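/- All von Neumann algebras have separable predual and all Hilbert spaces are separable. For a von Neumann algebra $P$ and a free ultrafilter $\omega$ on $\mathbb N$, let $A_\omega(P)$ be the algebra of bounded sequences $(x_n)_n$ in $P$ with $\lim_{n\to\omega}\|f(\,\cdot\,x_n)-f(x_n\,\cdot\,)\|_{P_*}=0$ for all $f\in P_*$, let $J_\omega(P)\subset A_\omega(P)$ be the ideal of bounded sequences that tend to $0$ in the $*$-strong topology along $\omega$, and put $P_\omega:=A_\omega(P)/J_\omega(P)$. A factor $P$ is called full if the group $\mathrm{Inn}(P)$ of inner automorphisms is closed in $\mathrm{Aut}(P)$ for the u-topology, i.e. the topology of pointwise norm convergence on $P_*$. Let $M$ and $N$ be factors. Represent $M$ on $L^2(M)$, the GNS space of a (any) faithful normal state of $M$, let $M'$ be the commutant of $M$ there, let $C^*\{M,M'\}\subset\mathbb B(L^2(M))$ be the $C^*$-algebra generated by $M$ and $M'$, and let $\mathbb K(L^2(M))$ be the compact operators. Assume that $$C^*\{M,M'\}\cap\mathbb K(L^2(M))\neq 0 .$$ Then, for every free ultrafilter $\omega$ on $\mathbb N$, the map $$N_\omega\to(M\mathbin{\bar\otimes}N)_\omega,\qquad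 (x_n)_n\mapsto(1\otimes x_n)_n,$$ is a well-defined homomorphism of algebras and is surjective. In particular, if $N$ is full (where $N=\mathbb C$ is allowed), then $M\mathbin{\bar\otimes}N$ is a full factor. -/

import Mathlib

open Filter Topology
open scoped InnerProductSpace TensorProduct ComplexOrder

namespace VonNeumannAlgebra

section Basic

variable {H : Type*} [NormedAddCommGroup H] [InnerProductSpace ℂ H] [CompleteSpace H]

/-- The elements of a von Neumann algebra, as a type. -/
abbrev Elem (M : VonNeumannAlgebra H) : Type _ := M.toStarSubalgebra

theorem isClosed_coe (M : VonNeumannAlgebra H) :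
    IsClosed (M.toStarSubalgebra : Set (H →L[ℂ] H)) := by
  have h : (M.toStarSubalgebra : Set (H →L[ℂ] H)) =
      Set.centralizer (Set.centralizer (M : Set (H →L[ℂ] H))) := M.centralizer_centralizer.symm
  rw [h]
  exact Set.isClosed_centralizer _

noncomputable instance instCStarAlgebraElem (M : VonNeumannAlgebra H) : CStarAlgebra M.Elem :=
  haveI := M.isClosed_coe
  StarSubalgebra.cstarAlgebra M.toStarSubalgebra

/-- The order of `M.Elem` is the one inherited from the bounded operators, so `0 ≤ x` means that
`x` is a positive operator. -/
instance instStarOrderedRingElem (M : VonNeumannAlgebra H) : StarOrderedRing M.Elem := by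
  refine StarOrderedRing.of_nonneg_iff' (fun {x y} h z => ?_) (fun x => ?_)
  · exact add_le_add_right (α := H →L[ℂ] H) h z
  · constructor
    · intro hx
      have hx' : (0 : H →L[ℂ] H) ≤ x := hx
      have hmem : CFC.sqrt (x : H →L[ℂ] H) ∈ (M : Set (H →L[ℂ] H)) := by
        rw [← M.centralizer_centralizer]
        intro y hy
        have hc : Commute (x : H →L[ℂ] H) y := hy _ x.2
        exact (hc.cfcₙ_nnreal NNReal.sqrt).symm
      refine ⟨⟨_, hmem⟩, Subtype.ext ?_⟩
      change (x : H →L[ℂ] H) = star (CFC.sqrt (x : H →L[ℂ] H)) * CFC.sqrt (x : H →L[ℂ] H)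
      rw [(CFC.sqrt_nonneg (x : H →L[ℂ] H)).isSelfAdjoint.star_eq,
        CFC.sqrt_mul_sqrt_self (x : H →L[ℂ] H) hx']
    · rintro ⟨s, rfl⟩
      exact star_mul_self_nonneg (s : H →L[ℂ] H)

/-- A factor: a nonzero von Neumann algebra whose center consists of the scalars. -/
def IsFactor (M : VonNeumannAlgebra H) : Prop :=
  Nontrivial H ∧ ∀ x ∈ M, x ∈ M.commutant → ∃ c : ℂ, x = c • (1 : H →L[ℂ] H)

/-- The von Neumann algebra generated by a set of bounded operators: the double commutant of
`S ∪ S*`. -/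
noncomputable def generated (S : Set (H →L[ℂ] H)) : VonNeumannAlgebra H where
  toStarSubalgebra :=
    StarSubalgebra.centralizer ℂ (StarSubalgebra.centralizer ℂ S : Set (H →L[ℂ] H))
  centralizer_centralizer' := by
    change Set.centralizer (Set.centralizer ((StarSubalgebra.centralizer ℂ
      (StarSubalgebra.centralizer ℂ S : Set (H →L[ℂ] H)) : StarSubalgebra ℂ (H →L[ℂ] H)) :
      Set (H →L[ℂ] H))) = ((StarSubalgebra.centralizer ℂ
      (StarSubalgebra.centralizer ℂ S : Set (H →L[ℂ] H)) : StarSubalgebra ℂ (H →L[ℂ] H)) :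
      Set (H →L[ℂ] H))
    rw [StarSubalgebra.coe_centralizer_centralizer, Set.centralizer_centralizer_centralizer]

theorem subset_generated (S : Set (H →L[ℂ] H)) {x : H →L[ℂ] H} (hx : x ∈ S) :
    x ∈ (generated S).toStarSubalgebra := by
  have h : x ∈ SetLike.coe (StarSubalgebra.centralizer ℂ
      (StarSubalgebra.centralizer ℂ S : Set (H →L[ℂ] H))) := by
    rw [StarSubalgebra.coe_centralizer_centralizer]
    exact Set.subset_centralizer_centralizer (Or.inl hx)
  exact h

/-- Normality (σ-weak continuity) of a functional on `M`: it is of the form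
`x ↦ ∑ ⟨x ξₙ, ηₙ⟩` with `∑ ‖ξₙ‖² < ∞` and `∑ ‖ηₙ‖² < ∞`. -/
def IsNormal {M : VonNeumannAlgebra H} (f : M.Elem → ℂ) : Prop :=
  ∃ ξ η : ℕ → H, Summable (fun n => ‖ξ n‖ ^ 2) ∧ Summable (fun n => ‖η n‖ ^ 2) ∧
    ∀ x : M.Elem, HasSum (fun n => ⟪η n, (x : H →L[ℂ] H) (ξ n)⟫_ℂ) (f x)

/-- The predual `M_*`, as a set of elements of the dual Banach space of `M`. -/
def predual (M : VonNeumannAlgebra H) : Set (M.Elem →L[ℂ] ℂ) := {f | IsNormal f}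

/-- Faithful normal states. -/
structure IsFaithfulNormalState {M : VonNeumannAlgebra H} (φ : M.Elem →ₚ[ℂ] ℂ) : Prop where
  normal : IsNormal φ
  map_one : φ 1 = 1
  faithful : ∀ x : M.Elem, φ (star x * x) = 0 → x = 0

/-- For a positive functional `φ` on `M`, with GNS space `L²(M, φ)`, the unital C*-algebra
`C*{M, M'}` generated in `𝔹(L²(M, φ))` by the image of `M` and its commutant. -/
noncomputable def cstarLeftRight {M : VonNeumannAlgebra H} (φ : M.Elem →ₚ[ℂ] ℂ) :
    StarSubalgebra ℂ (φ.GNS →L[ℂ] φ.GNS) :=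
  (StarAlgebra.adjoin ℂ (Set.range φ.gnsStarAlgHom ∪
    Set.centralizer (Set.range φ.gnsStarAlgHom))).topologicalClosure

/-- A *-automorphism of `M`, as a bounded linear map. -/
noncomputable def autCLM {M : VonNeumannAlgebra H} (θ : M.Elem ≃⋆ₐ[ℂ] M.Elem) :
    M.Elem →L[ℂ] M.Elem :=
  LinearMap.mkContinuous
    { toFun := fun x => θ x
      map_add' := fun x y => map_add θ x y
      map_smul' := fun c x => map_smul θ c x } 1 (fun x => by
        simpa using NonUnitalStarAlgHom.norm_apply_le θ x)

/-- The u-topology on `Aut(M)`: pointwise norm convergence of `f ∘ θ` in the dual of `M`, for all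
`f` in the predual. (Inversion of automorphisms is continuous for it, because automorphisms act
isometrically; so replacing `f ∘ θ` by `f ∘ θ⁻¹` gives the same topology.) -/
@[reducible]
noncomputable def uTopology (M : VonNeumannAlgebra H) :
    TopologicalSpace (M.Elem ≃⋆ₐ[ℂ] M.Elem) :=
  TopologicalSpace.induced
    (fun θ => fun f : M.predual => (f : M.Elem →L[ℂ] ℂ).comp (autCLM θ))
    Pi.topologicalSpace

/-- The inner automorphisms `x ↦ u x u*` of `M`, with `u` a unitary of `M`. -/
def innerAut (M : VonNeumannAlgebra H) : Set (M.Elem ≃⋆ₐ[ℂ] M.Elem) :=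
  Set.range (Unitary.conjStarAlgAut ℂ M.Elem)

/-- A full factor: a factor such that `Inn(M)` is closed in `Aut(M)` in the u-topology. -/
def IsFull (M : VonNeumannAlgebra H) : Prop :=
  M.IsFactor ∧ IsClosed[M.uTopology] M.innerAut

/-- The functional `z ↦ f (z x) - f (x z)`. -/
noncomputable def comm {M : VonNeumannAlgebra H} (f : M.Elem →L[ℂ] ℂ) (x : M.Elem) :
    M.Elem →L[ℂ] ℂ :=
  f.comp ((ContinuousLinearMap.mul ℂ M.Elem).flip x) - f.comp (ContinuousLinearMap.mul ℂ M.Elem x)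

theorem comm_apply {M : VonNeumannAlgebra H} (f : M.Elem →L[ℂ] ℂ) (x z : M.Elem) :
    comm f x z = f (z * x) - f (x * z) := by
  simp [comm]

theorem norm_comm_apply_le {M : VonNeumannAlgebra H} (f : M.Elem →L[ℂ] ℂ) (x z : M.Elem) :
    ‖f (z * x) - f (x * z)‖ ≤ ‖comm f x‖ * ‖z‖ := by
  rw [← comm_apply]
  exact (comm f x).le_opNorm z

/-- The functional `x ↦ conj (f x*)`. -/
noncomputable def conjFunctional {M : VonNeumannAlgebra H} (f : M.Elem →L[ℂ] ℂ) :
    M.Elem →L[ℂ] ℂ :=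
  LinearMap.mkContinuous
    { toFun := fun x => star (f (star x))
      map_add' := by intro x y; simp
      map_smul' := by intro c x; simp } ‖f‖ (by
        intro x
        simpa using f.le_opNorm (star x))

theorem conjFunctional_apply {M : VonNeumannAlgebra H} (f : M.Elem →L[ℂ] ℂ) (x : M.Elem) :
    conjFunctional f x = star (f (star x)) := rfl

theorem conjFunctional_mem {M : VonNeumannAlgebra H} {f : M.Elem →L[ℂ] ℂ} (hf : f ∈ M.predual) :
    conjFunctional f ∈ M.predual := by
  obtain ⟨ξ, η, hξ, hη, h⟩ := hf
  refine ⟨η, ξ, hη, hξ, fun x => ?_⟩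
  have h1 := (h (star x)).star
  rw [conjFunctional_apply]
  convert h1 using 2 with n
  have : ((star x : M.Elem) : H →L[ℂ] H) = ContinuousLinearMap.adjoint (x : H →L[ℂ] H) := rfl
  rw [this, ContinuousLinearMap.adjoint_inner_right]
  exact (inner_conj_symm _ _).symm

theorem norm_comm_star_le {M : VonNeumannAlgebra H} (f : M.Elem →L[ℂ] ℂ) (x : M.Elem) :
    ‖comm f (star x)‖ ≤ ‖comm (conjFunctional f) x‖ := by
  refine ContinuousLinearMap.opNorm_le_bound _ (norm_nonneg _) fun z => ?_
  have h := norm_comm_apply_le (conjFunctional f) x (star z)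
  rw [comm_apply]
  rw [conjFunctional_apply, conjFunctional_apply, ← star_sub, norm_star, star_mul, star_mul,
    star_star, norm_star] at h
  rw [norm_sub_rev]
  exact h

theorem norm_comm_mul_le {M : VonNeumannAlgebra H} (f : M.Elem →L[ℂ] ℂ) (x y : M.Elem) :
    ‖comm f (x * y)‖ ≤ ‖comm f y‖ * ‖x‖ + ‖comm f x‖ * ‖y‖ := by
  refine ContinuousLinearMap.opNorm_le_bound _ (by positivity) fun z => ?_
  have h1 := norm_comm_apply_le f y (z * x)
  have h2 := norm_comm_apply_le f x (y * z)
  rw [comm_apply]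
  have e : f (z * (x * y)) - f (x * y * z) =
      (f (z * x * y) - f (y * (z * x))) + (f (y * z * x) - f (x * (y * z))) := by
    simp only [mul_assoc]; ring
  rw [e]
  calc _ ≤ ‖comm f y‖ * ‖z * x‖ + ‖comm f x‖ * ‖y * z‖ :=
        (norm_add_le _ _).trans (add_le_add h1 h2)
    _ ≤ ‖comm f y‖ * (‖z‖ * ‖x‖) + ‖comm f x‖ * (‖y‖ * ‖z‖) := by
        gcongr <;> exact norm_mul_le _ _
    _ = _ := by ring

/-- The algebra `A_ω` of bounded sequences in `M` with `‖f(· xₙ) - f(xₙ ·)‖ → 0` along `ω`, for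
every `f` in the predual. -/
noncomputable def centralizingSeq (M : VonNeumannAlgebra H) (ω : Ultrafilter ℕ) :
    StarSubalgebra ℂ (ℕ → M.Elem) where
  carrier := {x | (∃ C : ℝ, ∀ n, ‖x n‖ ≤ C) ∧
    ∀ f ∈ M.predual, Tendsto (fun n => ‖comm f (x n)‖) ω (𝓝 0)}
  mul_mem' := by
    rintro x y ⟨⟨C, hC⟩, hx⟩ ⟨⟨D, hD⟩, hy⟩
    have hC0 : 0 ≤ C := (norm_nonneg _).trans (hC 0)
    refine ⟨⟨C * D, fun n => ?_⟩, fun f hf => ?_⟩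
    · exact (norm_mul_le _ _).trans (mul_le_mul (hC n) (hD n) (norm_nonneg _) hC0)
    · have h := ((hy f hf).mul_const C).add ((hx f hf).mul_const D)
      rw [zero_mul, zero_mul, add_zero] at h
      refine squeeze_zero (fun _ => norm_nonneg _) (fun n => ?_) h
      refine (norm_comm_mul_le f (x n) (y n)).trans ?_
      gcongr
      · exact hC n
      · exact hD n
  add_mem' := by
    rintro x y ⟨⟨C, hC⟩, hx⟩ ⟨⟨D, hD⟩, hy⟩
    refine ⟨⟨C + D, fun n => (norm_add_le _ _).trans (add_le_add (hC n) (hD n))⟩, fun f hf => ?_⟩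
    have h := (hx f hf).add (hy f hf)
    rw [add_zero] at h
    refine squeeze_zero (fun _ => norm_nonneg _) (fun n => ?_) h
    have e : comm f ((x + y) n) = comm f (x n) + comm f (y n) := by
      ext z; simp [comm_apply, mul_add, add_mul]; ring
    rw [e]
    exact norm_add_le _ _
  algebraMap_mem' := by
    intro c
    refine ⟨⟨‖algebraMap ℂ M.Elem c‖, fun n => le_rfl⟩, fun f _ => ?_⟩
    have e : ∀ n, comm f (algebraMap ℂ (ℕ → M.Elem) c n) = 0 := by
      intro n
      ext z
      rw [comm_apply, Pi.algebraMap_apply, Algebra.commutes, sub_self]; rfl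
    simpa only [e, norm_zero] using tendsto_const_nhds
  star_mem' := by
    rintro x ⟨⟨C, hC⟩, hx⟩
    refine ⟨⟨C, fun n => (norm_star (x n)).trans_le (hC n)⟩, fun f hf => ?_⟩
    exact squeeze_zero (fun _ => norm_nonneg _) (fun n => norm_comm_star_le f (x n))
      (hx _ (conjFunctional_mem hf))

/-- Convergence to `0` along `ω` in the *-strong topology. -/
def StarStronglyNull {M : VonNeumannAlgebra H} (ω : Ultrafilter ℕ) (x : ℕ → M.Elem) : Prop :=
  ∀ ξ : H, Tendsto (fun n => (x n : H →L[ℂ] H) ξ) ω (𝓝 0) ∧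
    Tendsto (fun n => (star (x n) : H →L[ℂ] H) ξ) ω (𝓝 0)

theorem tendsto_mul_left {H : Type*} [NormedAddCommGroup H] [InnerProductSpace ℂ H] {ω : Ultrafilter ℕ} {x : ℕ → H →L[ℂ] H} {y : ℕ → H →L[ℂ] H}
    {C : ℝ} (hy : ∀ n, ‖y n‖ ≤ C) {ξ : H} (hx : Tendsto (fun n => x n ξ) ω (𝓝 0)) :
    Tendsto (fun n => (y n * x n) ξ) ω (𝓝 0) := by
  rw [tendsto_zero_iff_norm_tendsto_zero] at hx ⊢
  have h := hx.const_mul C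
  rw [mul_zero] at h
  refine squeeze_zero (fun _ => norm_nonneg _) (fun n => ?_) h
  exact ((y n).le_opNorm _).trans (mul_le_mul_of_nonneg_right (hy n) (norm_nonneg _))

/-- The vector functional `x ↦ ⟨x ξ, η⟩`. -/
noncomputable def vectorFunctional (M : VonNeumannAlgebra H) (ξ η : H) : M.Elem →L[ℂ] ℂ :=
  LinearMap.mkContinuous
    { toFun := fun x => ⟪η, (x : H →L[ℂ] H) ξ⟫_ℂ
      map_add' := by intro x y; simp
      map_smul' := by intro c x; simp } (‖η‖ * ‖ξ‖) (by
        intro x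
        refine (norm_inner_le_norm _ _).trans ?_
        calc _ ≤ ‖η‖ * (‖(x : H →L[ℂ] H)‖ * ‖ξ‖) := by
              gcongr; exact (x : H →L[ℂ] H).le_opNorm ξ
          _ = ‖η‖ * ‖ξ‖ * ‖x‖ := by
              change _ = ‖η‖ * ‖ξ‖ * ‖(x : H →L[ℂ] H)‖
              ring)

theorem vectorFunctional_apply (M : VonNeumannAlgebra H) (ξ η : H) (x : M.Elem) :
    M.vectorFunctional ξ η x = ⟪η, (x : H →L[ℂ] H) ξ⟫_ℂ := rfl

theorem vectorFunctional_mem (M : VonNeumannAlgebra H) (ξ η : H) :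
    M.vectorFunctional ξ η ∈ M.predual := by
  refine ⟨Pi.single 0 ξ, Pi.single 0 η, ?_, ?_, fun x => ?_⟩
  · exact summable_of_ne_finset_zero (s := {0}) (by
      intro n hn; rw [Finset.notMem_singleton] at hn; simp [hn])
  · exact summable_of_ne_finset_zero (s := {0}) (by
      intro n hn; rw [Finset.notMem_singleton] at hn; simp [hn])
  · have h := hasSum_single (f := fun n => ⟪(Pi.single 0 η : ℕ → H) n,
      (x : H →L[ℂ] H) ((Pi.single 0 ξ : ℕ → H) n)⟫_ℂ) 0 (by
        intro n hn; simp [hn])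
    simpa [vectorFunctional_apply] using h

theorem tendsto_mul_right {M : VonNeumannAlgebra H} {ω : Ultrafilter ℕ} {x y : ℕ → M.Elem}
    {C : ℝ} (hC : ∀ n, ‖x n‖ ≤ C) (hy : y ∈ M.centralizingSeq ω)
    (hx : ∀ ξ : H, Tendsto (fun n => (x n : H →L[ℂ] H) ξ) ω (𝓝 0)) (ξ : H) :
    Tendsto (fun n => ((x n : H →L[ℂ] H) * (y n : H →L[ℂ] H)) ξ) ω (𝓝 0) := by
  obtain ⟨⟨D, hD⟩, hy⟩ := hy
  have hC0 : 0 ≤ C := (norm_nonneg _).trans (hC 0)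
  have hD0 : 0 ≤ D := (norm_nonneg _).trans (hD 0)
  set f := M.vectorFunctional ξ ξ with hf
  let w : ℕ → M.Elem := fun n => star (y n) * (star (x n) * x n)
  have hsx : ∀ n, ‖star (x n) * x n‖ ≤ C * C := fun n =>
    (norm_mul_le _ _).trans
      (mul_le_mul ((norm_star (x n)).trans_le (hC n)) (hC n) (norm_nonneg _) hC0)
  have hw : ∀ n, ‖w n‖ ≤ D * (C * C) := fun n =>
    (norm_mul_le _ _).trans
      (mul_le_mul ((norm_star (y n)).trans_le (hD n)) (hsx n) (norm_nonneg _) hD0)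
  have key : ∀ n, ‖((x n : H →L[ℂ] H) * (y n : H →L[ℂ] H)) ξ‖ ^ 2 ≤
      ‖comm f (y n)‖ * (D * (C * C)) + ‖ξ‖ * (D * D * C * ‖(x n : H →L[ℂ] H) ξ‖) := by
    intro n
    have e1 : f (w n * y n) =
        ((‖((x n : H →L[ℂ] H) * (y n : H →L[ℂ] H)) ξ‖ ^ 2 : ℝ) : ℂ) := by
      have e : ((w n * y n : M.Elem) : H →L[ℂ] H) =
          ContinuousLinearMap.adjoint ((x n : H →L[ℂ] H) * (y n : H →L[ℂ] H)) *
            ((x n : H →L[ℂ] H) * (y n : H →L[ℂ] H)) := by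
        change star (y n : H →L[ℂ] H) * (star (x n : H →L[ℂ] H) * (x n : H →L[ℂ] H)) *
          (y n : H →L[ℂ] H) = star ((x n : H →L[ℂ] H) * (y n : H →L[ℂ] H)) * _
        rw [star_mul]; simp only [mul_assoc]
      rw [hf, vectorFunctional_apply, e, _root_.mul_apply_eq_comp,
        ContinuousLinearMap.adjoint_inner_right, inner_self_eq_norm_sq_to_K]
      push_cast; rfl
    have e2 : ‖f (y n * w n)‖ ≤ ‖ξ‖ * (D * D * C * ‖(x n : H →L[ℂ] H) ξ‖) := by
      rw [hf, vectorFunctional_apply]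
      refine (norm_inner_le_norm _ _).trans ?_
      gcongr
      change ‖((y n * (star (y n) * star (x n)) : M.Elem) : H →L[ℂ] H)
        ((x n : H →L[ℂ] H) ξ)‖ ≤ _
      refine (ContinuousLinearMap.le_opNorm _ _).trans ?_
      gcongr
      change ‖(y n * (star (y n) * star (x n)) : M.Elem)‖ ≤ _
      calc _ ≤ ‖y n‖ * (‖star (y n)‖ * ‖star (x n)‖) :=
            (norm_mul_le _ _).trans (by gcongr; exact norm_mul_le _ _)
        _ ≤ D * (D * C) := by
            rw [norm_star, norm_star]
            gcongr
            · exact hD n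
            · exact hD n
            · exact hC n
        _ = _ := by ring
    have e3 : ‖f (w n * y n) - f (y n * w n)‖ ≤ ‖comm f (y n)‖ * (D * (C * C)) :=
      (norm_comm_apply_le f (y n) (w n)).trans (by gcongr; exact hw n)
    calc _ = ‖f (w n * y n)‖ := by
          rw [e1, Complex.norm_real, Real.norm_of_nonneg (by positivity)]
      _ = ‖(f (w n * y n) - f (y n * w n)) + f (y n * w n)‖ := by rw [sub_add_cancel]
      _ ≤ _ := (norm_add_le _ _).trans (add_le_add e3 e2)
  have hlim : Tendsto (fun n => ‖comm f (y n)‖ * (D * (C * C)) +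
      ‖ξ‖ * (D * D * C * ‖(x n : H →L[ℂ] H) ξ‖)) ω (𝓝 0) := by
    have h1 := (hy f (vectorFunctional_mem M ξ ξ)).mul_const (D * (C * C))
    have h2 := ((tendsto_zero_iff_norm_tendsto_zero.mp (hx ξ)).const_mul (D * D * C)).const_mul ‖ξ‖
    simpa using h1.add h2
  have hsq := squeeze_zero (fun n => by positivity) key hlim
  rw [tendsto_zero_iff_norm_tendsto_zero]
  have := hsq.sqrt
  simpa [Real.sqrt_sq (norm_nonneg _)] using this

/-- The ideal `J_ω` of `A_ω` of the sequences that tend to `0` *-strongly along `ω`. -/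
noncomputable def nullSeq (M : VonNeumannAlgebra H) (ω : Ultrafilter ℕ) :
    Ideal (M.centralizingSeq ω) where
  carrier := {x | StarStronglyNull ω (x : ℕ → M.Elem)}
  add_mem' := by
    intro x y hx hy ξ
    have h1 := (hx ξ).1.add (hy ξ).1
    have h2 := (hx ξ).2.add (hy ξ).2
    rw [add_zero] at h1 h2
    refine ⟨h1, ?_⟩
    convert h2 using 2 with n
    change (star ((x : ℕ → M.Elem) n + (y : ℕ → M.Elem) n : H →L[ℂ] H)) ξ = _
    rw [star_add]; rfl
  zero_mem' := by
    intro ξ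
    constructor <;> simp
  smul_mem' := by
    intro y x hx ξ
    obtain ⟨⟨C, hC⟩, -⟩ := x.2
    obtain ⟨⟨D, hD⟩, -⟩ := y.2
    refine ⟨tendsto_mul_left (y := fun n => ((y : ℕ → M.Elem) n : H →L[ℂ] H)) hD (hx ξ).1, ?_⟩
    have h := tendsto_mul_right (x := star (x : ℕ → M.Elem)) (y := star (y : ℕ → M.Elem))
      (fun n => (norm_star ((x : ℕ → M.Elem) n)).trans_le (hC n)) (star_mem y.2)
      (fun ζ => (hx ζ).2) ξ
    convert h using 2 with n
    change (star (((y : ℕ → M.Elem) n : H →L[ℂ] H) * ((x : ℕ → M.Elem) n : H →L[ℂ] H))) ξ = _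
    rw [star_mul]; rfl

instance instIsTwoSidedNullSeq (M : VonNeumannAlgebra H) (ω : Ultrafilter ℕ) :
    (M.nullSeq ω).IsTwoSided where
  mul_mem_of_left := by
    intro x y hx ξ
    obtain ⟨⟨C, hC⟩, -⟩ := x.2
    obtain ⟨⟨D, hD⟩, -⟩ := y.2
    refine ⟨tendsto_mul_right hC y.2 (fun ζ => (hx ζ).1) ξ, ?_⟩
    have h := tendsto_mul_left (x := fun n => star ((x : ℕ → M.Elem) n : H →L[ℂ] H))
      (y := fun n => star ((y : ℕ → M.Elem) n : H →L[ℂ] H))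
      (fun n => (norm_star ((y : ℕ → M.Elem) n)).trans_le (hD n)) (hx ξ).2
    convert h using 2 with n
    change (star (((x : ℕ → M.Elem) n : H →L[ℂ] H) * ((y : ℕ → M.Elem) n : H →L[ℂ] H))) ξ = _
    rw [star_mul]

/-- The asymptotic centralizer `M_ω = A_ω / J_ω`. -/
abbrev AsymptoticCentralizer (M : VonNeumannAlgebra H) (ω : Ultrafilter ℕ) : Type _ :=
  M.centralizingSeq ω ⧸ M.nullSeq ω

/-- The class in `M_ω` of a sequence in `A_ω`. -/
noncomputable def toAsymptoticCentralizer (M : VonNeumannAlgebra H) (ω : Ultrafilter ℕ)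
    (x : M.centralizingSeq ω) : M.AsymptoticCentralizer ω :=
  Ideal.Quotient.mk (M.nullSeq ω) x

end Basic

section Tensor

variable {H K : Type*} [NormedAddCommGroup H] [InnerProductSpace ℂ H] [CompleteSpace H]
  [NormedAddCommGroup K] [InnerProductSpace ℂ K] [CompleteSpace K]

variable (H K) in
/-- The Hilbert space tensor product. -/
abbrev HilbertTensor : Type _ := UniformSpace.Completion (H ⊗[ℂ] K)

/-- The bounded operator `a ⊗ b` on the Hilbert space tensor product. -/
noncomputable def opTensor (a : H →L[ℂ] H) (b : K →L[ℂ] K) :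
    HilbertTensor H K →L[ℂ] HilbertTensor H K :=
  (TensorProduct.mapL a b).completion

/-- The von Neumann algebra tensor product: the von Neumann algebra on the Hilbert space tensor
product that is generated by the operators `a ⊗ b`, `a ∈ M`, `b ∈ N`. -/
noncomputable def tensor (M : VonNeumannAlgebra H) (N : VonNeumannAlgebra K) :
    VonNeumannAlgebra (HilbertTensor H K) :=
  generated {T | ∃ a ∈ M, ∃ b ∈ N, T = opTensor a b}

/-- The element `1 ⊗ b` of the von Neumann algebra tensor product. -/
noncomputable def oneTensor (M : VonNeumannAlgebra H) {N : VonNeumannAlgebra K} (b : N.Elem) :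
    (M.tensor N).Elem :=
  ⟨opTensor 1 (b : K →L[ℂ] K), subset_generated _ ⟨1, one_mem M, b, b.2, rfl⟩⟩

end Tensor

end VonNeumannAlgebra

/-!
Write `P = M ⊗ N`. A bounded family `x` in `P` is *asymptotically central* along a filter if `‖f(·
xᵢ) - f(xᵢ ·)‖ → 0` for every normal `f`.

**Surjectivity.** The GNS representation of a normal state of `M` is intertwined with an
amplification of the given representation by an operator of dense range, so a nonzero compact
operator in `C*{M, M'}` on the GNS space yields one, `S`, in the norm closure of the span of `M M'`
on the original space (`exists_compact_commSpan`). Fix a unit vector `ξ₀` and let `y = (ω_{ξ₀} ⊗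
id)(x)` be the slice of an asymptotically central family `x` of `P`; it is asymptotically central in
`N`. Weak limits of the other slices of `x` commute with `M` and `M'`, so they are scalar because
`M` is a factor, and hence every slice of `x` by `ω_{ξ, v}` is strongly asymptotic to `⟨v, ξ⟩ y`
(`IsAsympCentral.tendsto_slice_sub`). So all slices of `z = x - 1 ⊗ y` tend to `0`, and the compact
`S` turns this into `(S ⊗ 1) z → 0`. As `x` asymptotically commutes with `M M' ⊗ 1`, and so does `1
⊗ y`, also `z (S ⊗ 1) → 0`. The vectors `u` with `z (u ⊗ η) → 0` for all `η` thus form a nonzero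
closed subspace that is invariant under `M` and `M'`, and it is everything
(`IsAsympCentral.tendsto_sub_ampR_slice`). So `x` and `1 ⊗ y` have the same class.

**Fullness.** Let `N` be full. Its unitary group, with the topology induced by `u ↦ Ad u`, is
complete: norm limits of inner automorphisms on the predual are automorphisms
(`exists_aut_of_tendsto`), and these are inner. The successive approximation of the open mapping
theorem then shows that, if `Ad u` is close to the identity, it is implemented by a strong limit of
products of unitaries close to `1`, so that `u` is almost scalar
(`IsFull.nearly_scalar_mem_nhds_one`). By the Cayley transform, all asymptotically central families
of `N` are asymptotically scalar (`IsFull.tendsto_offScalar`), and by the first part the same holds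
for `P`. Finally, if `Ad uᵢ → θ` in `Aut(P)`, then `uᵢ uⱼ*` is asymptotically central, hence
asymptotically scalar; along an ultrafilter the phases converge, so `uᵢ*` converges strongly, and
the limit is a unitary that implements `θ` (`isClosed_innerAut`).
-/


/-! ### Weak limits along ultrafilters -/

section WeakLimits

variable {ι E F : Type*} [NormedAddCommGroup E] [InnerProductSpace ℂ E]
  [NormedAddCommGroup F] [InnerProductSpace ℂ F] [CompleteSpace F]

theorem Ultrafilter.exists_tendsto_of_norm_le {V : Type*} [NormedAddCommGroup V] [ProperSpace V]
    (ω : Ultrafilter ι) {c : ι → V} {C : ℝ} (hc : ∀ i, ‖c i‖ ≤ C) :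
    ∃ a, Tendsto c ω (𝓝 a) := by
  obtain ⟨a, -, ha⟩ := (isCompact_closedBall (0 : V) C).ultrafilter_le_nhds (ω.map c)
    (by
      rw [le_principal_iff]
      exact Filter.mem_map.mpr (Eventually.of_forall fun i => by simpa using hc i))
  exact ⟨a, ha⟩

/-- Bounded families of vectors converge weakly along ultrafilters. -/
theorem Ultrafilter.exists_weak_limit (ω : Ultrafilter ι) {k : ι → F} {C : ℝ}
    (hk : ∀ i, ‖k i‖ ≤ C) :
    ∃ a : F, ∀ η : F, Tendsto (fun i => ⟪η, k i⟫_ℂ) ω (𝓝 ⟪η, a⟫_ℂ) := by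
  have h : ∀ η : F, ∃ a, Tendsto (fun i => ⟪k i, η⟫_ℂ) ω (𝓝 a) := fun η =>
    ω.exists_tendsto_of_norm_le (C := C * ‖η‖) fun i =>
      (norm_inner_le_norm _ _).trans (by gcongr; exact hk i)
  choose l hl using h
  let L : F →L[ℂ] ℂ := LinearMap.mkContinuous
    { toFun := l
      map_add' := fun x y => tendsto_nhds_unique (hl (x + y)) (by
        simpa only [inner_add_right] using (hl x).add (hl y))
      map_smul' := fun c x => tendsto_nhds_unique (hl (c • x)) (by
        simpa only [inner_smul_right, RingHom.id_apply, smul_eq_mul] using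
          (hl x).const_mul c) } C (fun x =>
      le_of_tendsto (hl x).norm (Eventually.of_forall fun i =>
        (norm_inner_le_norm _ _).trans (by gcongr; exact hk i)))
  refine ⟨(InnerProductSpace.toDual ℂ F).symm L, fun η => ?_⟩
  have h2 : ⟪(InnerProductSpace.toDual ℂ F).symm L, η⟫_ℂ = l η :=
    InnerProductSpace.toDual_symm_apply
  have h1 := (hl η).star
  rw [← h2] at h1
  simpa only [Complex.star_def, inner_conj_symm] using h1

/-- Bounded families of operators converge in the weak operator topology along ultrafilters. -/
theorem Ultrafilter.exists_wot_limit (ω : Ultrafilter ι) {T : ι → E →L[ℂ] F} {C : ℝ}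
    (hT : ∀ i, ‖T i‖ ≤ C) :
    ∃ S : E →L[ℂ] F, ∀ (ξ : E) (η : F),
      Tendsto (fun i => ⟪η, T i ξ⟫_ℂ) ω (𝓝 ⟪η, S ξ⟫_ℂ) := by
  have hb : ∀ ξ i, ‖T i ξ‖ ≤ C * ‖ξ‖ := fun ξ i =>
    ((T i).le_opNorm ξ).trans (by gcongr; exact hT i)
  choose s hs using fun ξ => ω.exists_weak_limit (hb ξ)
  refine ⟨LinearMap.mkContinuous
    { toFun := s
      map_add' := fun x y => ext_inner_left ℂ fun η => tendsto_nhds_unique (hs (x + y) η) (by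
        simpa only [map_add, inner_add_right] using (hs x η).add (hs y η))
      map_smul' := fun c x => ext_inner_left ℂ fun η => tendsto_nhds_unique (hs (c • x) η) (by
        simpa only [map_smul, inner_smul_right, RingHom.id_apply] using
          (hs x η).const_mul c) } C (fun x => ?_), hs⟩
  rcases eq_or_ne (s x) 0 with h0 | h0
  · have : (0 : ℝ) ≤ C * ‖x‖ := by
      obtain ⟨i⟩ : Nonempty ι := ω.neBot.nonempty
      exact (norm_nonneg _).trans (hb x i)
    simpa [h0] using this
  · have h1 : ‖⟪s x, s x⟫_ℂ‖ ≤ ‖s x‖ * (C * ‖x‖) :=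
      le_of_tendsto (hs x (s x)).norm (Eventually.of_forall fun i =>
        (norm_inner_le_norm _ _).trans (by gcongr; exact hb x i))
    rw [norm_inner_symm, ← inner_self_re_eq_norm, inner_self_eq_norm_mul_norm] at h1
    exact le_of_mul_le_mul_left h1 (norm_pos_iff.mpr h0)

end WeakLimits

/-! ### The predual and asymptotically central families -/

namespace VonNeumannAlgebra

variable {H : Type*} [NormedAddCommGroup H] [InnerProductSpace ℂ H] [CompleteSpace H]

theorem mem_of_forall_commutant {M : VonNeumannAlgebra H} {x : H →L[ℂ] H}
    (h : ∀ y ∈ M.commutant, y * x = x * y) : x ∈ M := by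
  rw [← M.commutant_commutant]
  exact mem_commutant_iff.mpr h

theorem norm_vectorFunctional_le (M : VonNeumannAlgebra H) (ξ η : H) :
    ‖M.vectorFunctional ξ η‖ ≤ ‖η‖ * ‖ξ‖ :=
  LinearMap.mkContinuous_norm_le _ (by positivity) _

/-- The vector functionals span a norm-dense subspace of the predual. -/
theorem predual_subset_of_isClosed {M : VonNeumannAlgebra H} (S : Submodule ℂ (M.Elem →L[ℂ] ℂ))
    (hS : IsClosed (S : Set (M.Elem →L[ℂ] ℂ))) (h : ∀ ξ η, M.vectorFunctional ξ η ∈ S)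
    {f : M.Elem →L[ℂ] ℂ} (hf : f ∈ M.predual) : f ∈ S := by
  obtain ⟨ξ, η, hξ, hη, hs⟩ := hf
  have hsum : Summable fun n => M.vectorFunctional (ξ n) (η n) := by
    refine Summable.of_norm_bounded (hη.add hξ) fun n => ?_
    refine (M.norm_vectorFunctional_le _ _).trans ?_
    nlinarith [sq_nonneg (‖η n‖ - ‖ξ n‖), sq_nonneg (‖η n‖ + ‖ξ n‖)]
  have e : f = ∑' n, M.vectorFunctional (ξ n) (η n) := by
    ext x
    refine (hs x).unique ?_
    exact hsum.hasSum.mapL (ContinuousLinearMap.apply ℂ ℂ x)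
  rw [e]
  exact hS.mem_of_tendsto hsum.hasSum
    (Eventually.of_forall fun s => S.sum_mem fun n _ => h _ _)

/-- The vectors on which a family of semilinear maps tends to `0`. It is closed when the family is
bounded. -/
def nullSubmodule {ι V W : Type*} [NormedAddCommGroup V] [NormedSpace ℂ V] [NormedAddCommGroup W]
    [NormedSpace ℂ W] {σ : ℂ →+* ℂ} (l : Filter ι) (T : ι → V →ₛₗ[σ] W) : Submodule ℂ V where
  carrier := {f | Tendsto (fun i => T i f) l (𝓝 0)}
  add_mem' := fun {a b} ha hb => by simpa using Tendsto.add ha hb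
  zero_mem' := by simpa using tendsto_const_nhds
  smul_mem' := fun c a ha => by simpa using Tendsto.const_smul ha (σ c)

theorem isClosed_nullSubmodule {ι V W : Type*} [NormedAddCommGroup V] [NormedSpace ℂ V]
    [NormedAddCommGroup W] [NormedSpace ℂ W] {σ : ℂ →+* ℂ} (l : Filter ι)
    (T : ι → V →ₛₗ[σ] W) {C : ℝ}
    (hT : ∀ i v, ‖T i v‖ ≤ C * ‖v‖) : IsClosed (nullSubmodule l T : Set V) := by
  refine isClosed_of_closure_subset fun v hv => ?_
  change Tendsto (fun i => T i v) l (𝓝 0)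
  rw [Metric.tendsto_nhds]
  intro ε hε
  obtain ⟨w, hw, hvw⟩ := Metric.mem_closure_iff.mp hv (ε / 2 / (|C| + 1)) (by positivity)
  have hw' : Tendsto (fun i => T i w) l (𝓝 0) := hw
  filter_upwards [Metric.tendsto_nhds.mp hw' (ε / 2) (half_pos hε)] with i hi
  rw [dist_zero_right] at hi ⊢
  have h1 : ‖T i (v - w)‖ ≤ ε / 2 := by
    refine (hT i _).trans ?_
    rw [dist_eq_norm] at hvw
    calc C * ‖v - w‖ ≤ (|C| + 1) * (ε / 2 / (|C| + 1)) := by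
          gcongr
          linarith [le_abs_self C]
      _ = ε / 2 := by field_simp
  calc ‖T i v‖ = ‖T i (v - w) + T i w‖ := by rw [← map_add, sub_add_cancel]
    _ < ε := by linarith [norm_add_le (T i (v - w)) (T i w)]

/-- `comm` as a linear map in the functional. -/
noncomputable def commₗ {M : VonNeumannAlgebra H} (x : M.Elem) :
    (M.Elem →L[ℂ] ℂ) →ₗ[ℂ] (M.Elem →L[ℂ] ℂ) where
  toFun f := comm f x
  map_add' f g := by ext z; simp [comm_apply]; ring
  map_smul' c f := by ext z; simp [comm_apply]; ring

theorem norm_comm_le {M : VonNeumannAlgebra H} (f : M.Elem →L[ℂ] ℂ) (x : M.Elem) :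
    ‖comm f x‖ ≤ 2 * ‖x‖ * ‖f‖ := by
  refine ContinuousLinearMap.opNorm_le_bound _ (by positivity) fun z => ?_
  rw [comm_apply]
  calc _ ≤ ‖f (z * x)‖ + ‖f (x * z)‖ := norm_sub_le _ _
    _ ≤ ‖f‖ * (‖z‖ * ‖x‖) + ‖f‖ * (‖x‖ * ‖z‖) := by
        gcongr
        · exact (f.le_opNorm _).trans (by gcongr; exact norm_mul_le _ _)
        · exact (f.le_opNorm _).trans (by gcongr; exact norm_mul_le _ _)
    _ = _ := by ring

/-- A bounded family `x` in `M` with `‖f(· xᵢ) - f(xᵢ ·)‖ → 0` along the filter `l` for every `f`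
in the predual. -/
structure IsAsympCentral {ι : Type*} {M : VonNeumannAlgebra H} (l : Filter ι) (x : ι → M.Elem) :
    Prop where
  bounded : ∃ C : ℝ, ∀ i, ‖x i‖ ≤ C
  tendsto : ∀ f ∈ M.predual, Tendsto (fun i => ‖comm f (x i)‖) l (𝓝 0)

theorem IsAsympCentral.star_family {ι : Type*} {M : VonNeumannAlgebra H} {l : Filter ι}
    {x : ι → M.Elem} (h : IsAsympCentral l x) : IsAsympCentral l fun i => star (x i) := by
  obtain ⟨⟨C, hC⟩, hx⟩ := h
  exact ⟨⟨C, fun i => (norm_star (x i)).trans_le (hC i)⟩, fun f hf =>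
    squeeze_zero (fun _ => norm_nonneg _) (fun n => norm_comm_star_le f (x n))
      (hx _ (conjFunctional_mem hf))⟩

/-- It suffices to test asymptotic centrality on vector functionals. -/
theorem isAsympCentral_of_vectorFunctional {ι : Type*} {M : VonNeumannAlgebra H} {l : Filter ι}
    {x : ι → M.Elem} {C : ℝ} (hC : ∀ i, ‖x i‖ ≤ C)
    (h : ∀ ξ η, Tendsto (fun i => ‖comm (M.vectorFunctional ξ η) (x i)‖) l (𝓝 0)) :
    IsAsympCentral l x := by
  refine ⟨⟨C, hC⟩, fun f hf => ?_⟩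
  have := predual_subset_of_isClosed (nullSubmodule l fun i => commₗ (x i))
    (isClosed_nullSubmodule l _ (C := 2 * C) fun i v => (norm_comm_le v (x i)).trans (by
      gcongr; exact hC i)) (fun ξ η => tendsto_zero_iff_norm_tendsto_zero.mpr (h ξ η)) hf
  exact tendsto_zero_iff_norm_tendsto_zero.mp this

theorem coe_star_elem {M : VonNeumannAlgebra H} (x : M.Elem) :
    ((star x : M.Elem) : H →L[ℂ] H) = ContinuousLinearMap.adjoint (x : H →L[ℂ] H) := rfl

/-- Asymptotically central families commute asymptotically, in the strong topology, with the
elements of the algebra. -/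
theorem IsAsympCentral.tendsto_commutator {ι : Type*} {M : VonNeumannAlgebra H} {l : Filter ι}
    {x : ι → M.Elem} (h : IsAsympCentral l x) {a : H →L[ℂ] H} (ha : a ∈ M) (ξ : H) :
    Tendsto (fun i => ((x i).1 * a - a * (x i).1) ξ) l (𝓝 0) := by
  obtain ⟨⟨C, hC⟩, hx⟩ := h
  lift a to M.Elem using ha
  set f := M.vectorFunctional (a.1 ξ) ξ
  set g := M.vectorFunctional ξ ξ
  -- with `c = [x, a]*`, one has `g (c x a - c a x) = (f (c x) - f (x c)) + (g (x c a) - g (c a x))`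
  let c : ι → M.Elem := fun i => star (x i * a - a * x i)
  have hc : ∀ i, ‖c i‖ ≤ 2 * C * ‖a‖ := fun i => by
    rw [norm_star]
    calc _ ≤ ‖x i‖ * ‖a‖ + ‖a‖ * ‖x i‖ :=
          (norm_sub_le _ _).trans (add_le_add (norm_mul_le _ _) (norm_mul_le _ _))
      _ ≤ C * ‖a‖ + ‖a‖ * C := by gcongr <;> exact hC i
      _ = _ := by ring
  have key : ∀ i, ‖((x i).1 * a.1 - a.1 * (x i).1) ξ‖ ^ 2 ≤
      ‖comm f (x i)‖ * (2 * C * ‖a‖) + ‖comm g (x i)‖ * (2 * C * ‖a‖ * ‖a‖) := by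
    intro i
    have e1 : g (c i * (x i * a - a * x i)) =
        ((‖((x i).1 * a.1 - a.1 * (x i).1) ξ‖ ^ 2 : ℝ) : ℂ) := by
      change ⟪ξ, (ContinuousLinearMap.adjoint ((x i).1 * a.1 - a.1 * (x i).1) *
        ((x i).1 * a.1 - a.1 * (x i).1)) ξ⟫_ℂ = _
      rw [_root_.mul_apply_eq_comp, ContinuousLinearMap.adjoint_inner_right,
        inner_self_eq_norm_sq_to_K]
      push_cast; rfl
    have hfg : ∀ z : M.Elem, f z = g (z * a) := fun z => rfl
    have e2 : g (c i * (x i * a - a * x i)) =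
        (f (c i * x i) - f (x i * c i)) - (g ((c i * a) * x i) - g (x i * (c i * a))) := by
      rw [hfg, hfg, mul_sub, map_sub]
      simp only [mul_assoc]
      ring
    calc _ = ‖g (c i * (x i * a - a * x i))‖ := by
          rw [e1, Complex.norm_real, Real.norm_of_nonneg (by positivity)]
      _ ≤ ‖f (c i * x i) - f (x i * c i)‖ + ‖g ((c i * a) * x i) - g (x i * (c i * a))‖ := by
          rw [e2]; exact norm_sub_le _ _
      _ ≤ ‖comm f (x i)‖ * ‖c i‖ + ‖comm g (x i)‖ * ‖c i * a‖ :=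
          add_le_add (norm_comm_apply_le _ _ _) (norm_comm_apply_le _ _ _)
      _ ≤ _ := by
          gcongr
          · exact hc i
          · exact (norm_mul_le _ _).trans (by gcongr; exact hc i)
  have hlim : Tendsto (fun i => ‖comm f (x i)‖ * (2 * C * ‖a‖) +
      ‖comm g (x i)‖ * (2 * C * ‖a‖ * ‖a‖)) l (𝓝 0) := by
    simpa using ((hx f (vectorFunctional_mem M _ _)).mul_const (2 * C * ‖a‖)).add
      ((hx g (vectorFunctional_mem M _ _)).mul_const (2 * C * ‖a‖ * ‖a‖))
  have hsq := (squeeze_zero (fun i => by positivity) key hlim).sqrt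
  rw [tendsto_zero_iff_norm_tendsto_zero]
  simpa [Real.sqrt_sq (norm_nonneg _)] using hsq

end VonNeumannAlgebra


/-! ### Hilbert space tensor products -/

namespace VonNeumannAlgebra

section TensorProducts

variable {H K : Type*} [NormedAddCommGroup H] [InnerProductSpace ℂ H]
  [NormedAddCommGroup K] [InnerProductSpace ℂ K]

/-- The elementary tensor `ξ ⊗ η` in the Hilbert space tensor product. -/
noncomputable def tm (ξ : H) (η : K) : HilbertTensor H K := ((ξ ⊗ₜ[ℂ] η : H ⊗[ℂ] K) : _)

/-- The operator `η ↦ ξ ⊗ η`. -/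
noncomputable def leftT (ξ : H) : K →L[ℂ] HilbertTensor H K :=
  UniformSpace.Completion.toComplL ∘L TensorProduct.mkL ℂ H K ξ

/-- The operator `ξ ↦ ξ ⊗ η`. -/
noncomputable def rightT (η : K) : H →L[ℂ] HilbertTensor H K :=
  UniformSpace.Completion.toComplL ∘L (TensorProduct.mkL ℂ H K).flip η

@[simp] theorem leftT_apply (ξ : H) (η : K) : leftT ξ η = tm ξ η := rfl

@[simp] theorem rightT_apply (ξ : H) (η : K) : rightT η ξ = tm ξ η := rfl

@[simp] theorem inner_tm (ξ ξ' : H) (η η' : K) :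
    ⟪tm ξ η, tm ξ' η'⟫_ℂ = ⟪ξ, ξ'⟫_ℂ * ⟪η, η'⟫_ℂ := by
  rw [tm, tm, UniformSpace.Completion.inner_coe, TensorProduct.inner_tmul]

@[simp] theorem norm_tm (ξ : H) (η : K) : ‖tm ξ η‖ = ‖ξ‖ * ‖η‖ := by
  rw [tm, UniformSpace.Completion.norm_coe, TensorProduct.norm_tmul]

theorem norm_leftT_le (ξ : H) : ‖(leftT ξ : K →L[ℂ] HilbertTensor H K)‖ ≤ ‖ξ‖ :=
  ContinuousLinearMap.opNorm_le_bound _ (norm_nonneg _) fun η => by simp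

theorem norm_rightT_le (η : K) : ‖(rightT η : H →L[ℂ] HilbertTensor H K)‖ ≤ ‖η‖ :=
  ContinuousLinearMap.opNorm_le_bound _ (norm_nonneg _) fun ξ => by simp [mul_comm]

/-- The elementary tensors are total in the Hilbert space tensor product. -/
theorem mem_of_tm_mem (S : Submodule ℂ (HilbertTensor H K))
    (hS : IsClosed (S : Set (HilbertTensor H K))) (h : ∀ ξ η, tm ξ η ∈ S)
    (ζ : HilbertTensor H K) : ζ ∈ S := by
  induction ζ using UniformSpace.Completion.induction_on with
  | hp => exact hS
  | ih a =>
    induction a using TensorProduct.induction_on with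
    | zero => rw [UniformSpace.Completion.coe_zero]; exact S.zero_mem
    | tmul x y => exact h x y
    | add x y hx hy => rw [UniformSpace.Completion.coe_add]; exact S.add_mem hx hy

theorem ext_tm {V : Type*} [NormedAddCommGroup V] [NormedSpace ℂ V]
    {S T : HilbertTensor H K →L[ℂ] V} (h : ∀ ξ η, S (tm ξ η) = T (tm ξ η)) : S = T := by
  ext ζ
  exact mem_of_tm_mem (LinearMap.eqLocus (S : HilbertTensor H K →ₗ[ℂ] V) T)
    (isClosed_eq S.continuous T.continuous) h ζ

theorem ext_inner_tm {ζ ζ' : HilbertTensor H K}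
    (h : ∀ ξ η, ⟪tm ξ η, ζ⟫_ℂ = ⟪tm ξ η, ζ'⟫_ℂ) : ζ = ζ' := by
  refine ext_inner_right ℂ fun w => ?_
  have : innerSL ℂ ζ = innerSL ℂ ζ' := ext_tm fun ξ η => by
    simpa only [innerSL_apply_apply, inner_conj_symm] using congrArg (starRingEnd ℂ) (h ξ η)
  exact DFunLike.congr_fun this w

@[simp] theorem opTensor_tm (a : H →L[ℂ] H) (b : K →L[ℂ] K) (ξ : H) (η : K) :
    opTensor a b (tm ξ η) = tm (a ξ) (b η) := by
  rw [opTensor, tm, ContinuousLinearMap.completion_apply_coe, TensorProduct.mapL_tmul]; rfl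

theorem tm_add_left (ξ ξ' : H) (η : K) : tm (ξ + ξ') η = tm ξ η + tm ξ' η :=
  (rightT η).map_add ξ ξ'

theorem tm_add_right (ξ : H) (η η' : K) : tm ξ (η + η') = tm ξ η + tm ξ η' :=
  (leftT ξ).map_add η η'

theorem tm_smul_left (c : ℂ) (ξ : H) (η : K) : tm (c • ξ) η = c • tm ξ η :=
  (rightT η).map_smul c ξ

theorem tm_smul_right (c : ℂ) (ξ : H) (η : K) : tm ξ (c • η) = c • tm ξ η :=
  (leftT ξ).map_smul c η

theorem opTensor_mul (a a' : H →L[ℂ] H) (b b' : K →L[ℂ] K) :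
    opTensor (a * a') (b * b') = opTensor a b * opTensor a' b' :=
  ext_tm fun ξ η => by simp

variable [CompleteSpace H] [CompleteSpace K]

theorem adjoint_opTensor (a : H →L[ℂ] H) (b : K →L[ℂ] K) :
    ContinuousLinearMap.adjoint (opTensor a b) =
      opTensor (ContinuousLinearMap.adjoint a) (ContinuousLinearMap.adjoint b) := by
  refine ext_tm fun ξ η => ext_inner_tm fun ξ' η' => ?_
  simp [ContinuousLinearMap.adjoint_inner_right]

variable (H K) in
/-- The amplification `a ↦ a ⊗ 1`. -/
noncomputable def ampL : (H →L[ℂ] H) →⋆ₐ[ℂ] (HilbertTensor H K →L[ℂ] HilbertTensor H K) where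
  toFun a := opTensor a 1
  map_one' := ext_tm fun ξ η => by simp
  map_mul' a b := by rw [← opTensor_mul, one_mul]
  map_zero' := ext_tm fun ξ η => by
    simpa using (rightT η : H →L[ℂ] HilbertTensor H K).map_zero
  map_add' a b := ext_tm fun ξ η => by simp [tm_add_left]
  commutes' c := ext_tm fun ξ η => by simp [Algebra.algebraMap_eq_smul_one, tm_smul_left]
  map_star' a := by
    simp only [ContinuousLinearMap.star_eq_adjoint, adjoint_opTensor]
    congr 1
    exact (star_one (K →L[ℂ] K)).symm

variable (H K) in
/-- The amplification `b ↦ 1 ⊗ b`. -/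
noncomputable def ampR : (K →L[ℂ] K) →⋆ₐ[ℂ] (HilbertTensor H K →L[ℂ] HilbertTensor H K) where
  toFun b := opTensor 1 b
  map_one' := ext_tm fun ξ η => by simp
  map_mul' a b := by rw [← opTensor_mul, one_mul]
  map_zero' := ext_tm fun ξ η => by
    simpa using (leftT ξ : K →L[ℂ] HilbertTensor H K).map_zero
  map_add' a b := ext_tm fun ξ η => by simp [tm_add_right]
  commutes' c := ext_tm fun ξ η => by simp [Algebra.algebraMap_eq_smul_one, tm_smul_right]
  map_star' a := by
    simp only [ContinuousLinearMap.star_eq_adjoint, adjoint_opTensor]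
    congr 1
    exact (star_one (H →L[ℂ] H)).symm

@[simp] theorem ampL_tm (a : H →L[ℂ] H) (ξ : H) (η : K) : ampL H K a (tm ξ η) = tm (a ξ) η :=
  opTensor_tm a 1 ξ η

@[simp] theorem ampR_tm (b : K →L[ℂ] K) (ξ : H) (η : K) : ampR H K b (tm ξ η) = tm ξ (b η) :=
  opTensor_tm 1 b ξ η

theorem ampL_mul_ampR (a : H →L[ℂ] H) (b : K →L[ℂ] K) :
    ampL H K a * ampR H K b = opTensor a b :=
  ext_tm fun ξ η => by simp

theorem ampR_mul_ampL (a : H →L[ℂ] H) (b : K →L[ℂ] K) :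
    ampR H K b * ampL H K a = opTensor a b :=
  ext_tm fun ξ η => by simp

theorem norm_ampL_le (a : H →L[ℂ] H) : ‖ampL H K a‖ ≤ ‖a‖ :=
  NonUnitalStarAlgHom.norm_apply_le (ampL H K) a

theorem norm_ampR_le (b : K →L[ℂ] K) : ‖ampR H K b‖ ≤ ‖b‖ :=
  NonUnitalStarAlgHom.norm_apply_le (ampR H K) b

omit [CompleteSpace H] in
@[simp] theorem adjoint_leftT_tm (v ξ : H) (η : K) :
    ContinuousLinearMap.adjoint (leftT v) (tm ξ η) = ⟪v, ξ⟫_ℂ • η := by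
  refine ext_inner_left ℂ fun w => ?_
  rw [ContinuousLinearMap.adjoint_inner_right, leftT_apply, inner_tm, inner_smul_right]

theorem adjoint_leftT_ampR (v : H) (b : K →L[ℂ] K) (ζ : HilbertTensor H K) :
    ContinuousLinearMap.adjoint (leftT v) (ampR H K b ζ) =
      b (ContinuousLinearMap.adjoint (leftT v) ζ) := by
  have : ContinuousLinearMap.adjoint (leftT v) ∘L ampR H K b =
      b ∘L ContinuousLinearMap.adjoint (leftT v) := ext_tm fun ξ η => by simp
  exact DFunLike.congr_fun this ζ

theorem adjoint_rightT_ampL (η : K) (a : H →L[ℂ] H) (ζ : HilbertTensor H K) :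
    ContinuousLinearMap.adjoint (rightT η) (ampL H K a ζ) =
      a (ContinuousLinearMap.adjoint (rightT η) ζ) := by
  refine ext_inner_left ℂ fun w => ?_
  rw [ContinuousLinearMap.adjoint_inner_right, ← ContinuousLinearMap.adjoint_inner_left a,
    ContinuousLinearMap.adjoint_inner_right, ← ContinuousLinearMap.adjoint_inner_left,
    ← ContinuousLinearMap.star_eq_adjoint, ← map_star]
  simp [ContinuousLinearMap.star_eq_adjoint]

/-! ### The tensor product of von Neumann algebras -/

theorem commute_of_mem_generated {S : Set (H →L[ℂ] H)} {T : H →L[ℂ] H}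
    (h : ∀ s ∈ S, s * T = T * s) (h' : ∀ s ∈ S, star s * T = T * star s) {x : H →L[ℂ] H}
    (hx : x ∈ generated S) : x * T = T * x := by
  have hT : T ∈ StarSubalgebra.centralizer ℂ S :=
    (StarSubalgebra.mem_centralizer_iff ℂ).mpr fun s hs => ⟨h s hs, h' s hs⟩
  have hx' : x ∈ StarSubalgebra.centralizer ℂ (StarSubalgebra.centralizer ℂ S : Set _) := hx
  exact (((StarSubalgebra.mem_centralizer_iff ℂ).mp hx') T hT).1.symm

variable {M : VonNeumannAlgebra H} {N : VonNeumannAlgebra K}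

theorem opTensor_mem {a : H →L[ℂ] H} {b : K →L[ℂ] K} (ha : a ∈ M) (hb : b ∈ N) :
    opTensor a b ∈ M.tensor N :=
  subset_generated _ ⟨a, ha, b, hb, rfl⟩

theorem ampL_mem {a : H →L[ℂ] H} (ha : a ∈ M) : ampL H K a ∈ M.tensor N :=
  opTensor_mem ha (one_mem N)

theorem ampR_mem {b : K →L[ℂ] K} (hb : b ∈ N) : ampR H K b ∈ M.tensor N :=
  opTensor_mem (one_mem M) hb

theorem commute_ampL {a : H →L[ℂ] H} (ha : a ∈ M.commutant)
    {x : HilbertTensor H K →L[ℂ] HilbertTensor H K} (hx : x ∈ M.tensor N) :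
    x * ampL H K a = ampL H K a * x := by
  have key : ∀ c ∈ M, ∀ d : K →L[ℂ] K,
      opTensor c d * ampL H K a = ampL H K a * opTensor c d := by
    intro c hc d
    rw [← ampL_mul_ampR, mul_assoc, ampR_mul_ampL, ← ampL_mul_ampR, ← mul_assoc, ← mul_assoc,
      ← map_mul, ← map_mul, mem_commutant_iff.mp ha c hc]
  refine commute_of_mem_generated ?_ ?_ hx
  · rintro _ ⟨c, hc, d, -, rfl⟩
    exact key c hc d
  · rintro _ ⟨c, hc, d, -, rfl⟩
    rw [ContinuousLinearMap.star_eq_adjoint, adjoint_opTensor]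
    exact key _ (star_mem hc) _

theorem commute_ampR {b : K →L[ℂ] K} (hb : b ∈ N.commutant)
    {x : HilbertTensor H K →L[ℂ] HilbertTensor H K} (hx : x ∈ M.tensor N) :
    x * ampR H K b = ampR H K b * x := by
  have key : ∀ (c : H →L[ℂ] H), ∀ d ∈ N,
      opTensor c d * ampR H K b = ampR H K b * opTensor c d := by
    intro c d hd
    rw [← ampR_mul_ampL, mul_assoc, ampL_mul_ampR, ← ampR_mul_ampL, ← mul_assoc, ← mul_assoc,
      ← map_mul, ← map_mul, mem_commutant_iff.mp hb d hd]
  refine commute_of_mem_generated ?_ ?_ hx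
  · rintro _ ⟨c, -, d, hd, rfl⟩
    exact key c d hd
  · rintro _ ⟨c, -, d, hd, rfl⟩
    rw [ContinuousLinearMap.star_eq_adjoint, adjoint_opTensor]
    exact key _ _ (star_mem hd)

/-- The slice `(ω_{ξ, v} ⊗ id)(x)` of an operator on the tensor product. -/
noncomputable def slice (v ξ : H) (x : HilbertTensor H K →L[ℂ] HilbertTensor H K) : K →L[ℂ] K :=
  ContinuousLinearMap.adjoint (leftT v) ∘L x ∘L leftT ξ

omit [CompleteSpace H] in
theorem slice_apply (v ξ : H) (x : HilbertTensor H K →L[ℂ] HilbertTensor H K) (η : K) :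
    slice v ξ x η = ContinuousLinearMap.adjoint (leftT v) (x (tm ξ η)) := rfl

omit [CompleteSpace H] in
theorem inner_slice (v ξ : H) (x : HilbertTensor H K →L[ℂ] HilbertTensor H K) (η η' : K) :
    ⟪η', slice v ξ x η⟫_ℂ = ⟪tm v η', x (tm ξ η)⟫_ℂ := by
  rw [slice_apply, ContinuousLinearMap.adjoint_inner_right, leftT_apply]

omit [CompleteSpace H] in
theorem adjoint_slice (v ξ : H) (x : HilbertTensor H K →L[ℂ] HilbertTensor H K) :
    ContinuousLinearMap.adjoint (slice v ξ x) = slice ξ v (ContinuousLinearMap.adjoint x) := by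
  refine ContinuousLinearMap.ext fun η => ext_inner_left ℂ fun η' => ?_
  rw [ContinuousLinearMap.adjoint_inner_right, inner_slice, ← inner_conj_symm, inner_slice,
    ContinuousLinearMap.adjoint_inner_right, inner_conj_symm]

omit [CompleteSpace H] in
theorem norm_slice_le (v ξ : H) (x : HilbertTensor H K →L[ℂ] HilbertTensor H K) :
    ‖slice v ξ x‖ ≤ ‖v‖ * ‖ξ‖ * ‖x‖ := by
  calc _ ≤ ‖ContinuousLinearMap.adjoint (leftT v : K →L[ℂ] HilbertTensor H K)‖ *
        (‖x‖ * ‖(leftT ξ : K →L[ℂ] HilbertTensor H K)‖) :=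
        (ContinuousLinearMap.opNorm_comp_le _ _).trans
          (by gcongr; exact ContinuousLinearMap.opNorm_comp_le _ _)
    _ ≤ ‖v‖ * (‖x‖ * ‖ξ‖) := by
        rw [LinearIsometryEquiv.norm_map]
        gcongr <;> exact norm_leftT_le _
    _ = _ := by ring

theorem slice_mem (v ξ : H) {x : HilbertTensor H K →L[ℂ] HilbertTensor H K}
    (hx : x ∈ M.tensor N) : slice v ξ x ∈ N := by
  refine mem_of_forall_commutant fun b hb => ?_
  ext η
  have h := DFunLike.congr_fun (commute_ampR hb hx) (tm ξ η)
  rw [_root_.mul_apply_eq_comp, _root_.mul_apply_eq_comp, slice_apply,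
    slice_apply, ← adjoint_leftT_ampR]
  rw [_root_.mul_apply_eq_comp, _root_.mul_apply_eq_comp, ampR_tm] at h
  rw [h]

end TensorProducts

end VonNeumannAlgebra


/-! ### Transfer of compact operators from the GNS space -/

namespace VonNeumannAlgebra

section Transfer

variable {H : Type*} [NormedAddCommGroup H] [InnerProductSpace ℂ H] [CompleteSpace H]

omit [CompleteSpace H] in
/-- For an orthonormal sequence `e` and square-summable `ξ`, the vector `∑ ξₙ ⊗ eₙ` has the
coordinates `ξₙ`. -/
theorem exists_hasSum_tm {L : Type*} [NormedAddCommGroup L] [InnerProductSpace ℂ L]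
    [CompleteSpace L] {e : ℕ → L} (he : Orthonormal ℂ e) {ξ : ℕ → H}
    (hξ : Summable fun n => ‖ξ n‖ ^ 2) :
    ∃ Z : HilbertTensor H L, HasSum (fun n => tm (ξ n) (e n)) Z ∧
      ∀ n h, ⟪tm h (e n), Z⟫_ℂ = ⟪h, ξ n⟫_ℂ := by
  let V : ℕ → H →ₗᵢ[ℂ] HilbertTensor H L := fun n =>
    ⟨(rightT (e n) : H →L[ℂ] HilbertTensor H L).toLinearMap, fun x => by simp [he.norm_eq_one]⟩
  have hV : OrthogonalFamily ℂ (fun _ : ℕ => H) V := fun m n hmn v w => by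
    change ⟪tm v (e m), tm w (e n)⟫_ℂ = 0
    rw [inner_tm, he.inner_eq_zero hmn, mul_zero]
  obtain ⟨Z, hZ⟩ := (hV.summable_iff_norm_sq_summable ξ).mpr hξ
  have hZ' : HasSum (fun n => tm (ξ n) (e n)) Z := hZ
  refine ⟨Z, hZ', fun n h => HasSum.unique (f := fun m => ⟪tm h (e n), tm (ξ m) (e m)⟫_ℂ)
    (hZ'.mapL (innerSL ℂ (tm h (e n)))) ?_⟩
  have h2 := hasSum_single (f := fun m => ⟪tm h (e n), tm (ξ m) (e m)⟫_ℂ) n fun m hmn => by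
    rw [inner_tm, he.inner_eq_zero hmn.symm, mul_zero]
  simpa [inner_tm, he.norm_eq_one] using h2

/-- A normal functional is a vector functional of an amplification of `M`. -/
theorem IsNormal.exists_vectors {M : VonNeumannAlgebra H} {f : M.Elem → ℂ} (hf : IsNormal f)
    {L : Type*} [NormedAddCommGroup L] [InnerProductSpace ℂ L]
    [CompleteSpace L] {e : ℕ → L} (he : Orthonormal ℂ e) :
    ∃ Z Z' : HilbertTensor H L, ∀ x : M.Elem, f x = ⟪Z', ampL H L (x : H →L[ℂ] H) Z⟫_ℂ := by
  obtain ⟨ξ, η, hξ, hη, h⟩ := hf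
  obtain ⟨Z, hZ, -⟩ := exists_hasSum_tm he hξ
  obtain ⟨Z', -, hZ'⟩ := exists_hasSum_tm he hη
  refine ⟨Z, Z', fun x => (h x).unique ?_⟩
  have h1 : ∀ n, ⟪η n, (x : H →L[ℂ] H) (ξ n)⟫_ℂ =
      innerSL ℂ Z' (ampL H L (x : H →L[ℂ] H) (tm (ξ n) (e n))) := fun n => by
    rw [ampL_tm, innerSL_apply_apply, ← inner_conj_symm Z', hZ', inner_conj_symm]
  simp only [h1]
  exact (hZ.mapL (ampL H L (x : H →L[ℂ] H))).mapL (innerSL ℂ Z')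

end Transfer

/-- A cyclic representation is a quotient of every representation `π` with a vector `z` that
dominates its cyclic vector. -/
theorem exists_dense_intertwiner {A V V' : Type*} [Ring A] [StarRing A] [Algebra ℂ A]
    [NormedAddCommGroup V] [InnerProductSpace ℂ V] [CompleteSpace V]
    [NormedAddCommGroup V'] [InnerProductSpace ℂ V'] [CompleteSpace V']
    (π : A →⋆ₐ[ℂ] (V →L[ℂ] V)) (ρ : A →⋆ₐ[ℂ] (V' →L[ℂ] V')) (ψ : A →ₗ[ℂ] V')
    (hψ : DenseRange ψ) (hρ : ∀ a b, ρ a (ψ b) = ψ (a * b)) (z : V)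
    (hz : ∀ b, ‖ψ b‖ ≤ ‖π b z‖) :
    ∃ W : V →L[ℂ] V', DenseRange W ∧ ∀ a v, W (π a v) = ρ a (W v) := by
  let e₀ : A →ₗ[ℂ] V := (ContinuousLinearMap.apply ℂ V z).toLinearMap ∘ₗ π.toAlgHom.toLinearMap
  let U := (LinearMap.range e₀).topologicalClosure
  have hU : ∀ b, e₀ b ∈ U := fun b => Submodule.le_topologicalClosure _ ⟨b, rfl⟩
  have : CompleteSpace U := (Submodule.isClosed_topologicalClosure _).completeSpace_coe
  let e : A →ₗ[ℂ] U := e₀.codRestrict U hU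
  have hdense : DenseRange e := by
    intro u
    rw [closure_subtype]
    have h1 : (Subtype.val '' Set.range e : Set V) = LinearMap.range e₀ := by
      ext v; constructor
      · rintro ⟨_, ⟨b, rfl⟩, rfl⟩; exact ⟨b, rfl⟩
      · rintro ⟨b, rfl⟩; exact ⟨_, ⟨b, rfl⟩, rfl⟩
    rw [h1]
    exact u.2
  let R : U →L[ℂ] V' := ψ.extendOfNorm e
  have hR : ∀ b, R (e b) = ψ b :=
    LinearMap.extendOfNorm_eq hdense ⟨1, fun b => by rw [one_mul]; exact hz b⟩
  have hinv : ∀ a, ∀ u ∈ U, π a u ∈ U := by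
    intro a u hu
    have : U ≤ U.comap (π a).toLinearMap := by
      refine Submodule.topologicalClosure_minimal _ ?_
        ((Submodule.isClosed_topologicalClosure _).preimage (π a).continuous)
      rintro _ ⟨b, rfl⟩
      change π a (π b z) ∈ U
      rw [← _root_.mul_apply_eq_comp, ← map_mul]
      exact hU (a * b)
    exact this hu
  have hinv' : ∀ a, ∀ u ∈ Uᗮ, π a u ∈ Uᗮ := by
    intro a u hu v hv
    rw [← ContinuousLinearMap.adjoint_inner_left, ← ContinuousLinearMap.star_eq_adjoint,
      ← map_star]
    exact hu _ (hinv _ v hv)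
  have hRU : ∀ a, ∀ u : U, R ⟨π a u, hinv a u u.2⟩ = ρ a (R u) := by
    intro a u
    refine hdense.induction_on (p := fun u : U => R ⟨π a u, hinv a u u.2⟩ = ρ a (R u)) u ?_ ?_
    · refine isClosed_eq (R.continuous.comp ?_) ((ρ a).continuous.comp R.continuous)
      exact ((π a).continuous.comp continuous_subtype_val).subtype_mk _
    · intro b
      rw [hR, hρ, ← hR]
      congr 1
      ext1
      change π a (π b z) = π (a * b) z
      rw [map_mul, _root_.mul_apply_eq_comp]
  refine ⟨R ∘L U.orthogonalProjectionOnto, ?_, fun a w => ?_⟩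
  · refine hψ.mono ?_
    rintro _ ⟨b, rfl⟩
    refine ⟨e b, ?_⟩
    rw [ContinuousLinearMap.comp_apply, Submodule.orthogonalProjectionOnto_mem_subspace_eq_self, hR]
  · have hw : w = (U.orthogonalProjectionOnto w : V) + (w - U.orthogonalProjectionOnto w) := by
      abel
    have hw' : w - U.orthogonalProjectionOnto w ∈ Uᗮ := U.sub_starProjection_mem_orthogonal w
    change R (U.orthogonalProjectionOnto (π a w)) = ρ a (R (U.orthogonalProjectionOnto w))
    rw [← hRU]
    congr 1
    conv_lhs => rw [hw, map_add, map_add]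
    rw [(Submodule.orthogonalProjectionOnto_eq_zero_iff).mpr (hinv' a _ hw'), add_zero]
    exact U.orthogonalProjectionOnto_mem_subspace_eq_self ⟨_, hinv a _ (Subtype.coe_prop _)⟩

/-- The *-algebra generated by the range of a *-homomorphism and its centralizer is spanned by
products. -/
theorem adjoin_range_union_centralizer {A B : Type*} [Ring A] [StarRing A] [Algebra ℂ A]
    [Ring B] [StarRing B] [Algebra ℂ B] [StarModule ℂ B] (π : A →⋆ₐ[ℂ] B) {T : B}
    (hT : T ∈ StarAlgebra.adjoin ℂ (Set.range π ∪ Set.centralizer (Set.range π))) :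
    T ∈ Submodule.span ℂ {S | ∃ a, ∃ b ∈ Set.centralizer (Set.range π), S = π a * b} := by
  set X : Set B := {S | ∃ a, ∃ b ∈ Set.centralizer (Set.range π), S = π a * b} with hX
  have hcomm : ∀ b ∈ Set.centralizer (Set.range π), ∀ a, b * π a = π a * b :=
    fun b hb a => (hb _ ⟨a, rfl⟩).symm
  have hstar : ∀ b ∈ Set.centralizer (Set.range π), star b ∈ Set.centralizer (Set.range π) := by
    rintro b hb _ ⟨a, rfl⟩
    have := congrArg star (hcomm b hb (star a))
    rw [star_mul, star_mul, map_star, star_star] at this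
    exact this
  have hone : (1 : B) ∈ Set.centralizer (Set.range π) := Set.one_mem_centralizer
  have hmul : ∀ S ∈ Submodule.span ℂ X, ∀ S' ∈ Submodule.span ℂ X,
      S * S' ∈ Submodule.span ℂ X := by
    intro S hS S' hS'
    have h1 := Submodule.mul_mem_mul hS hS'
    rw [Submodule.span_mul_span] at h1
    refine Submodule.span_mono ?_ h1
    rintro _ ⟨_, ⟨a, b, hb, rfl⟩, _, ⟨a', b', hb', rfl⟩, rfl⟩
    refine ⟨a * a', b * b', Set.mul_mem_centralizer hb hb', ?_⟩
    change π a * b * (π a' * b') = _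
    rw [map_mul, mul_assoc, ← mul_assoc b, hcomm b hb]
    simp only [mul_assoc]
  have hstarX : ∀ S ∈ Submodule.span ℂ X, star S ∈ Submodule.span ℂ X := by
    intro S hS
    induction hS using Submodule.span_induction with
    | mem S hS =>
      obtain ⟨a, b, hb, rfl⟩ := hS
      refine Submodule.subset_span ⟨star a, star b, hstar b hb, ?_⟩
      rw [star_mul, ← map_star, hcomm _ (hstar b hb)]
    | zero => simp
    | add S S' _ _ h h' => rw [star_add]; exact add_mem h h'
    | smul c S _ h => rw [star_smul]; exact Submodule.smul_mem _ _ h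
  induction hT using StarAlgebra.adjoin_induction with
  | mem S hS =>
    rcases hS with ⟨a, rfl⟩ | hb
    · exact Submodule.subset_span ⟨a, 1, hone, by rw [mul_one]⟩
    · exact Submodule.subset_span ⟨1, S, hb, by rw [map_one, one_mul]⟩
  | algebraMap c =>
    rw [Algebra.algebraMap_eq_smul_one]
    exact Submodule.smul_mem _ _ (Submodule.subset_span ⟨1, 1, hone, by rw [map_one, one_mul]⟩)
  | add S S' _ _ h h' => exact add_mem h h'
  | mul S S' _ _ h h' => exact hmul S h S' h'
  | star S _ h => exact hstarX S h

section Transfer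

variable {H : Type*} [NormedAddCommGroup H] [InnerProductSpace ℂ H] [CompleteSpace H]
  {M : VonNeumannAlgebra H}

/-- The span of the operators `a b` with `a ∈ M` and `b ∈ M'`. -/
def commSpan (M : VonNeumannAlgebra H) : Submodule ℂ (H →L[ℂ] H) :=
  Submodule.span ℂ {T | ∃ a ∈ M, ∃ b ∈ M.commutant, T = a * b}

/-- Intertwiners with jointly dense range compress a nonzero compact operator in the closed span
of `ρ(M) ρ(M)'` to a nonzero compact operator in the closed span of `M M'`. -/
theorem exists_compact_commSpan_of_intertwiner {V L : Type*} [NormedAddCommGroup V]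
    [InnerProductSpace ℂ V] [CompleteSpace V] [NormedAddCommGroup L] [InnerProductSpace ℂ L]
    [CompleteSpace L] (ρ : M.Elem →⋆ₐ[ℂ] (V →L[ℂ] V)) (W : HilbertTensor H L →L[ℂ] V)
    (hWd : DenseRange W) (hW : ∀ (a : M.Elem) v, W (ampL H L (a : H →L[ℂ] H) v) = ρ a (W v))
    {T : V →L[ℂ] V} (hT : T ∈ closure (Submodule.span ℂ
      {S | ∃ a, ∃ b ∈ Set.centralizer (Set.range ρ), S = ρ a * b} : Set (V →L[ℂ] V)))
    (hTc : IsCompactOperator T) (hT0 : T ≠ 0) :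
    ∃ S ∈ closure (M.commSpan : Set (H →L[ℂ] H)), IsCompactOperator S ∧ S ≠ 0 := by
  obtain ⟨w, hwd⟩ : ∃ w : L → H →L[ℂ] V, w = fun k => W ∘L rightT k := ⟨_, rfl⟩
  have hw : ∀ k (a : M.Elem) v, w k ((a : H →L[ℂ] H) v) = ρ a (w k v) := fun k a v => by
    subst hwd
    change W (tm ((a : H →L[ℂ] H) v) k) = ρ a (W (tm v k))
    rw [← hW, ampL_tm]
  have hw' : ∀ k (a : M.Elem) v, (a : H →L[ℂ] H) (ContinuousLinearMap.adjoint (w k) v) =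
      ContinuousLinearMap.adjoint (w k) (ρ a v) := fun k a v => by
    refine ext_inner_left ℂ fun u => ?_
    rw [ContinuousLinearMap.adjoint_inner_right, ← ContinuousLinearMap.adjoint_inner_left,
      ← coe_star_elem, ContinuousLinearMap.adjoint_inner_right, hw, map_star,
      ContinuousLinearMap.star_eq_adjoint, ContinuousLinearMap.adjoint_inner_left]
  -- the intertwiners `w k` have jointly dense range
  have hzero : ∀ v, (∀ k, ContinuousLinearMap.adjoint (w k) v = 0) → v = 0 := by
    intro v hv
    have h1 : ContinuousLinearMap.adjoint W v = 0 := ext_inner_tm fun ξ k => by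
      have := congrArg (fun z => ⟪ξ, z⟫_ℂ) (hv k)
      rw [ContinuousLinearMap.adjoint_inner_right, inner_zero_right, hwd] at this
      rw [ContinuousLinearMap.adjoint_inner_right, inner_zero_right]
      exact this
    have h2 : innerSL ℂ v = 0 := by
      refine ContinuousLinearMap.ext fun u => ?_
      refine hWd.induction_on (p := fun u => innerSL ℂ v u = (0 : V →L[ℂ] ℂ) u) u
        (isClosed_eq (by fun_prop) (by fun_prop)) fun u => ?_
      rw [innerSL_apply_apply, ← ContinuousLinearMap.adjoint_inner_left, h1, inner_zero_left]
      rfl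
    rw [← inner_self_eq_zero (𝕜 := ℂ)]
    exact DFunLike.congr_fun h2 v
  have hk : ∃ j k, ContinuousLinearMap.adjoint (w k) ∘L T ∘L w j ≠ 0 := by
    by_contra! hall
    refine hT0 (ContinuousLinearMap.ext fun v => hzero _ fun k => ?_)
    have h2 : ContinuousLinearMap.adjoint (ContinuousLinearMap.adjoint (w k) ∘L T) = 0 := by
      refine ContinuousLinearMap.ext fun u => hzero _ fun j => ?_
      rw [← ContinuousLinearMap.comp_apply, ← ContinuousLinearMap.adjoint_comp,
        ContinuousLinearMap.comp_assoc, hall j k, map_zero]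
      rfl
    have h3 := congrArg ContinuousLinearMap.adjoint h2
    rw [ContinuousLinearMap.adjoint_adjoint, map_zero] at h3
    exact DFunLike.congr_fun h3 v
  obtain ⟨j, k, hjk⟩ := hk
  refine ⟨_, ?_, (hTc.comp_clm (w j)).clm_comp (ContinuousLinearMap.adjoint (w k)), hjk⟩
  have hcont : Continuous fun S : V →L[ℂ] V =>
      ContinuousLinearMap.adjoint (w k) ∘L S ∘L w j := by fun_prop
  refine map_mem_closure (f := fun S : V →L[ℂ] V =>
    ContinuousLinearMap.adjoint (w k) ∘L S ∘L w j) hcont hT fun S hS => ?_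
  change ContinuousLinearMap.adjoint (w k) ∘L S ∘L w j ∈ M.commSpan
  induction hS using Submodule.span_induction with
  | mem S hS =>
    obtain ⟨a, b, hb, rfl⟩ := hS
    refine Submodule.subset_span ⟨a, a.2, ContinuousLinearMap.adjoint (w k) ∘L b ∘L w j,
      mem_commutant_iff.mpr fun c hc => ?_, ?_⟩
    · lift c to M.Elem using hc
      refine ContinuousLinearMap.ext fun v => ?_
      change (c : H →L[ℂ] H) (ContinuousLinearMap.adjoint (w k) (b (w j v))) =
        ContinuousLinearMap.adjoint (w k) (b (w j ((c : H →L[ℂ] H) v)))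
      rw [hw, hw']
      exact congrArg _ (DFunLike.congr_fun (hb _ ⟨c, rfl⟩) (w j v))
    · refine ContinuousLinearMap.ext fun v => ?_
      exact (hw' k a _).symm
  | zero => simp
  | add S S' _ _ h h' =>
    rw [ContinuousLinearMap.add_comp, ContinuousLinearMap.comp_add]; exact add_mem h h'
  | smul c S _ h =>
    rw [ContinuousLinearMap.smul_comp, ContinuousLinearMap.comp_smul]
    exact Submodule.smul_mem _ _ h

variable (φ : M.Elem →ₚ[ℂ] ℂ)

/-- The class of `b` in the GNS space of `φ`. -/
noncomputable def gnsVec : M.Elem →ₗ[ℂ] φ.GNS :=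
  (UniformSpace.Completion.toComplL (𝕜 := ℂ) (E := φ.PreGNS)).toLinearMap ∘ₗ
    φ.toPreGNS.toLinearMap

theorem gnsVec_apply (b : M.Elem) : gnsVec φ b = ((φ.toPreGNS b : φ.PreGNS) : φ.GNS) := rfl

theorem norm_gnsVec_sq (b : M.Elem) : ((‖gnsVec φ b‖ ^ 2 : ℝ) : ℂ) = φ (star b * b) := by
  rw [gnsVec_apply, UniformSpace.Completion.norm_coe, Complex.ofReal_pow, φ.preGNS_norm_sq,
    φ.ofPreGNS_toPreGNS]

theorem gnsStarAlgHom_gnsVec (a b : M.Elem) :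
    φ.gnsStarAlgHom a (gnsVec φ b) = gnsVec φ (a * b) :=
  φ.gnsNonUnitalStarAlgHom_apply_coe

theorem denseRange_gnsVec : DenseRange (gnsVec φ) :=
  UniformSpace.Completion.denseRange_coe.comp φ.toPreGNS.surjective.denseRange
    (UniformSpace.Completion.continuous_coe _)

/-- If `φ = ⟨· Z, Z'⟩` is positive, then polarization gives `4 φ ≤ ⟨· (Z + Z'), Z + Z'⟩`. -/
theorem norm_gnsVec_le {L : Type*} [NormedAddCommGroup L] [InnerProductSpace ℂ L]
    [CompleteSpace L] {Z Z' : HilbertTensor H L}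
    (hZ : ∀ x : M.Elem, φ x = ⟪Z', ampL H L (x : H →L[ℂ] H) Z⟫_ℂ) (b : M.Elem) :
    ‖gnsVec φ b‖ ≤ ‖ampL H L (b : H →L[ℂ] H) (Z + Z')‖ := by
  obtain ⟨B, hB⟩ : ∃ B, B = ampL H L (b : H →L[ℂ] H) := ⟨_, rfl⟩
  have h1 : ‖gnsVec φ b‖ ^ 2 = (⟪B Z', B Z⟫_ℂ).re := by
    have h2 := norm_gnsVec_sq φ b
    have h3 : ampL H L ((star b * b : M.Elem) : H →L[ℂ] H) = star B * B := by
      rw [hB, ← map_star, ← map_mul]; rfl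
    rw [hZ, h3, _root_.mul_apply_eq_comp, ContinuousLinearMap.star_eq_adjoint,
      ContinuousLinearMap.adjoint_inner_right] at h2
    rw [← h2, Complex.ofReal_re]
  rw [← hB]
  refine (sq_le_sq₀ (norm_nonneg _) (norm_nonneg _)).mp ?_
  have h5 := norm_add_sq (𝕜 := ℂ) (B Z') (B Z)
  have h6 := norm_sub_sq (𝕜 := ℂ) (B Z') (B Z)
  simp only [RCLike.re_eq_complex_re] at h5 h6
  rw [map_add, add_comm, h1]
  nlinarith [sq_nonneg ‖B Z' - B Z‖, sq_nonneg ‖B Z' + B Z‖]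

/-- A nonzero compact operator in `C*{π(M), π(M)'}` on the GNS space of a normal positive
functional gives a nonzero compact operator in the closed span of `M M'` on the original space. -/
theorem exists_compact_commSpan (hφ : IsNormal φ)
    (hcpt : ∃ T ∈ cstarLeftRight φ, IsCompactOperator T ∧ T ≠ 0) :
    ∃ S ∈ closure (M.commSpan : Set (H →L[ℂ] H)), IsCompactOperator S ∧ S ≠ 0 := by
  obtain ⟨T, hT, hTc, hT0⟩ := hcpt
  have he : Orthonormal ℂ fun n : ℕ => lp.single (E := fun _ : ℕ => ℂ) 2 n (1 : ℂ) := by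
    rw [orthonormal_iff_ite]
    intro m n
    rw [lp.inner_single_left]
    by_cases hmn : m = n
    · subst hmn; simp
    · simp [hmn]
  obtain ⟨Z, Z', hZ⟩ := hφ.exists_vectors he
  obtain ⟨W, hWd, hW⟩ := exists_dense_intertwiner
    ((ampL H (lp (fun _ : ℕ => ℂ) 2)).comp M.toStarSubalgebra.subtype) φ.gnsStarAlgHom (gnsVec φ)
    (denseRange_gnsVec φ) (gnsStarAlgHom_gnsVec φ) (Z + Z') (norm_gnsVec_le φ hZ)
  exact exists_compact_commSpan_of_intertwiner φ.gnsStarAlgHom W hWd hW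
    (closure_mono (fun S hS => adjoin_range_union_centralizer φ.gnsStarAlgHom hS) hT) hTc hT0

end Transfer

end VonNeumannAlgebra


/-! ### Compact operators and slices -/

namespace VonNeumannAlgebra

section Slices

variable {H K : Type*} [NormedAddCommGroup H] [InnerProductSpace ℂ H] [CompleteSpace H]
  [NormedAddCommGroup K] [InnerProductSpace ℂ K] [CompleteSpace K]

/-- Compact operators on a Hilbert space are norm limits of finite rank operators. -/
theorem mem_closure_span_rankOne {S : H →L[ℂ] H} (hS : IsCompactOperator S) :
    S ∈ closure (Submodule.span ℂ {T | ∃ e v : H, T = InnerProductSpace.rankOne ℂ e v} :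
      Set (H →L[ℂ] H)) := by
  rw [Metric.mem_closure_iff]
  intro ε hε
  have htb : TotallyBounded (closure (S '' Metric.closedBall 0 1)) :=
    (hS.isCompact_closure_image_closedBall 1).totallyBounded
  obtain ⟨t, ht, hcov⟩ := Metric.totallyBounded_iff.mp htb (ε / 2) (half_pos hε)
  let F := Submodule.span ℂ t
  have : FiniteDimensional ℂ F := FiniteDimensional.span_of_finite ℂ ht
  let b := stdOrthonormalBasis ℂ F
  refine ⟨F.starProjection ∘L S, ?_, ?_⟩
  · rw [b.starProjection_eq_sum_rankOne]
    have h1 : (∑ i, InnerProductSpace.rankOne ℂ (b i : H) (b i : H)) ∘L S =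
        ∑ i, InnerProductSpace.rankOne ℂ (b i : H) (ContinuousLinearMap.adjoint S (b i)) := by
      ext v
      simp [ContinuousLinearMap.adjoint_inner_left]
    rw [h1]
    exact Submodule.sum_mem _ fun i _ => Submodule.subset_span ⟨_, _, rfl⟩
  · rw [dist_eq_norm]
    refine (ContinuousLinearMap.opNorm_le_of_unit_norm (𝕜 := ℂ) (C := ε / 2) (by positivity)
      fun v hv => ?_).trans_lt (half_lt_self hε)
    have hv' : S v ∈ closure (S '' Metric.closedBall 0 1) :=
      subset_closure ⟨v, by simp [hv], rfl⟩
    obtain ⟨f, hf, hvf⟩ := Set.mem_iUnion₂.mp (hcov hv')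
    change ‖S v - F.starProjection (S v)‖ ≤ ε / 2
    rw [F.starProjection_minimal]
    refine (ciInf_le ⟨0, ?_⟩ (⟨f, Submodule.subset_span hf⟩ : F)).trans ?_
    · rintro _ ⟨x, rfl⟩; exact norm_nonneg _
    · rw [← dist_eq_norm]; exact (Metric.mem_ball.mp hvf).le

/-- If all the slices `(⟨v| ⊗ 1) ζᵢ` of a bounded family tend to `0`, then `(S ⊗ 1) ζᵢ → 0` for
every compact `S`. -/
theorem tendsto_ampL_of_compact {ι : Type*} {l : Filter ι} {ζ : ι → HilbertTensor H K} {C : ℝ}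
    (hC : ∀ i, ‖ζ i‖ ≤ C)
    (h : ∀ v : H, Tendsto (fun i => ContinuousLinearMap.adjoint (leftT v) (ζ i)) l (𝓝 0))
    {S : H →L[ℂ] H} (hS : IsCompactOperator S) :
    Tendsto (fun i => ampL H K S (ζ i)) l (𝓝 0) := by
  let T : ι → (H →L[ℂ] H) →ₗ[ℂ] HilbertTensor H K := fun i =>
    (ContinuousLinearMap.apply ℂ _ (ζ i)).toLinearMap ∘ₗ (ampL H K).toAlgHom.toLinearMap
  have hT : ∀ i S, T i S = ampL H K S (ζ i) := fun i S => rfl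
  have hcl : IsClosed (nullSubmodule l T : Set (H →L[ℂ] H)) :=
    isClosed_nullSubmodule l T (C := C) fun i S => by
      rw [hT, mul_comm]
      exact (ContinuousLinearMap.le_opNorm _ _).trans
        (mul_le_mul (norm_ampL_le S) (hC i) (norm_nonneg _) (norm_nonneg _))
  refine hcl.closure_subset_iff.mpr ?_ (mem_closure_span_rankOne hS)
  refine Submodule.span_le.mpr ?_
  rintro _ ⟨e, v, rfl⟩
  have h1 : ∀ w, ampL H K (InnerProductSpace.rankOne ℂ e v) w =
      leftT e (ContinuousLinearMap.adjoint (leftT v) w) := fun w => by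
    have : ampL H K (InnerProductSpace.rankOne ℂ e v) =
        leftT e ∘L ContinuousLinearMap.adjoint (leftT v) := ext_tm fun ξ η => by
      simp [tm_smul_left]
    rw [this]; rfl
  change Tendsto (fun i => ampL H K (InnerProductSpace.rankOne ℂ e v) (ζ i)) l (𝓝 0)
  simp only [h1]
  have h2 := ((leftT e : K →L[ℂ] HilbertTensor H K).continuous.tendsto 0).comp (h v)
  rwa [map_zero] at h2

/-- A factor and its commutant have no common nontrivial closed invariant subspace. -/
theorem IsFactor.eq_top_of_invariant {M : VonNeumannAlgebra H} (hM : M.IsFactor)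
    (G : Submodule ℂ H) (hG : IsClosed (G : Set H)) (h : ∀ a ∈ M, ∀ u ∈ G, a u ∈ G)
    (h' : ∀ a ∈ M.commutant, ∀ u ∈ G, a u ∈ G) {u : H} (hu : u ∈ G) (hu0 : u ≠ 0) : G = ⊤ := by
  have : CompleteSpace G := hG.completeSpace_coe
  have hP : IsStarProjection G.starProjection := isStarProjection_starProjection
  have h1 : G.starProjection ∈ M := (IsStarProjection.mem_iff hP M).mpr fun y hy => by
    rw [Submodule.range_starProjection]
    exact fun v hv => h' y hy v hv
  have h2 : G.starProjection ∈ M.commutant :=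
    (IsStarProjection.mem_iff hP M.commutant).mpr fun y hy => by
      rw [Submodule.range_starProjection]
      rw [commutant_commutant] at hy
      exact fun v hv => h y hy v hv
  obtain ⟨c, hc⟩ := hM.2 _ h1 h2
  have h3 : G.starProjection u = u := Submodule.starProjection_eq_self_iff.mpr hu
  have hc1 : c = 1 := by
    rw [hc] at h3
    have h4 : (c - 1) • u = 0 := by
      rw [sub_smul, one_smul, sub_eq_zero]; exact h3
    exact sub_eq_zero.mp ((smul_eq_zero.mp h4).resolve_right hu0)
  rw [eq_top_iff]
  intro v _
  rw [← Submodule.starProjection_eq_self_iff, hc, hc1, one_smul]; rfl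

end Slices

/-! ### Asymptotically central families in a tensor product -/

section Core

variable {H K : Type*} [NormedAddCommGroup H] [InnerProductSpace ℂ H] [CompleteSpace H]
  [NormedAddCommGroup K] [InnerProductSpace ℂ K] [CompleteSpace K]
  {M : VonNeumannAlgebra H} {N : VonNeumannAlgebra K} {ι : Type*}

theorem mem_commSpan_of_mem {a : H →L[ℂ] H} (ha : a ∈ M) : a ∈ M.commSpan :=
  Submodule.subset_span ⟨a, ha, 1, one_mem _, by rw [mul_one]⟩

theorem mem_commSpan_of_mem_commutant {b : H →L[ℂ] H} (hb : b ∈ M.commutant) : b ∈ M.commSpan :=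
  Submodule.subset_span ⟨1, one_mem _, b, hb, by rw [one_mul]⟩

/-- Asymptotically central families of `M ⊗ N` commute asymptotically with `S ⊗ 1`, for `S` in the
closed span of `M M'`. -/
theorem IsAsympCentral.tendsto_commutator_ampL {l : Filter ι} {x : ι → (M.tensor N).Elem}
    (h : IsAsympCentral l x) {S : H →L[ℂ] H}
    (hS : S ∈ closure (M.commSpan : Set (H →L[ℂ] H))) (ζ : HilbertTensor H K) :
    Tendsto (fun i => ((x i).1 * ampL H K S - ampL H K S * (x i).1) ζ) l (𝓝 0) := by
  obtain ⟨C, hC⟩ := h.bounded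
  let T : ι → (H →L[ℂ] H) →ₗ[ℂ] HilbertTensor H K := fun i =>
    { toFun := fun S => ((x i).1 * ampL H K S - ampL H K S * (x i).1) ζ
      map_add' := fun S S' => by
        rw [map_add, mul_add, add_mul, add_sub_add_comm]; rfl
      map_smul' := fun c S => by
        rw [map_smul, mul_smul_comm, smul_mul_assoc, ← smul_sub]; rfl }
  have hcl : IsClosed (nullSubmodule l T : Set (H →L[ℂ] H)) :=
    isClosed_nullSubmodule l T (C := 2 * C * ‖ζ‖) fun i S => by
      have hx : ‖(x i).1‖ ≤ C := hC i
      have hC0 : 0 ≤ C := (norm_nonneg _).trans hx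
      calc ‖((x i).1 * ampL H K S - ampL H K S * (x i).1) ζ‖
          ≤ ‖(x i).1 * ampL H K S - ampL H K S * (x i).1‖ * ‖ζ‖ :=
            ContinuousLinearMap.le_opNorm _ _
        _ ≤ (C * ‖S‖ + ‖S‖ * C) * ‖ζ‖ := by
            gcongr
            refine (norm_sub_le _ _).trans (add_le_add ?_ ?_)
            · exact (norm_mul_le _ _).trans (mul_le_mul hx (norm_ampL_le S) (norm_nonneg _) hC0)
            · exact (norm_mul_le _ _).trans
                (mul_le_mul (norm_ampL_le S) hx (norm_nonneg _) (norm_nonneg _))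
        _ = 2 * C * ‖ζ‖ * ‖S‖ := by ring
  refine hcl.closure_subset_iff.mpr ?_ hS
  refine Submodule.span_le.mpr ?_
  rintro _ ⟨a, ha, b, hb, rfl⟩
  change Tendsto (fun i => ((x i).1 * ampL H K (a * b) - ampL H K (a * b) * (x i).1) ζ) l (𝓝 0)
  have e : ∀ i, ((x i).1 * ampL H K (a * b) - ampL H K (a * b) * (x i).1) ζ =
      ((x i).1 * ampL H K a - ampL H K a * (x i).1) (ampL H K b ζ) := fun i => by
    rw [map_mul, mul_assoc (ampL H K a), ← commute_ampL hb (x i).2, ← mul_assoc, ← mul_assoc,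
      ← sub_mul, _root_.mul_apply_eq_comp]
  simp only [e]
  exact h.tendsto_commutator (ampL_mem ha) _

/-- Weak slices of an asymptotically central family along an ultrafilter commute with `M` and
`M'`, so they are scalar when `M` is a factor. -/
theorem IsAsympCentral.exists_weak_slice (hM : M.IsFactor) (ω : Ultrafilter ι)
    {x : ι → (M.tensor N).Elem} (h : IsAsympCentral (ω : Filter ι) x) (η : K) {k : ι → K} {D : ℝ}
    (hk : ∀ i, ‖k i‖ ≤ D) :
    ∃ c : ℂ, ∀ v ξ : H, Tendsto (fun i => ⟪k i, slice v ξ (x i).1 η⟫_ℂ) ω (𝓝 (c * ⟪v, ξ⟫_ℂ)) := by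
  obtain ⟨C, hC⟩ := h.bounded
  let T : ι → H →L[ℂ] H := fun i =>
    ContinuousLinearMap.adjoint (rightT (k i)) ∘L (x i).1 ∘L rightT η
  have hTn : ∀ i, ‖T i‖ ≤ D * (C * ‖η‖) := fun i => by
    have hx : ‖(x i).1‖ ≤ C := hC i
    refine (ContinuousLinearMap.opNorm_comp_le _ _).trans (mul_le_mul ?_ ?_ (norm_nonneg _)
      ((norm_nonneg _).trans (hk i)))
    · rw [LinearIsometryEquiv.norm_map]
      exact (norm_rightT_le _).trans (hk i)
    · exact (ContinuousLinearMap.opNorm_comp_le _ _).trans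
        (mul_le_mul hx (norm_rightT_le _) (norm_nonneg _) ((norm_nonneg _).trans hx))
  have hTi : ∀ i v ξ, ⟪v, T i ξ⟫_ℂ = ⟪k i, slice v ξ (x i).1 η⟫_ℂ := fun i v ξ => by
    rw [inner_slice]
    change ⟪v, ContinuousLinearMap.adjoint (rightT (k i)) ((x i).1 (tm ξ η))⟫_ℂ = _
    rw [ContinuousLinearMap.adjoint_inner_right, rightT_apply]
  obtain ⟨s, hs⟩ := ω.exists_wot_limit hTn
  have hcomm : ∀ S ∈ M.commSpan, S * s = s * S := by
    intro S hS
    refine ContinuousLinearMap.ext fun ξ => ext_inner_left ℂ fun v => ?_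
    have h1 : Tendsto (fun i => ⟪v, S (T i ξ)⟫_ℂ) ω (𝓝 ⟪v, S (s ξ)⟫_ℂ) := by
      simpa only [ContinuousLinearMap.adjoint_inner_left] using
        hs ξ (ContinuousLinearMap.adjoint S v)
    have h2 := hs (S ξ) v
    have h3 := h.tendsto_commutator_ampL (subset_closure hS) (tm ξ η)
    have h4 : ∀ i, T i (S ξ) - S (T i ξ) = ContinuousLinearMap.adjoint (rightT (k i))
        (((x i).1 * ampL H K S - ampL H K S * (x i).1) (tm ξ η)) := fun i => by
      rw [_root_.sub_apply, map_sub, _root_.mul_apply_eq_comp, _root_.mul_apply_eq_comp, ampL_tm,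
        adjoint_rightT_ampL]
      rfl
    have h5 : Tendsto (fun i => ⟪v, T i (S ξ) - S (T i ξ)⟫_ℂ) ω (𝓝 0) := by
      rw [tendsto_zero_iff_norm_tendsto_zero] at h3 ⊢
      have h6 := (h3.const_mul D).const_mul ‖v‖
      rw [mul_zero, mul_zero] at h6
      refine squeeze_zero (fun _ => norm_nonneg _) (fun i => ?_) h6
      refine (norm_inner_le_norm _ _).trans ?_
      rw [h4]
      gcongr
      refine (ContinuousLinearMap.le_opNorm _ _).trans ?_
      gcongr
      rw [LinearIsometryEquiv.norm_map]
      exact (norm_rightT_le _).trans (hk i)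
    have h7 := h2.sub h1
    simp only [← inner_sub_right] at h7
    have h8 := tendsto_nhds_unique h7 h5
    rw [inner_sub_right, sub_eq_zero] at h8
    exact h8.symm
  obtain ⟨c, hc⟩ := hM.2 s
    (mem_of_forall_commutant fun y hy => hcomm y (mem_commSpan_of_mem_commutant hy))
    (mem_commutant_iff.mpr fun y hy => hcomm y (mem_commSpan_of_mem hy))
  refine ⟨c, fun v ξ => ?_⟩
  have h1 := hs ξ v
  rw [hc, _root_.smul_apply, inner_smul_right, one_apply_eq_self] at h1
  simpa only [hTi] using h1

/-- Along an ultrafilter, the slices of an asymptotically central family by `ω_{ξ, v}` and by the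
multiple `⟨v, ξ⟩` of a vector state agree asymptotically in the strong topology. Indeed the norm
square of the difference is a difference of weak slices, paired with the difference itself. -/
theorem IsAsympCentral.tendsto_slice_sub (hM : M.IsFactor) (ω : Ultrafilter ι)
    {x : ι → (M.tensor N).Elem} (h : IsAsympCentral (ω : Filter ι) x) {ξ₀ : H} (hξ₀ : ‖ξ₀‖ = 1)
    (v ξ : H) (η : K) :
    Tendsto (fun i => (slice v ξ (x i).1 - ⟪v, ξ⟫_ℂ • slice ξ₀ ξ₀ (x i).1) η) ω (𝓝 0) := by
  obtain ⟨C, hC⟩ := h.bounded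
  set d : ι → K := fun i => (slice v ξ (x i).1 - ⟪v, ξ⟫_ℂ • slice ξ₀ ξ₀ (x i).1) η with hd
  have hdn : ∀ i, ‖d i‖ ≤ (‖v‖ * ‖ξ‖ * C + ‖v‖ * ‖ξ‖ * (‖ξ₀‖ * ‖ξ₀‖ * C)) * ‖η‖ := fun i => by
    have hx : ‖(x i).1‖ ≤ C := hC i
    refine (ContinuousLinearMap.le_opNorm _ _).trans ?_
    gcongr
    refine (norm_sub_le _ _).trans (add_le_add ((norm_slice_le _ _ _).trans (by gcongr)) ?_)
    rw [norm_smul]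
    gcongr
    · exact norm_inner_le_norm _ _
    · exact (norm_slice_le _ _ _).trans (by gcongr)
  obtain ⟨c, hc⟩ := h.exists_weak_slice hM ω η hdn
  have h1 := (hc v ξ).sub ((hc ξ₀ ξ₀).const_mul ⟪v, ξ⟫_ℂ)
  have h2 : c * ⟪v, ξ⟫_ℂ - ⟪v, ξ⟫_ℂ * (c * ⟪ξ₀, ξ₀⟫_ℂ) = 0 := by
    rw [inner_self_eq_norm_sq_to_K, hξ₀]; simp [mul_comm]
  rw [h2] at h1
  have h3 : ∀ i, ⟪d i, slice v ξ (x i).1 η⟫_ℂ - ⟪v, ξ⟫_ℂ * ⟪d i, slice ξ₀ ξ₀ (x i).1 η⟫_ℂ =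
      ((‖d i‖ ^ 2 : ℝ) : ℂ) := fun i => by
    rw [← inner_smul_right, ← inner_sub_right]
    change ⟪d i, d i⟫_ℂ = _
    rw [inner_self_eq_norm_sq_to_K]; push_cast; rfl
  simp only [h3] at h1
  have h4 := h1.norm
  simp only [norm_zero, Complex.norm_real, norm_pow, norm_norm] at h4
  rw [tendsto_zero_iff_norm_tendsto_zero]
  simpa [Real.sqrt_sq (norm_nonneg _)] using h4.sqrt

/-- If the closed span of `M M'` contains a nonzero compact operator, then every asymptotically
central family of `M ⊗ N` is strongly asymptotic to its slice by a vector state. -/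
theorem IsAsympCentral.tendsto_sub_ampR_slice (hM : M.IsFactor)
    (hcpt : ∃ S ∈ closure (M.commSpan : Set (H →L[ℂ] H)), IsCompactOperator S ∧ S ≠ 0)
    (ω : Ultrafilter ι) {x : ι → (M.tensor N).Elem} (h : IsAsympCentral (ω : Filter ι) x)
    {ξ₀ : H} (hξ₀ : ‖ξ₀‖ = 1) (ζ : HilbertTensor H K) :
    Tendsto (fun i => ((x i).1 - ampR H K (slice ξ₀ ξ₀ (x i).1)) ζ) ω (𝓝 0) := by
  obtain ⟨S, hS, hSc, hS0⟩ := hcpt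
  obtain ⟨C, hC⟩ := h.bounded
  obtain ⟨z, hz⟩ : ∃ z : ι → HilbertTensor H K →L[ℂ] HilbertTensor H K,
    z = fun i => (x i).1 - ampR H K (slice ξ₀ ξ₀ (x i).1) := ⟨_, rfl⟩
  have hzn : ∀ i, ‖z i‖ ≤ 2 * C := fun i => by
    have hx : ‖(x i).1‖ ≤ C := hC i
    rw [hz]
    calc _ ≤ ‖(x i).1‖ + ‖ampR H K (slice ξ₀ ξ₀ (x i).1)‖ := norm_sub_le _ _
      _ ≤ C + ‖ξ₀‖ * ‖ξ₀‖ * C := by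
          gcongr
          exact (norm_ampR_le _).trans ((norm_slice_le _ _ _).trans (by gcongr))
      _ = 2 * C := by rw [hξ₀]; ring
  have hzb : ∀ i w, ‖z i w‖ ≤ 2 * C * ‖w‖ := fun i w =>
    (ContinuousLinearMap.le_opNorm _ _).trans (by gcongr; exact hzn i)
  have hzc : ∀ i a w, z i (ampL H K a w) =
      ((x i).1 * ampL H K a - ampL H K a * (x i).1) w + ampL H K a (z i w) := fun i a w => by
    have h1 : ampR H K (slice ξ₀ ξ₀ (x i).1) (ampL H K a w) =
        ampL H K a (ampR H K (slice ξ₀ ξ₀ (x i).1) w) := by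
      rw [← _root_.mul_apply_eq_comp, ← _root_.mul_apply_eq_comp, ampR_mul_ampL, ampL_mul_ampR]
    rw [hz]
    simp only [_root_.sub_apply, _root_.mul_apply_eq_comp, map_sub, h1]
    abel
  -- the vectors `u` with `zᵢ (u ⊗ η) → 0` for all `η` form a closed subspace invariant under
  -- `M` and `M'`
  let G : Submodule ℂ H := ⨅ η : K, nullSubmodule (ω : Filter ι) fun i =>
    (z i ∘L rightT η).toLinearMap
  have hGmem : ∀ u, u ∈ G ↔ ∀ η, Tendsto (fun i => z i (tm u η)) ω (𝓝 0) := fun u => by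
    rw [Submodule.mem_iInf]; rfl
  have hGcl : IsClosed (G : Set H) := by
    rw [Submodule.coe_iInf]
    refine isClosed_iInter fun η => isClosed_nullSubmodule _ _ (C := 2 * C * ‖η‖) fun i u => ?_
    refine (hzb i _).trans ?_
    change 2 * C * ‖tm u η‖ ≤ _
    rw [norm_tm]
    exact le_of_eq (by ring)
  have hGinv : ∀ a ∈ M.commSpan, ∀ u ∈ G, a u ∈ G := by
    intro a ha u hu
    rw [hGmem] at hu ⊢
    intro η
    have h1 := (h.tendsto_commutator_ampL (subset_closure ha) (tm u η)).add
      (((ampL H K a).continuous.tendsto 0).comp (hu η))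
    rw [map_zero, add_zero] at h1
    simp only [← ampL_tm, hzc]
    exact h1
  have hSG : ∀ u, S u ∈ G := by
    intro u
    rw [hGmem]
    intro η
    have h2 : Tendsto (fun i => ampL H K S (z i (tm u η))) ω (𝓝 0) := by
      refine tendsto_ampL_of_compact (fun i => hzb i _) (fun v => ?_) hSc
      refine (h.tendsto_slice_sub hM ω hξ₀ v u η).congr fun i => ?_
      rw [hz]
      simp only [_root_.sub_apply, map_sub, ampR_tm, adjoint_leftT_tm, _root_.smul_apply]
      rfl
    have h1 := (h.tendsto_commutator_ampL hS (tm u η)).add h2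
    rw [add_zero] at h1
    simpa only [← ampL_tm, hzc] using h1
  obtain ⟨u, hu⟩ : ∃ u, S u ≠ 0 := by
    by_contra! h0
    exact hS0 (ContinuousLinearMap.ext h0)
  have hGtop := hM.eq_top_of_invariant G hGcl (fun a ha => hGinv a (mem_commSpan_of_mem ha))
    (fun a ha => hGinv a (mem_commSpan_of_mem_commutant ha)) (hSG u) hu
  have h3 := mem_of_tm_mem (nullSubmodule (ω : Filter ι) fun i => (z i).toLinearMap)
    (isClosed_nullSubmodule _ _ hzb) (fun ξ η => (hGmem ξ).mp (hGtop ▸ Submodule.mem_top) η) ζ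
  rw [hz] at h3
  exact h3

theorem norm_oneTensor_le (y : N.Elem) : ‖M.oneTensor y‖ ≤ ‖y‖ := norm_ampR_le y.1

/-- The slice of an element of `M ⊗ N` by a vector functional, as an element of `N`. -/
noncomputable def sliceElem (v ξ : H) (x : (M.tensor N).Elem) : N.Elem :=
  ⟨slice v ξ x.1, slice_mem v ξ x.2⟩

theorem norm_sliceElem_le (v ξ : H) (x : (M.tensor N).Elem) :
    ‖sliceElem v ξ x‖ ≤ ‖v‖ * ‖ξ‖ * ‖x‖ := norm_slice_le v ξ x.1

/-- Slices of asymptotically central families are asymptotically central. -/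
theorem IsAsympCentral.sliceElem {l : Filter ι} {x : ι → (M.tensor N).Elem}
    (h : IsAsympCentral l x) (v ξ : H) :
    IsAsympCentral l fun i => VonNeumannAlgebra.sliceElem v ξ (x i) := by
  obtain ⟨C, hC⟩ := h.bounded
  refine isAsympCentral_of_vectorFunctional (C := ‖v‖ * ‖ξ‖ * C)
    (fun i => (norm_sliceElem_le v ξ (x i)).trans (by gcongr; exact hC i)) fun η η' => ?_
  refine squeeze_zero (fun _ => norm_nonneg _) (fun i => ?_)
    (h.tendsto _ (vectorFunctional_mem _ (tm ξ η) (tm v η')))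
  refine ContinuousLinearMap.opNorm_le_bound _ (norm_nonneg _) fun b => ?_
  have e : comm (N.vectorFunctional η η') (VonNeumannAlgebra.sliceElem v ξ (x i)) b =
      comm ((M.tensor N).vectorFunctional (tm ξ η) (tm v η')) (x i) (M.oneTensor b) := by
    rw [comm_apply, comm_apply]
    change ⟪η', b.1 (slice v ξ (x i).1 η)⟫_ℂ - ⟪η', slice v ξ (x i).1 (b.1 η)⟫_ℂ =
      ⟪tm v η', ampR H K b.1 ((x i).1 (tm ξ η))⟫_ℂ -
        ⟪tm v η', (x i).1 (ampR H K b.1 (tm ξ η))⟫_ℂ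
    rw [ampR_tm, inner_slice, slice_apply, ← adjoint_leftT_ampR,
      ContinuousLinearMap.adjoint_inner_right, leftT_apply]
  rw [e]
  exact (ContinuousLinearMap.le_opNorm _ _).trans (by gcongr; exact norm_oneTensor_le b)

/-- If `y` is asymptotically central in `N`, then `1 ⊗ y` is asymptotically central in `M ⊗ N`. -/
theorem IsAsympCentral.oneTensor {l : Filter ι} {y : ι → N.Elem} (h : IsAsympCentral l y) :
    IsAsympCentral l fun i => M.oneTensor (y i) := by
  obtain ⟨C, hC⟩ := h.bounded
  have hC' : ∀ i, ‖M.oneTensor (y i)‖ ≤ C := fun i => (norm_oneTensor_le _).trans (hC i)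
  refine isAsympCentral_of_vectorFunctional hC' fun ζ ζ' => ?_
  have hbound : ∀ i (ζ ζ' : HilbertTensor H K),
      ‖comm ((M.tensor N).vectorFunctional ζ ζ') (M.oneTensor (y i))‖ ≤
        2 * C * (‖ζ'‖ * ‖ζ‖) := fun i ζ ζ' => by
    have h0 := (norm_nonneg _).trans (hC' i)
    refine (norm_comm_le _ _).trans ?_
    gcongr
    · exact hC' i
    · exact norm_vectorFunctional_le _ _ _
  -- both sides are (anti)linear and continuous in `ζ` and `ζ'`, so elementary tensors suffice
  let T₁ : HilbertTensor H K → ι → HilbertTensor H K →ₗ[ℂ] ((M.tensor N).Elem →L[ℂ] ℂ) :=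
    fun ζ' i =>
    { toFun := fun ζ => comm ((M.tensor N).vectorFunctional ζ ζ') (M.oneTensor (y i))
      map_add' := fun a b => by
        ext z; simp [comm_apply, vectorFunctional_apply]; ring
      map_smul' := fun c a => by
        ext z; simp [comm_apply, vectorFunctional_apply]; ring }
  let T₂ : HilbertTensor H K → ι →
      HilbertTensor H K →ₛₗ[starRingEnd ℂ] ((M.tensor N).Elem →L[ℂ] ℂ) := fun ζ i =>
    { toFun := fun ζ' => comm ((M.tensor N).vectorFunctional ζ ζ') (M.oneTensor (y i))
      map_add' := fun a b => by
        ext z; simp [comm_apply, vectorFunctional_apply]; ring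
      map_smul' := fun c a => by
        ext z; simp [comm_apply, vectorFunctional_apply]; ring }
  refine tendsto_zero_iff_norm_tendsto_zero.mp ?_
  refine mem_of_tm_mem (nullSubmodule l (T₁ ζ')) (isClosed_nullSubmodule _ _ (C := 2 * C * ‖ζ'‖)
    fun i ζ => (hbound i ζ ζ').trans (le_of_eq (by ring))) (fun ξ η => ?_) ζ
  refine mem_of_tm_mem (nullSubmodule l (T₂ (tm ξ η))) (isClosed_nullSubmodule _ _
    (C := 2 * C * ‖tm ξ η‖) fun i ζ' => (hbound i _ ζ').trans (le_of_eq (by ring)))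
    (fun ξ' η' => ?_) ζ'
  refine tendsto_zero_iff_norm_tendsto_zero.mpr ?_
  have h1 := (h.tendsto _ (vectorFunctional_mem N η η')).mul_const (‖ξ'‖ * ‖ξ‖)
  rw [zero_mul] at h1
  refine squeeze_zero (fun _ => norm_nonneg _) (fun i => ?_) h1
  refine ContinuousLinearMap.opNorm_le_bound _ (by positivity) fun Z => ?_
  have e : T₂ (tm ξ η) i (tm ξ' η') Z =
      comm (N.vectorFunctional η η') (y i) (VonNeumannAlgebra.sliceElem ξ' ξ Z) := by
    change comm _ _ _ = _
    rw [comm_apply, comm_apply]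
    change ⟪tm ξ' η', Z.1 (ampR H K (y i).1 (tm ξ η))⟫_ℂ -
        ⟪tm ξ' η', ampR H K (y i).1 (Z.1 (tm ξ η))⟫_ℂ =
      ⟪η', slice ξ' ξ Z.1 ((y i).1 η)⟫_ℂ - ⟪η', (y i).1 (slice ξ' ξ Z.1 η)⟫_ℂ
    rw [ampR_tm, inner_slice, slice_apply, ← adjoint_leftT_ampR,
      ContinuousLinearMap.adjoint_inner_right, leftT_apply]
  rw [e]
  refine (ContinuousLinearMap.le_opNorm _ _).trans ?_
  rw [mul_assoc]
  gcongr
  exact norm_sliceElem_le _ _ _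

end Core

end VonNeumannAlgebra


/-! ### The map of asymptotic centralizers -/

namespace VonNeumannAlgebra

section Map

variable {H K : Type*} [NormedAddCommGroup H] [InnerProductSpace ℂ H] [CompleteSpace H]
  [NormedAddCommGroup K] [InnerProductSpace ℂ K] [CompleteSpace K]

theorem mem_centralizingSeq_iff {M : VonNeumannAlgebra H} {ω : Ultrafilter ℕ} {x : ℕ → M.Elem} :
    x ∈ M.centralizingSeq ω ↔ IsAsympCentral (ω : Filter ℕ) x :=
  ⟨fun h => ⟨h.1, h.2⟩, fun h => ⟨h.1, h.2⟩⟩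

/-- The homomorphism `(xₙ) ↦ (1 ⊗ xₙ)` from `A_ω(N)` to `A_ω(M ⊗ N)`. -/
noncomputable def oneTensorSeq (M : VonNeumannAlgebra H) (N : VonNeumannAlgebra K)
    (ω : Ultrafilter ℕ) : N.centralizingSeq ω →ₐ[ℂ] (M.tensor N).centralizingSeq ω where
  toFun x := ⟨fun n => M.oneTensor ((x : ℕ → N.Elem) n),
    mem_centralizingSeq_iff.mpr (mem_centralizingSeq_iff.mp x.2).oneTensor⟩
  map_one' := Subtype.ext <| funext fun _ => Subtype.ext <| map_one (ampR H K)
  map_mul' x y := Subtype.ext <| funext fun n => Subtype.ext <|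
    map_mul (ampR H K) ((x : ℕ → N.Elem) n).1 ((y : ℕ → N.Elem) n).1
  map_zero' := Subtype.ext <| funext fun _ => Subtype.ext <| map_zero (ampR H K)
  map_add' x y := Subtype.ext <| funext fun n => Subtype.ext <|
    map_add (ampR H K) ((x : ℕ → N.Elem) n).1 ((y : ℕ → N.Elem) n).1
  commutes' c := Subtype.ext <| funext fun _ => Subtype.ext <|
    AlgHomClass.commutes (ampR H K) c

theorem oneTensorSeq_mem_nullSeq (M : VonNeumannAlgebra H) (N : VonNeumannAlgebra K)
    (ω : Ultrafilter ℕ) {x : N.centralizingSeq ω} (hx : x ∈ N.nullSeq ω) :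
    oneTensorSeq M N ω x ∈ (M.tensor N).nullSeq ω := by
  obtain ⟨⟨C, hC⟩, -⟩ := x.2
  have key : ∀ y : ℕ → N.Elem, (∀ n, ‖y n‖ ≤ C) →
      (∀ η : K, Tendsto (fun n => (y n : K →L[ℂ] K) η) ω (𝓝 0)) → ∀ ζ : HilbertTensor H K,
      Tendsto (fun n => ampR H K (y n : K →L[ℂ] K) ζ) ω (𝓝 0) := by
    intro y hy hy0 ζ
    refine mem_of_tm_mem (nullSubmodule (ω : Filter ℕ) fun n => (ampR H K (y n).1).toLinearMap)
      (isClosed_nullSubmodule _ _ (C := C) fun n w => ?_) (fun ξ η => ?_) ζ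
    · refine (ContinuousLinearMap.le_opNorm _ _).trans ?_
      gcongr
      exact (norm_ampR_le _).trans (hy n)
    · have h1 := ((leftT ξ : K →L[ℂ] HilbertTensor H K).continuous.tendsto 0).comp (hy0 η)
      rw [map_zero] at h1
      refine h1.congr fun n => ?_
      exact (ampR_tm (y n).1 ξ η).symm
  intro ζ
  refine ⟨key x hC (fun η => (hx η).1) ζ, ?_⟩
  refine (key (star (x : ℕ → N.Elem)) (fun n => (norm_star _).trans_le (hC n))
    (fun η => (hx η).2) ζ).congr fun n => ?_
  exact DFunLike.congr_fun (map_star (ampR H K) ((x : ℕ → N.Elem) n).1) ζ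

/-- The homomorphism `N_ω → (M ⊗ N)_ω` induced by `(xₙ) ↦ (1 ⊗ xₙ)`. -/
noncomputable def oneTensorAsymptotic (M : VonNeumannAlgebra H) (N : VonNeumannAlgebra K)
    (ω : Ultrafilter ℕ) :
    N.AsymptoticCentralizer ω →ₐ[ℂ] (M.tensor N).AsymptoticCentralizer ω :=
  Ideal.Quotient.liftₐ (N.nullSeq ω)
    ((Ideal.Quotient.mkₐ ℂ ((M.tensor N).nullSeq ω)).comp (oneTensorSeq M N ω)) fun _ hx =>
    Ideal.Quotient.eq_zero_iff_mem.mpr (oneTensorSeq_mem_nullSeq M N ω hx)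

theorem oneTensorAsymptotic_surjective {M : VonNeumannAlgebra H} {N : VonNeumannAlgebra K}
    (hM : M.IsFactor)
    (hcpt : ∃ S ∈ closure (M.commSpan : Set (H →L[ℂ] H)), IsCompactOperator S ∧ S ≠ 0)
    (ω : Ultrafilter ℕ) : Function.Surjective (oneTensorAsymptotic M N ω) := by
  intro X
  obtain ⟨x, rfl⟩ := Ideal.Quotient.mk_surjective X
  have := hM.1
  obtain ⟨ξ₀, hξ₀⟩ := exists_norm_eq H zero_le_one
  have hx := mem_centralizingSeq_iff.mp x.2
  let y : N.centralizingSeq ω :=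
    ⟨_, mem_centralizingSeq_iff.mpr (hx.sliceElem ξ₀ ξ₀)⟩
  refine ⟨Ideal.Quotient.mk _ y, ?_⟩
  change Ideal.Quotient.mk _ (oneTensorSeq M N ω y) = _
  refine (Ideal.Quotient.eq.mpr ?_).symm
  intro ζ
  refine ⟨hx.tendsto_sub_ampR_slice hM hcpt ω hξ₀ ζ, ?_⟩
  refine (hx.star_family.tendsto_sub_ampR_slice hM hcpt ω hξ₀ ζ).congr fun n => ?_
  congr 1
  change _ = star (((x : ℕ → (M.tensor N).Elem) n).1 - ampR H K (slice ξ₀ ξ₀ _))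
  rw [star_sub, ← map_star, ContinuousLinearMap.star_eq_adjoint (slice _ _ _), adjoint_slice]
  rfl

end Map

end VonNeumannAlgebra


/-! ### Tensor products of factors -/

namespace VonNeumannAlgebra

section TensorFactor

variable {H K : Type*} [NormedAddCommGroup H] [InnerProductSpace ℂ H] [CompleteSpace H]
  [NormedAddCommGroup K] [InnerProductSpace ℂ K] [CompleteSpace K]

theorem IsFactor.tensor {M : VonNeumannAlgebra H} {N : VonNeumannAlgebra K} (hM : M.IsFactor)
    (hN : N.IsFactor) : (M.tensor N).IsFactor := by
  have := hM.1
  have := hN.1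
  obtain ⟨ξ₀, hξ₀⟩ := exists_norm_eq H zero_le_one
  obtain ⟨η₀, hη₀⟩ := exists_norm_eq K zero_le_one
  refine ⟨⟨tm ξ₀ η₀, 0, fun h => ?_⟩, fun x hx hx' => ?_⟩
  · have := congrArg norm h
    simp [hξ₀, hη₀] at this
  have hc := mem_commutant_iff.mp hx'
  -- slicing one leg of `x` gives central elements of `N`, slicing the other gives scalars as well
  have h1 : ∀ v ξ, ∃ c : ℂ, slice v ξ x = c • (1 : K →L[ℂ] K) := fun v ξ => by
    refine hN.2 _ (slice_mem v ξ hx) (mem_commutant_iff.mpr fun b hb => ?_)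
    ext η
    have h := DFunLike.congr_fun (hc _ (ampR_mem (M := M) hb)) (tm ξ η)
    rw [_root_.mul_apply_eq_comp, _root_.mul_apply_eq_comp, slice_apply,
      slice_apply, ← adjoint_leftT_ampR]
    rw [_root_.mul_apply_eq_comp, _root_.mul_apply_eq_comp, ampR_tm] at h
    rw [h]
  let R : H →L[ℂ] H := ContinuousLinearMap.adjoint (rightT η₀) ∘L x ∘L rightT η₀
  have hR : ∀ a : H →L[ℂ] H, ampL H K a * x = x * ampL H K a → a * R = R * a := fun a ha => by
    ext ξ
    have h := DFunLike.congr_fun ha (tm ξ η₀)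
    rw [_root_.mul_apply_eq_comp, _root_.mul_apply_eq_comp, ampL_tm] at h
    change a (ContinuousLinearMap.adjoint (rightT η₀) (x (tm ξ η₀))) =
      ContinuousLinearMap.adjoint (rightT η₀) (x (tm (a ξ) η₀))
    rw [← adjoint_rightT_ampL, h]
  obtain ⟨c, hcR⟩ := hM.2 R
    (mem_of_forall_commutant fun a ha => hR a (commute_ampL ha hx).symm)
    (mem_commutant_iff.mpr fun a ha => hR a (hc _ (ampL_mem ha)))
  refine ⟨c, ext_tm fun ξ η => ext_inner_tm fun v η' => ?_⟩
  obtain ⟨d, hd⟩ := h1 v ξ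
  have hη₀' : ⟪η₀, η₀⟫_ℂ = 1 := by rw [inner_self_eq_norm_sq_to_K, hη₀]; simp
  have h2 : d = c * ⟪v, ξ⟫_ℂ := by
    have h3 : ⟪v, R ξ⟫_ℂ = ⟪η₀, slice v ξ x η₀⟫_ℂ := by
      rw [inner_slice]
      exact ContinuousLinearMap.adjoint_inner_right (rightT η₀) v _
    rw [hcR, hd, _root_.smul_apply, _root_.smul_apply, one_apply_eq_self, one_apply_eq_self,
      inner_smul_right, inner_smul_right, hη₀', mul_one] at h3
    exact h3.symm
  rw [← inner_slice, hd, h2, _root_.smul_apply, _root_.smul_apply, one_apply_eq_self,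
    one_apply_eq_self, inner_smul_right, inner_smul_right, inner_tm, mul_assoc]

end TensorFactor

/-! ### Automorphisms acting on the predual -/

section Pull

variable {H : Type*} [NormedAddCommGroup H] [InnerProductSpace ℂ H] [CompleteSpace H]
  {M : VonNeumannAlgebra H}

/-- The isometric action `f ↦ f ∘ θ` of an automorphism on the dual of `M`. -/
noncomputable def pull (θ : M.Elem ≃⋆ₐ[ℂ] M.Elem) :
    (M.Elem →L[ℂ] ℂ) →ₗᵢ[ℂ] (M.Elem →L[ℂ] ℂ) where
  toFun f := f.comp (autCLM θ)
  map_add' _ _ := rfl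
  map_smul' _ _ := rfl
  norm_map' f := by
    have key : ∀ (θ : M.Elem ≃⋆ₐ[ℂ] M.Elem) (f : M.Elem →L[ℂ] ℂ), ‖f.comp (autCLM θ)‖ ≤ ‖f‖ :=
      fun θ f => ContinuousLinearMap.opNorm_le_bound _ (norm_nonneg _) fun z =>
        (f.le_opNorm _).trans (by gcongr; exact NonUnitalStarAlgHom.norm_apply_le θ z)
    refine le_antisymm (key θ f) ?_
    have h : f = (f.comp (autCLM θ)).comp (autCLM θ.symm) :=
      ContinuousLinearMap.ext fun z => congrArg f (θ.apply_symm_apply z).symm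
    exact (congrArg norm h).trans_le (key θ.symm _)

theorem pull_apply (θ : M.Elem ≃⋆ₐ[ℂ] M.Elem) (f : M.Elem →L[ℂ] ℂ) (z : M.Elem) :
    pull θ f z = f (θ z) := rfl

/-- Pull-back of functionals by the inner automorphism `x ↦ u x u*`. -/
noncomputable abbrev rot (u : unitary M.Elem) : (M.Elem →L[ℂ] ℂ) →ₗᵢ[ℂ] (M.Elem →L[ℂ] ℂ) :=
  pull (Unitary.conjStarAlgAut ℂ M.Elem u)

theorem rot_apply (u : unitary M.Elem) (f : M.Elem →L[ℂ] ℂ) (z : M.Elem) :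
    rot u f z = f (u * z * star (u : M.Elem)) := by
  rw [pull_apply, Unitary.conjStarAlgAut_apply]

theorem rot_mul (u v : unitary M.Elem) (f : M.Elem →L[ℂ] ℂ) : rot (u * v) f = rot v (rot u f) := by
  ext z
  rw [pull_apply, map_mul]; rfl

@[simp] theorem rot_one (f : M.Elem →L[ℂ] ℂ) : rot (1 : unitary M.Elem) f = f := by
  ext z
  rw [pull_apply, map_one]; rfl

@[simp] theorem rot_rot_inv (u : unitary M.Elem) (f : M.Elem →L[ℂ] ℂ) : rot u (rot u⁻¹ f) = f := by
  rw [← rot_mul, inv_mul_cancel, rot_one]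

theorem norm_coe_unitary_le (u : unitary M.Elem) : ‖(u : M.Elem)‖ ≤ 1 := by
  rcases subsingleton_or_nontrivial M.Elem with h | h
  · rw [Subsingleton.elim (u : M.Elem) 0, norm_zero]; exact zero_le_one
  · exact (CStarRing.norm_coe_unitary u).le

/-- Asymptotic centrality of unitaries is convergence to the identity of the inner automorphisms. -/
theorem norm_rot_sub (u : unitary M.Elem) (f : M.Elem →L[ℂ] ℂ) :
    ‖rot u f - f‖ = ‖comm f (u : M.Elem)‖ := by
  refine le_antisymm (ContinuousLinearMap.opNorm_le_bound _ (norm_nonneg _) fun z => ?_)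
    (ContinuousLinearMap.opNorm_le_bound _ (norm_nonneg _) fun z => ?_)
  · have h := norm_comm_apply_le f (u : M.Elem) (z * star (u : M.Elem))
    rw [mul_assoc, Unitary.coe_star_mul_self, mul_one, ← mul_assoc, norm_sub_rev, ← rot_apply] at h
    refine h.trans ?_
    gcongr
    refine (norm_mul_le _ _).trans (mul_le_of_le_one_right (norm_nonneg _) ?_)
    rw [norm_star]; exact norm_coe_unitary_le u
  · have h := (rot u f - f).le_opNorm (z * (u : M.Elem))
    rw [_root_.sub_apply, rot_apply, ← mul_assoc, mul_assoc ((u : M.Elem) * z),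
      Unitary.mul_star_self_of_mem u.2, mul_one, norm_sub_rev, ← comm_apply] at h
    refine h.trans ?_
    gcongr
    exact (norm_mul_le _ _).trans (mul_le_of_le_one_right (norm_nonneg _) (norm_coe_unitary_le u))

theorem norm_rot_inv_sub (u : unitary M.Elem) (f : M.Elem →L[ℂ] ℂ) :
    ‖rot u⁻¹ f - f‖ = ‖rot u f - f‖ := by
  rw [← (rot u).norm_map (rot u⁻¹ f - f), map_sub, rot_rot_inv, norm_sub_rev]

theorem continuous_vectorFunctional :
    Continuous fun p : H × H => M.vectorFunctional p.1 p.2 := by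
  refine continuous_iff_continuousAt.mpr fun p => ?_
  rw [ContinuousAt, tendsto_iff_norm_sub_tendsto_zero]
  have hb : ∀ q : H × H, ‖M.vectorFunctional q.1 q.2 - M.vectorFunctional p.1 p.2‖ ≤
      ‖q.2‖ * ‖q.1 - p.1‖ + ‖q.2 - p.2‖ * ‖p.1‖ := fun q => by
    have e : M.vectorFunctional q.1 q.2 - M.vectorFunctional p.1 p.2 =
        M.vectorFunctional (q.1 - p.1) q.2 + M.vectorFunctional p.1 (q.2 - p.2) := by
      ext z
      simp [vectorFunctional_apply]
    rw [e]
    exact (norm_add_le _ _).trans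
      (add_le_add (norm_vectorFunctional_le _ _ _) (norm_vectorFunctional_le _ _ _))
  refine squeeze_zero (fun _ => norm_nonneg _) hb ?_
  have : Continuous fun q : H × H => ‖q.2‖ * ‖q.1 - p.1‖ + ‖q.2 - p.2‖ * ‖p.1‖ := by fun_prop
  simpa using this.tendsto p

/-- A closed submodule of the dual that contains the vector functionals of a dense sequence of
vectors contains the predual. -/
theorem predual_subset_of_dense {e : ℕ → H} (he : DenseRange e)
    (S : Submodule ℂ (M.Elem →L[ℂ] ℂ)) (hS : IsClosed (S : Set (M.Elem →L[ℂ] ℂ)))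
    (h : ∀ m n, M.vectorFunctional (e m) (e n) ∈ S) {f : M.Elem →L[ℂ] ℂ} (hf : f ∈ M.predual) :
    f ∈ S := by
  refine predual_subset_of_isClosed S hS (fun ξ η => ?_) hf
  have hd : DenseRange (Prod.map e e) := he.prodMap he
  refine hd.induction_on (p := fun p : H × H => M.vectorFunctional p.1 p.2 ∈ S) (ξ, η)
    (hS.preimage continuous_vectorFunctional) fun a => h a.1 a.2

/-- Asymptotic equality of two families of automorphisms on the predual may be tested on the
vector functionals of a dense sequence of vectors. -/
theorem tendsto_pull_sub_of_dense {ι : Type*} {l : Filter ι} {p q : ι → M.Elem ≃⋆ₐ[ℂ] M.Elem}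
    {e : ℕ → H} (he : DenseRange e)
    (h : ∀ m n, Tendsto (fun i => pull (p i) (M.vectorFunctional (e m) (e n)) -
      pull (q i) (M.vectorFunctional (e m) (e n))) l (𝓝 0)) {f : M.Elem →L[ℂ] ℂ}
    (hf : f ∈ M.predual) : Tendsto (fun i => pull (p i) f - pull (q i) f) l (𝓝 0) := by
  refine predual_subset_of_dense he
    (nullSubmodule l fun i => (pull (p i)).toLinearMap - (pull (q i)).toLinearMap)
    (isClosed_nullSubmodule _ _ (C := 2) fun i v => ?_) h hf
  refine (norm_sub_le _ _).trans (le_of_eq ?_)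
  change ‖pull (p i) v‖ + ‖pull (q i) v‖ = _
  rw [LinearIsometry.norm_map, LinearIsometry.norm_map, two_mul]

end Pull

/-! ### Strong limits and isometries -/

section StrongLimits

/-- A bounded pointwise Cauchy family of operators has a strong limit. -/
theorem exists_strong_limit {ι V W : Type*} [NormedAddCommGroup V] [NormedSpace ℂ V]
    [NormedAddCommGroup W] [NormedSpace ℂ W] [CompleteSpace W] {l : Filter ι} [l.NeBot]
    {T : ι → V →L[ℂ] W} {C : ℝ} (hT : ∀ i, ‖T i‖ ≤ C)
    (h : ∀ v, Tendsto (fun p : ι × ι => T p.1 v - T p.2 v) (l ×ˢ l) (𝓝 0)) :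
    ∃ S : V →L[ℂ] W, ∀ v, Tendsto (fun i => T i v) l (𝓝 (S v)) := by
  have hc : ∀ v, ∃ w, Tendsto (fun i => T i v) l (𝓝 w) := fun v => by
    refine cauchy_iff_exists_le_nhds.mp (cauchy_map_iff.mpr ⟨inferInstance, ?_⟩)
    rw [uniformity_eq_comap_nhds_zero_swapped, tendsto_comap_iff]
    exact h v
  choose s hs using hc
  refine ⟨LinearMap.mkContinuous
    { toFun := s
      map_add' := fun x y => tendsto_nhds_unique (hs (x + y)) (by
        simpa only [map_add] using (hs x).add (hs y))
      map_smul' := fun c x => tendsto_nhds_unique (hs (c • x)) (by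
        simpa only [map_smul, RingHom.id_apply] using (hs x).const_smul c) } C (fun x => ?_), hs⟩
  exact le_of_tendsto (hs x).norm (Eventually.of_forall fun i =>
    ((T i).le_opNorm x).trans (by gcongr; exact hT i))

variable {H : Type*} [NormedAddCommGroup H] [InnerProductSpace ℂ H] [CompleteSpace H]
  {M : VonNeumannAlgebra H}

theorem mem_of_strong_limit {ι : Type*} {l : Filter ι} [l.NeBot] {T : ι → H →L[ℂ] H}
    {S : H →L[ℂ] H} (hT : ∀ i, T i ∈ M) (h : ∀ v, Tendsto (fun i => T i v) l (𝓝 (S v))) :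
    S ∈ M := by
  refine mem_of_forall_commutant fun y hy => ContinuousLinearMap.ext fun v => ?_
  refine tendsto_nhds_unique ((y.continuous.tendsto _).comp (h v)) ((h (y v)).congr fun i => ?_)
  exact (DFunLike.congr_fun (mem_commutant_iff.mp hy _ (hT i)) v).trans rfl

/-- Strong limits `w` of unitaries `uᵢ` with `uᵢ* z uᵢ → θ z` weakly for an automorphism `θ` are
unitary and implement `θ`. Such a limit is an isometry with `θ z = w* z w`, so
`θ (1 - w w*) = 0`. -/
theorem exists_unitary_of_strong_limit {ι : Type*} {l : Filter ι} [l.NeBot]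
    {u : ι → unitary M.Elem} {θ : M.Elem ≃⋆ₐ[ℂ] M.Elem}
    (hθ : ∀ ξ η z, Tendsto (fun i => rot (u i)⁻¹ (M.vectorFunctional ξ η) z) l
      (𝓝 (M.vectorFunctional ξ η (θ z))))
    {S : H →L[ℂ] H} (hS : ∀ v, Tendsto (fun i => ((u i : M.Elem) : H →L[ℂ] H) v) l (𝓝 (S v))) :
    ∃ w : unitary M.Elem, ((w : M.Elem) : H →L[ℂ] H) = S ∧
      θ = Unitary.conjStarAlgAut ℂ M.Elem w⁻¹ := by
  have hSM : S ∈ M := mem_of_strong_limit (fun i => (u i : M.Elem).2) hS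
  let w : M.Elem := ⟨S, hSM⟩
  have hw : ∀ z, θ z = star w * z * w := fun z => by
    refine Subtype.ext (ContinuousLinearMap.ext fun ξ => ext_inner_left ℂ fun η => ?_)
    refine tendsto_nhds_unique (hθ ξ η z) ?_
    have h1 := ((z.1.continuous.tendsto _).comp (hS ξ))
    have h2 := (hS η).inner (𝕜 := ℂ) h1
    have e : ⟪η, (star w * z * w).1 ξ⟫_ℂ = ⟪S η, z.1 (S ξ)⟫_ℂ :=
      ContinuousLinearMap.adjoint_inner_right S η _
    rw [e]
    refine h2.congr fun i => ?_
    rw [rot_apply]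
    symm
    have e2 : (((u i)⁻¹ : unitary M.Elem) : M.Elem) = star (u i : M.Elem) := rfl
    rw [e2, star_star]
    exact ContinuousLinearMap.adjoint_inner_right (u i : M.Elem).1 η _
  have h1 : star w * w = 1 := by
    have := hw 1
    rw [map_one, mul_one] at this
    exact this.symm
  have h2 : w * star w = 1 := by
    have h3 : θ (1 - w * star w) = 0 := by
      rw [hw, mul_sub, sub_mul, mul_one, ← mul_assoc, h1, one_mul, h1, sub_self]
    rw [map_eq_zero_iff θ θ.injective, sub_eq_zero] at h3
    exact h3.symm
  refine ⟨⟨w, Unitary.mem_iff.mpr ⟨h1, h2⟩⟩, rfl, ?_⟩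
  refine StarAlgEquiv.ext fun z => ?_
  rw [Unitary.conjStarAlgAut_apply, hw]
  change _ = star w * z * star (star w)
  rw [star_star]

end StrongLimits

end VonNeumannAlgebra


/-! ### A Baire category argument in topological groups -/

section BaireGroup

variable {G : Type*} [Group G] [TopologicalSpace G] [IsTopologicalGroup G] [BaireSpace G]

/-- If countably many left translates of `V` cover a Baire group, then `V⁻¹ V` is dense in a
neighbourhood of `1`. -/
theorem closure_inv_mul_mem_nhds_one {V : Set G}
    (hV : ∃ s : Set G, s.Countable ∧ ∀ g, ∃ h ∈ s, h⁻¹ * g ∈ V) :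
    closure {g | ∃ a ∈ V, ∃ b ∈ V, g = a⁻¹ * b} ∈ 𝓝 (1 : G) := by
  obtain ⟨s, hs, hcov⟩ := hV
  have := hs.to_subtype
  obtain ⟨h, x, hx⟩ := nonempty_interior_of_iUnion_of_closed
    (f := fun h : s => (fun g => (h : G)⁻¹ * g) ⁻¹' closure V)
    (fun h => isClosed_closure.preimage (continuous_const_mul _))
    (Set.eq_univ_of_forall fun g => by
      obtain ⟨h, hh, hg⟩ := hcov g
      exact Set.mem_iUnion.mpr ⟨⟨h, hh⟩, subset_closure hg⟩)
  have hy : closure V ∈ 𝓝 ((h : G)⁻¹ * x) := by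
    rw [← map_mul_left_nhds]
    exact Filter.mem_map.mpr (mem_interior_iff_mem_nhds.mp hx)
  obtain ⟨v, hvV, hv⟩ := ((mem_closure_iff_frequently.mp (mem_of_mem_nhds hy)).and_eventually
    (eventually_mem_nhds_iff.mpr hy)).exists
  have h1 : (fun g => v * g) ⁻¹' closure V ∈ 𝓝 (1 : G) :=
    (continuous_const_mul v).continuousAt.preimage_mem_nhds (by simpa using hv)
  filter_upwards [h1] with g hg
  have := map_mem_closure (continuous_const_mul v⁻¹) hg
    (t := {g | ∃ a ∈ V, ∃ b ∈ V, g = a⁻¹ * b}) fun b hb => ⟨v, hvV, b, hb, rfl⟩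
  simpa using this

/-- In a Baire group, elements near `1` are limits of products `a₀⁻¹ b₀ a₁⁻¹ b₁ ⋯` with
`aₙ, bₙ ∈ Vₙ`, if countably many translates of each `Vₙ` cover the group. This is the successive
approximation in the open mapping theorem. -/
theorem exists_seq_tendsto_of_countable_cover [FirstCountableTopology G] (V : ℕ → Set G)
    (hV : ∀ n, ∃ s : Set G, s.Countable ∧ ∀ g, ∃ h ∈ s, h⁻¹ * g ∈ V n) :
    ∃ O ∈ 𝓝 (1 : G), ∀ u ∈ O, ∃ w : ℕ → G, w 0 = 1 ∧
      (∀ n, ∃ a ∈ V n, ∃ b ∈ V n, w (n + 1) = w n * (a⁻¹ * b)) ∧ Tendsto w atTop (𝓝 u) := by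
  let A : ℕ → Set G := fun n => {g | ∃ a ∈ V n, ∃ b ∈ V n, g = a⁻¹ * b}
  have hA : ∀ n, closure (A n) ∈ 𝓝 (1 : G) := fun n => closure_inv_mul_mem_nhds_one (hV n)
  obtain ⟨B, hB⟩ := (𝓝 (1 : G)).exists_antitone_basis
  refine ⟨closure (A 0), hA 0, fun u hu => ?_⟩
  have step : ∀ n (w : G), w⁻¹ * u ∈ closure (A n) →
      ∃ w', (∃ a ∈ V n, ∃ b ∈ V n, w' = w * (a⁻¹ * b)) ∧
        w'⁻¹ * u ∈ closure (A (n + 1)) ∧ w'⁻¹ * u ∈ B n := by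
    intro n w hw
    have h1 : Tendsto (fun a => a⁻¹ * (w⁻¹ * u)) (𝓝 (w⁻¹ * u)) (𝓝 1) := by
      have : Continuous fun a : G => a⁻¹ * (w⁻¹ * u) := by fun_prop
      simpa using this.tendsto (w⁻¹ * u)
    obtain ⟨a, ⟨c, hc, d, hd, rfl⟩, h2⟩ := ((mem_closure_iff_frequently.mp hw).and_eventually
      (h1 (inter_mem (hA (n + 1)) (hB.mem n)))).exists
    refine ⟨w * (c⁻¹ * d), ⟨c, hc, d, hd, rfl⟩, ?_⟩
    rw [mul_inv_rev, mul_assoc]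
    exact h2
  choose! nxt hn1 hn2 hn3 using step
  let w : ℕ → G := fun n => Nat.rec 1 nxt n
  have hw : ∀ n, (w n)⁻¹ * u ∈ closure (A n) := fun n => by
    induction n with
    | zero => simpa [w] using hu
    | succ n ih => exact hn2 n (w n) ih
  refine ⟨w, rfl, fun n => hn1 n (w n) (hw n), ?_⟩
  have h1 : Tendsto (fun n => (w (n + 1))⁻¹ * u) atTop (𝓝 1) :=
    hB.tendsto fun n => hn3 n (w n) (hw n)
  have h2 := (h1.inv).const_mul u
  simp only [mul_inv_rev, inv_inv, inv_one, mul_one, mul_inv_cancel_left] at h2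
  exact (tendsto_add_atTop_iff_nat 1).mp h2

end BaireGroup

/-! ### Limits of inner automorphisms -/

namespace VonNeumannAlgebra

variable {H : Type*} [NormedAddCommGroup H] [InnerProductSpace ℂ H] [CompleteSpace H]
  {M : VonNeumannAlgebra H}

theorem ext_vectorFunctional {x y : M.Elem}
    (h : ∀ ξ η, M.vectorFunctional ξ η x = M.vectorFunctional ξ η y) : x = y :=
  Subtype.ext (ContinuousLinearMap.ext fun ξ => ext_inner_left ℂ fun η => h ξ η)

theorem rot_vectorFunctional (u : unitary M.Elem) (ξ η : H) :
    rot u (M.vectorFunctional ξ η) = M.vectorFunctional (star (u : M.Elem).1 ξ)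
      (star (u : M.Elem).1 η) := by
  ext z
  rw [rot_apply]
  exact (ContinuousLinearMap.adjoint_inner_left (u : M.Elem).1 _ η).symm

theorem norm_unitary_conj_le (u : unitary M.Elem) (z : M.Elem) :
    ‖(u : M.Elem) * z * star (u : M.Elem)‖ ≤ ‖z‖ := by
  rw [← Unitary.conjStarAlgAut_apply (S := ℂ)]
  exact NonUnitalStarAlgHom.norm_apply_le (Unitary.conjStarAlgAut ℂ M.Elem u) z

/-- Norm limits of vector functionals are continuous along bounded weakly convergent families. -/
theorem tendsto_apply_of_mem_closure {ι : Type*} {l : Filter ι} {z : ι → M.Elem} {z₀ : M.Elem}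
    {C : ℝ} (hC : ∀ i, ‖z i‖ ≤ C)
    (h : ∀ ξ η, Tendsto (fun i => M.vectorFunctional ξ η (z i)) l
      (𝓝 (M.vectorFunctional ξ η z₀)))
    {f : M.Elem →L[ℂ] ℂ} (hf : f ∈ closure {f | ∃ ξ η, f = M.vectorFunctional ξ η}) :
    Tendsto (fun i => f (z i)) l (𝓝 (f z₀)) := by
  let T : ι → (M.Elem →L[ℂ] ℂ) →ₗ[ℂ] ℂ := fun i =>
    (ContinuousLinearMap.apply ℂ ℂ (z i - z₀)).toLinearMap
  have hcl : IsClosed (nullSubmodule l T : Set (M.Elem →L[ℂ] ℂ)) :=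
    isClosed_nullSubmodule l T (C := C + ‖z₀‖) fun i f => by
      rw [mul_comm]
      refine (f.le_opNorm _).trans ?_
      gcongr
      exact (norm_sub_le _ _).trans (by gcongr; exact hC i)
  have h1 : f ∈ (nullSubmodule l T : Set (M.Elem →L[ℂ] ℂ)) := by
    refine (hcl.closure_subset_iff.mpr ?_) hf
    rintro _ ⟨ξ, η, rfl⟩
    change Tendsto (fun i => M.vectorFunctional ξ η (z i - z₀)) l (𝓝 0)
    simp only [map_sub]
    exact tendsto_sub_nhds_zero_iff.mpr (h ξ η)
  have h2 : Tendsto (fun i => f (z i - z₀)) l (𝓝 0) := h1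
  simp only [map_sub] at h2
  exact tendsto_sub_nhds_zero_iff.mp h2

/-- Conjugates by unitaries converge weakly along an ultrafilter. -/
theorem exists_conj_limit {ι : Type*} (ω : Ultrafilter ι) (u : ι → unitary M.Elem) :
    ∃ θ : M.Elem → M.Elem, ∀ x ξ η, Tendsto (fun i => rot (u i) (M.vectorFunctional ξ η) x) ω
      (𝓝 (M.vectorFunctional ξ η (θ x))) := by
  have key : ∀ x : M.Elem, ∃ y : M.Elem, ∀ ξ η,
      Tendsto (fun i => rot (u i) (M.vectorFunctional ξ η) x) ω
        (𝓝 (M.vectorFunctional ξ η y)) := fun x => by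
    obtain ⟨S, hS⟩ := ω.exists_wot_limit
      (T := fun i => ((u i : M.Elem) * x * star (u i : M.Elem)).1)
      fun i => norm_unitary_conj_le (u i) x
    refine ⟨⟨S, mem_of_forall_commutant fun y hy => ?_⟩, fun ξ η => hS ξ η⟩
    refine ContinuousLinearMap.ext fun ξ => ext_inner_left ℂ fun η => ?_
    have h1 := hS ξ (ContinuousLinearMap.adjoint y η)
    simp only [ContinuousLinearMap.adjoint_inner_left] at h1
    refine tendsto_nhds_unique h1 ((hS (y ξ) η).congr fun i => ?_)
    exact congrArg (fun T : H →L[ℂ] H => ⟪η, T ξ⟫_ℂ)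
      (mem_commutant_iff.mp hy _ ((u i : M.Elem) * x * star (u i : M.Elem)).2)
  choose θ hθ using key
  exact ⟨θ, hθ⟩

section Limit

variable {ι : Type*} {ω : Ultrafilter ι} {u : ι → unitary M.Elem} {θ θ' : M.Elem → M.Elem}

theorem conj_limit_mem_closure {g : M.Elem →L[ℂ] ℂ} {ξ η : H}
    (hg : Tendsto (fun i => rot (u i) (M.vectorFunctional ξ η)) ω (𝓝 g)) :
    g ∈ closure {f | ∃ ξ η, f = M.vectorFunctional ξ η} :=
  mem_closure_of_tendsto hg (Eventually.of_forall fun _ => ⟨_, _, rot_vectorFunctional _ _ _⟩)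

/-- The weak limits of `u x u*` and `u* x u` are inverse to each other, provided that they are
norm limits on functionals. -/
theorem conj_limit_left_inverse
    (hθ : ∀ x ξ η, Tendsto (fun i => rot (u i) (M.vectorFunctional ξ η) x) ω
      (𝓝 (M.vectorFunctional ξ η (θ x))))
    (hθ' : ∀ x ξ η, Tendsto (fun i => rot (u i)⁻¹ (M.vectorFunctional ξ η) x) ω
      (𝓝 (M.vectorFunctional ξ η (θ' x))))
    (hu' : ∀ ξ η, ∃ g, Tendsto (fun i => rot (u i)⁻¹ (M.vectorFunctional ξ η)) ω (𝓝 g))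
    (x : M.Elem) : θ' (θ x) = x := by
  refine ext_vectorFunctional fun ξ η => ?_
  obtain ⟨g, hg⟩ := hu' ξ η
  have h1 : M.vectorFunctional ξ η (θ' (θ x)) = g (θ x) :=
    tendsto_nhds_unique (hθ' (θ x) ξ η)
      (((ContinuousLinearMap.apply ℂ ℂ (θ x)).continuous.tendsto g).comp hg)
  have h2 : Tendsto (fun i => rot (u i) g x) ω (𝓝 (g (θ x))) :=
    tendsto_apply_of_mem_closure (fun i => norm_unitary_conj_le (u i) x) (fun ξ η => hθ x ξ η)
      (conj_limit_mem_closure hg)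
  have h3 : Tendsto (fun i => rot (u i) g) ω (𝓝 (M.vectorFunctional ξ η)) := by
    rw [tendsto_iff_norm_sub_tendsto_zero] at hg ⊢
    refine hg.congr fun i => ?_
    rw [← (rot (u i)).norm_map, map_sub, rot_rot_inv, norm_sub_rev]
  rw [h1]
  exact tendsto_nhds_unique h2
    (((ContinuousLinearMap.apply ℂ ℂ x).continuous.tendsto _).comp h3)

/-- A weak limit of the automorphisms `x ↦ u x u*` is multiplicative if it is a norm limit on
functionals. Indeed `f (θ x θ y)` is the limit of `f (u x u* θ y) = (f ∘ Ad u) (x (u* θ y u))`,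
where `u* θ y u → y` weakly. -/
theorem conj_limit_mul
    (hθ : ∀ x ξ η, Tendsto (fun i => rot (u i) (M.vectorFunctional ξ η) x) ω
      (𝓝 (M.vectorFunctional ξ η (θ x))))
    (hθ' : ∀ x ξ η, Tendsto (fun i => rot (u i)⁻¹ (M.vectorFunctional ξ η) x) ω
      (𝓝 (M.vectorFunctional ξ η (θ' x))))
    (hu : ∀ ξ η, ∃ g, Tendsto (fun i => rot (u i) (M.vectorFunctional ξ η)) ω (𝓝 g))
    (hu' : ∀ ξ η, ∃ g, Tendsto (fun i => rot (u i)⁻¹ (M.vectorFunctional ξ η)) ω (𝓝 g))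
    (x y : M.Elem) : θ (x * y) = θ x * θ y := by
  refine ext_vectorFunctional fun ξ η => ?_
  obtain ⟨g, hg⟩ := hu ξ η
  have h1 : M.vectorFunctional ξ η (θ (x * y)) = g (x * y) :=
    tendsto_nhds_unique (hθ (x * y) ξ η)
      (((ContinuousLinearMap.apply ℂ ℂ (x * y)).continuous.tendsto g).comp hg)
  let z : ι → M.Elem := fun i =>
    ((u i)⁻¹ : unitary M.Elem) * θ y * star (((u i)⁻¹ : unitary M.Elem) : M.Elem)
  have hz : ∀ i, ‖z i‖ ≤ ‖θ y‖ := fun i => norm_unitary_conj_le _ _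
  have hzl : ∀ ξ η, Tendsto (fun i => M.vectorFunctional ξ η (z i)) ω
      (𝓝 (M.vectorFunctional ξ η y)) := fun ξ η => by
    have := hθ' (θ y) ξ η
    rw [conj_limit_left_inverse hθ hθ' hu' y] at this
    exact this
  have h2 : Tendsto (fun i => g (x * z i)) ω (𝓝 (g (x * y))) := by
    refine tendsto_apply_of_mem_closure (f := g) (C := ‖x‖ * ‖θ y‖)
      (fun i => (norm_mul_le _ _).trans (by gcongr; exact hz i)) (fun ξ η => ?_)
      (conj_limit_mem_closure hg)
    have e : ∀ w : M.Elem, M.vectorFunctional ξ η (x * w) =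
        M.vectorFunctional ξ (star x.1 η) w := fun w =>
      (ContinuousLinearMap.adjoint_inner_left x.1 (w.1 ξ) η).symm
    simp only [e]
    exact hzl _ _
  have h3 : Tendsto (fun i => (rot (u i) (M.vectorFunctional ξ η) - g) (x * z i)) ω (𝓝 0) := by
    rw [tendsto_iff_norm_sub_tendsto_zero] at hg
    have := hg.mul_const (‖x‖ * ‖θ y‖)
    rw [zero_mul] at this
    rw [tendsto_zero_iff_norm_tendsto_zero]
    refine squeeze_zero (fun _ => norm_nonneg _) (fun i => ?_) this
    refine (ContinuousLinearMap.le_opNorm _ _).trans ?_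
    gcongr
    exact (norm_mul_le _ _).trans (by gcongr; exact hz i)
  have h4 := h3.add h2
  rw [zero_add] at h4
  rw [h1]
  refine tendsto_nhds_unique h4 ((hθ x ((θ y).1 ξ) η).congr fun i => ?_)
  rw [_root_.sub_apply, sub_add_cancel, rot_apply, rot_apply]
  have e : (u i : M.Elem) * (x * z i) * star (u i : M.Elem) =
      (u i : M.Elem) * x * star (u i : M.Elem) * θ y := by
    have e1 : (((u i)⁻¹ : unitary M.Elem) : M.Elem) = star (u i : M.Elem) := rfl
    simp only [z, e1, star_star, mul_assoc, Unitary.mul_star_self_of_mem (u i).2, mul_one]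
  rw [e]
  rfl

/-- If the inner automorphisms `Ad uᵢ` and their inverses converge in norm on vector functionals,
then they converge to an automorphism. -/
theorem exists_aut_of_tendsto (ω : Ultrafilter ι) (u : ι → unitary M.Elem)
    (hu : ∀ ξ η, ∃ g, Tendsto (fun i => rot (u i) (M.vectorFunctional ξ η)) ω (𝓝 g))
    (hu' : ∀ ξ η, ∃ g, Tendsto (fun i => rot (u i)⁻¹ (M.vectorFunctional ξ η)) ω (𝓝 g)) :
    ∃ θ : M.Elem ≃⋆ₐ[ℂ] M.Elem,
      (∀ ξ η, Tendsto (fun i => rot (u i) (M.vectorFunctional ξ η)) ω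
        (𝓝 (pull θ (M.vectorFunctional ξ η)))) ∧
      ∀ ξ η, Tendsto (fun i => rot (u i)⁻¹ (M.vectorFunctional ξ η)) ω
        (𝓝 (pull θ.symm (M.vectorFunctional ξ η))) := by
  obtain ⟨θ, hθ⟩ := exists_conj_limit ω u
  obtain ⟨θ', hθ'⟩ := exists_conj_limit ω fun i => (u i)⁻¹
  have hinv := conj_limit_left_inverse hθ hθ' hu'
  have hinv' := conj_limit_left_inverse hθ' (θ' := θ) (by simpa only [inv_inv] using hθ)
    (by simpa only [inv_inv] using hu)
  have hg : ∀ {v : ι → unitary M.Elem} {β : M.Elem → M.Elem}, (∀ x ξ η,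
      Tendsto (fun i => rot (v i) (M.vectorFunctional ξ η) x) ω
        (𝓝 (M.vectorFunctional ξ η (β x)))) → ∀ {ξ η g},
      Tendsto (fun i => rot (v i) (M.vectorFunctional ξ η)) ω (𝓝 g) →
      ∀ x, g x = M.vectorFunctional ξ η (β x) := fun hβ ξ η g h x =>
    tendsto_nhds_unique (((ContinuousLinearMap.apply ℂ ℂ x).continuous.tendsto g).comp h)
      (hβ x ξ η)
  let Θ : M.Elem ≃⋆ₐ[ℂ] M.Elem :=
    { toFun := θ
      invFun := θ'
      left_inv := hinv
      right_inv := hinv'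
      map_mul' := conj_limit_mul hθ hθ' hu hu'
      map_add' := fun x y => ext_vectorFunctional fun ξ η => by
        obtain ⟨g, h⟩ := hu ξ η
        rw [map_add, ← hg hθ h, ← hg hθ h, ← hg hθ h, map_add]
      map_smul' := fun c x => ext_vectorFunctional fun ξ η => by
        obtain ⟨g, h⟩ := hu ξ η
        rw [map_smul, ← hg hθ h, ← hg hθ h, map_smul]
      map_star' := fun x => ext_vectorFunctional fun ξ η => by
        have e : ∀ (ξ η : H) (z : M.Elem), M.vectorFunctional ξ η (star z) =
            star (M.vectorFunctional η ξ z) := fun ξ η z => by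
          rw [vectorFunctional_apply, vectorFunctional_apply, coe_star_elem,
            ContinuousLinearMap.adjoint_inner_right]
          exact (inner_conj_symm _ _).symm
        rw [e]
        refine tendsto_nhds_unique (hθ (star x) ξ η) ((hθ x η ξ).star.congr fun i => ?_)
        rw [rot_apply, rot_apply, ← e]
        simp only [star_mul, star_star, mul_assoc] }
  refine ⟨Θ, fun ξ η => ?_, fun ξ η => ?_⟩
  · obtain ⟨g, h⟩ := hu ξ η
    have e : pull Θ (M.vectorFunctional ξ η) = g := ContinuousLinearMap.ext fun x =>
      (hg hθ h x).symm
    rwa [e]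
  · obtain ⟨g, h⟩ := hu' ξ η
    have e : pull Θ.symm (M.vectorFunctional ξ η) = g := ContinuousLinearMap.ext fun x =>
      (hg hθ' h x).symm
    rwa [e]

end Limit

end VonNeumannAlgebra


/-! ### The unitary group of a full factor -/

namespace VonNeumannAlgebra

variable {H : Type*} [NormedAddCommGroup H] [InnerProductSpace ℂ H] [CompleteSpace H]
  {M : VonNeumannAlgebra H}

theorem mem_innerAut_of_tendsto (hM : M.IsFull) {ι : Type*} {l : Filter ι}
    [l.NeBot] {u : ι → unitary M.Elem} {θ : M.Elem ≃⋆ₐ[ℂ] M.Elem}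
    (h : ∀ f ∈ M.predual, Tendsto (fun i => rot (u i) f) l (𝓝 (pull θ f))) :
    θ ∈ M.innerAut := by
  let _ := M.uTopology
  refine hM.2.mem_of_tendsto (f := fun i => Unitary.conjStarAlgAut ℂ M.Elem (u i)) (b := l) ?_
    (Eventually.of_forall fun i => ⟨u i, rfl⟩)
  rw [nhds_induced, tendsto_comap_iff, tendsto_pi_nhds]
  exact fun f => h f.1 f.2

theorem tendsto_rot_mul {ι : Type*} {l : Filter ι} {a b : ι → unitary M.Elem}
    {a₀ b₀ : unitary M.Elem}
    (ha : ∀ ξ η, Tendsto (fun i => rot (a i) (M.vectorFunctional ξ η)) l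
        (𝓝 (rot a₀ (M.vectorFunctional ξ η))))
    (hb : ∀ ξ η, Tendsto (fun i => rot (b i) (M.vectorFunctional ξ η)) l
        (𝓝 (rot b₀ (M.vectorFunctional ξ η)))) (ξ η : H) :
    Tendsto (fun i => rot (a i * b i) (M.vectorFunctional ξ η)) l
      (𝓝 (rot (a₀ * b₀) (M.vectorFunctional ξ η))) := by
  have h1 := hb (star (a₀ : M.Elem).1 ξ) (star (a₀ : M.Elem).1 η)
  rw [← rot_vectorFunctional, ← rot_mul] at h1
  refine (tendsto_iff_of_dist ?_).mp h1
  refine (tendsto_iff_dist_tendsto_zero.mp (ha ξ η)).congr fun i => ?_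
  rw [rot_mul, (rot (b i)).dist_map, dist_comm]

theorem norm_unitary_apply (u : unitary M.Elem) (ζ : H) : ‖(u : M.Elem).1 ζ‖ = ‖ζ‖ :=
  ContinuousLinearMap.norm_map_of_mem_unitary (u := (u : M.Elem).1)
    (Unitary.mem_iff.mpr ⟨congrArg Subtype.val (Unitary.star_mul_self_of_mem u.2),
      congrArg Subtype.val (Unitary.mul_star_self_of_mem u.2)⟩) ζ

theorem norm_inv_mul_apply_sub (a b : unitary M.Elem) (ζ : H) :
    ‖((a⁻¹ * b : unitary M.Elem) : M.Elem).1 ζ - ζ‖ =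
      ‖(b : M.Elem).1 ζ - (a : M.Elem).1 ζ‖ := by
  rw [← norm_unitary_apply a, map_sub]
  have h : (a : M.Elem).1 (((a⁻¹ * b : unitary M.Elem) : M.Elem).1 ζ) = (b : M.Elem).1 ζ := by
    conv_rhs => rw [← mul_inv_cancel_left a b]
    rfl
  rw [h]

/-- The unitary group of `M`, with the topology that `u ↦ Ad u` induces from the u-topology of
`Aut(M)`. It is a type synonym, since `unitary M.Elem` carries the norm topology. -/
def AdUnitary (M : VonNeumannAlgebra H) : Type _ := unitary M.Elem

namespace AdUnitary

noncomputable instance : Group (AdUnitary M) := inferInstanceAs (Group (unitary M.Elem))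

/-- The underlying unitary. -/
noncomputable def val (u : AdUnitary M) : unitary M.Elem := u

theorem val_mul (u v : AdUnitary M) : (u * v).val = u.val * v.val := rfl

theorem val_inv (u : AdUnitary M) : u⁻¹.val = u.val⁻¹ := rfl

variable [TopologicalSpace.SeparableSpace H]

/-- The images of countably many vector functionals under `Ad u` and its inverse. They define the
uniform structure; both `u` and its inverse enter, so that it can be complete. -/
noncomputable def orbit (u : AdUnitary M) :
    ℕ × ℕ → (M.Elem →L[ℂ] ℂ) × (M.Elem →L[ℂ] ℂ) := fun i =>
  let f := M.vectorFunctional (TopologicalSpace.denseSeq H i.1) (TopologicalSpace.denseSeq H i.2)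
  (rot u.val f, rot u.val⁻¹ f)

noncomputable instance : UniformSpace (AdUnitary M) := UniformSpace.comap orbit inferInstance

theorem isUniformInducing_orbit : IsUniformInducing (orbit (M := M)) := ⟨rfl⟩

instance : (uniformity (AdUnitary M)).IsCountablyGenerated :=
  inferInstanceAs (Filter.comap _ _).IsCountablyGenerated

/-- Convergence in `AdUnitary M`, tested on all vector functionals. -/
theorem tendsto_nhds {ι : Type*} {l : Filter ι} {u : ι → AdUnitary M} {v : AdUnitary M} :
    Tendsto u l (𝓝 v) ↔
      (∀ ξ η, Tendsto (fun i => rot (u i).val (M.vectorFunctional ξ η)) l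
        (𝓝 (rot v.val (M.vectorFunctional ξ η)))) ∧
      ∀ ξ η, Tendsto (fun i => rot (u i).val⁻¹ (M.vectorFunctional ξ η)) l
        (𝓝 (rot v.val⁻¹ (M.vectorFunctional ξ η))) := by
  have key : ∀ (p : ι → unitary M.Elem) (q : unitary M.Elem),
      (∀ m n, Tendsto (fun i => rot (p i) (M.vectorFunctional (TopologicalSpace.denseSeq H m)
        (TopologicalSpace.denseSeq H n))) l (𝓝 (rot q (M.vectorFunctional
          (TopologicalSpace.denseSeq H m) (TopologicalSpace.denseSeq H n))))) →
      ∀ ξ η, Tendsto (fun i => rot (p i) (M.vectorFunctional ξ η)) l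
        (𝓝 (rot q (M.vectorFunctional ξ η))) := fun p q h ξ η =>
    tendsto_sub_nhds_zero_iff.mp (tendsto_pull_sub_of_dense (q := fun _ =>
      Unitary.conjStarAlgAut ℂ M.Elem q) (TopologicalSpace.denseRange_denseSeq H)
      (fun m n => tendsto_sub_nhds_zero_iff.mpr (h m n)) (vectorFunctional_mem M ξ η))
  rw [isUniformInducing_orbit.isInducing.tendsto_nhds_iff, tendsto_pi_nhds]
  simp only [nhds_prod_eq, orbit, Prod.forall, Function.comp_def]
  constructor
  · intro h
    exact ⟨key _ _ fun m n => tendsto_fst.comp (h m n), key _ _ fun m n => tendsto_snd.comp (h m n)⟩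
  · exact fun h m n => (h.1 _ _).prodMk (h.2 _ _)

instance : IsTopologicalGroup (AdUnitary M) where
  continuous_mul := continuous_iff_continuousAt.mpr fun p => by
    have h1 := tendsto_nhds.mp (continuous_fst.tendsto p)
    have h2 := tendsto_nhds.mp (continuous_snd.tendsto p)
    refine tendsto_nhds.mpr ⟨tendsto_rot_mul h1.1 h2.1, ?_⟩
    simp only [val_mul, mul_inv_rev]
    exact tendsto_rot_mul h2.2 h1.2
  continuous_inv := continuous_iff_continuousAt.mpr fun p => by
    have h := tendsto_nhds.mp (Filter.tendsto_id (x := 𝓝 p))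
    refine tendsto_nhds.mpr ⟨h.2, ?_⟩
    simp only [val_inv, inv_inv]
    exact h.1

/-- For a full factor the group `AdUnitary M` is complete: limits of inner automorphisms are
inner. -/
theorem completeSpace (hM : M.IsFull) : CompleteSpace (AdUnitary M) := by
  refine completeSpace_iff_ultrafilter.mpr fun ω hω => ?_
  obtain ⟨A, hA⟩ := CompleteSpace.complete (isUniformInducing_orbit.cauchy_map_iff.mpr hω)
  have hA' := tendsto_pi_nhds.mp (show Tendsto orbit (ω : Filter (AdUnitary M)) (𝓝 A) from hA)
  have key : ∀ p : AdUnitary M → unitary M.Elem,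
      (∀ m n, ∃ g, Tendsto (fun i => rot (p i) (M.vectorFunctional (TopologicalSpace.denseSeq H m)
        (TopologicalSpace.denseSeq H n))) ω (𝓝 g)) →
      ∀ ξ η, ∃ g, Tendsto (fun i => rot (p i) (M.vectorFunctional ξ η)) ω (𝓝 g) := by
    intro p h ξ η
    refine cauchy_iff_exists_le_nhds.mp (cauchy_map_iff.mpr ⟨inferInstance, ?_⟩)
    rw [uniformity_eq_comap_nhds_zero_swapped, tendsto_comap_iff]
    refine tendsto_pull_sub_of_dense (l := (ω : Filter (AdUnitary M)) ×ˢ ω)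
      (p := fun i => Unitary.conjStarAlgAut ℂ M.Elem (p i.1))
      (q := fun i => Unitary.conjStarAlgAut ℂ M.Elem (p i.2))
      (TopologicalSpace.denseRange_denseSeq H) (fun m n => ?_) (vectorFunctional_mem M ξ η)
    obtain ⟨g, hg⟩ := h m n
    have := (hg.comp tendsto_fst).sub (hg.comp tendsto_snd)
    rwa [sub_self] at this
  obtain ⟨θ, h1, h2⟩ := exists_aut_of_tendsto ω val
    (key _ fun m n => ⟨_, (continuous_fst.tendsto _).comp (hA' (m, n))⟩)
    (key _ fun m n => ⟨_, (continuous_snd.tendsto _).comp (hA' (m, n))⟩)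
  obtain ⟨v, rfl⟩ := mem_innerAut_of_tendsto hM (l := (ω : Filter (AdUnitary M))) (u := val)
    (θ := θ) fun f hf => tendsto_sub_nhds_zero_iff.mp
      (tendsto_pull_sub_of_dense (q := fun _ => θ) (TopologicalSpace.denseRange_denseSeq H)
        (fun m n => tendsto_sub_nhds_zero_iff.mpr (h1 _ _)) hf)
  refine ⟨v, ?_⟩
  refine tendsto_nhds.mpr ⟨h1, fun ξ η => ?_⟩
  rw [Unitary.conjStarAlgAut_symm] at h2
  exact h2 ξ η

end AdUnitary

/-- Unitaries of a factor that implement the same automorphism are proportional. -/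
theorem IsFactor.exists_eq_smul_of_conj_eq (hM : M.IsFactor) {u v : unitary M.Elem}
    (h : Unitary.conjStarAlgAut ℂ M.Elem u = Unitary.conjStarAlgAut ℂ M.Elem v) :
    ∃ c : ℂ, ‖c‖ ≤ 1 ∧ (u : M.Elem).1 = c • (v : M.Elem).1 := by
  obtain ⟨x, rfl⟩ : ∃ x, u = v * x := ⟨v⁻¹ * u, (mul_inv_cancel_left _ _).symm⟩
  rw [map_mul, mul_eq_left] at h
  have hx : ∀ z : M.Elem, z * (x : M.Elem) = (x : M.Elem) * z := fun z => by
    have h1 : (x : M.Elem) * z * star (x : M.Elem) = z := DFunLike.congr_fun h z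
    conv_lhs => rw [← h1]
    rw [mul_assoc _ (star _), Unitary.star_mul_self_of_mem x.2, mul_one]
  obtain ⟨c, hc⟩ := hM.2 (x : M.Elem).1 (x : M.Elem).2
    (mem_commutant_iff.mpr fun y hy => congrArg Subtype.val (hx ⟨y, hy⟩))
  refine ⟨c, ?_, ?_⟩
  · have := hM.1
    have h1 : ‖(x : M.Elem).1‖ ≤ 1 := norm_coe_unitary_le x
    rwa [hc, norm_smul, norm_one, mul_one] at h1
  · change (v : M.Elem).1 * (x : M.Elem).1 = _
    rw [hc, mul_smul_comm, mul_one]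

/-- A sequence of unitaries converges strongly if it moves each vector of a dense sequence along a
sequence with eventually summable steps. -/
theorem exists_strong_limit_of_summable {e : ℕ → H} (he : DenseRange e) {w : ℕ → unitary M.Elem}
    {b : ℕ → ℝ} (hb : Summable b)
    (h : ∀ m n, m < n → dist ((w n : M.Elem).1 (e m)) ((w (n + 1) : M.Elem).1 (e m)) ≤ b n) :
    ∃ S : H →L[ℂ] H, ∀ v, Tendsto (fun n => (w n : M.Elem).1 v) atTop (𝓝 (S v)) := by
  refine exists_strong_limit (C := 1) (fun n => norm_coe_unitary_le (w n)) fun ζ => ?_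
  let T : ℕ × ℕ → H →ₗ[ℂ] H := fun p =>
    ((w p.1 : M.Elem).1 - (w p.2 : M.Elem).1).toLinearMap
  have hcl : IsClosed (nullSubmodule (atTop ×ˢ atTop) T : Set H) :=
    isClosed_nullSubmodule _ T (C := 2) fun p v => by
      refine (norm_sub_le _ _).trans (le_of_eq ?_)
      exact (congrArg₂ _ (norm_unitary_apply _ v) (norm_unitary_apply _ v)).trans
        (two_mul _).symm
  refine he.induction_on (p := fun ζ => ζ ∈ nullSubmodule (atTop ×ˢ atTop) T) ζ hcl fun m => ?_
  have hs : CauchySeq fun n => (w n : M.Elem).1 (e m) :=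
    cauchySeq_of_summable_dist ((summable_nat_add_iff (m + 1)).mp
      (Summable.of_nonneg_of_le (fun _ => dist_nonneg) (fun n => h m (n + (m + 1)) (by lia))
        ((summable_nat_add_iff (m + 1)).mpr hb)))
  have h2 := (cauchy_map_iff.mp hs).2
  rw [uniformity_eq_comap_nhds_zero_swapped, tendsto_comap_iff] at h2
  exact h2

/-- In a full factor, unitaries that almost commute with the algebra are almost scalar. This is
the open mapping theorem for the map `u ↦ Ad u` onto the closed group of inner automorphisms. -/
theorem IsFull.nearly_scalar_mem_nhds_one [TopologicalSpace.SeparableSpace H] (hM : M.IsFull)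
    {ε : ℝ} (hε : 0 < ε) {κ : Type*} [Fintype κ] (η : κ → H) :
    {u : AdUnitary M | ∃ c : ℂ, ∀ j, ‖(u.val : M.Elem).1 (η j) - c • η j‖ ≤ ε} ∈ 𝓝 1 := by
  have := AdUnitary.completeSpace hM
  have : BaireSpace (AdUnitary M) := by
    let _ : PseudoMetricSpace (AdUnitary M) := UniformSpace.pseudoMetricSpace _
    infer_instance
  let e := TopologicalSpace.denseSeq H
  -- a product of elements `a⁻¹ b` with `a, b ∈ V n` moves each `η j` by at most `∑ 2 δ n = ε`
  let δ : ℕ → ℝ := fun n => ε / 4 / 2 ^ n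
  have hδ : ∀ n, 0 < δ n := fun n => by positivity
  let V : ℕ → Set (AdUnitary M) := fun n => {v | (∀ j, ‖(v.val : M.Elem).1 (η j) - η j‖ ≤ δ n) ∧
    ∀ m : Fin n, ‖(v.val : M.Elem).1 (e m) - e m‖ ≤ δ n}
  have hV : ∀ n, ∃ s : Set (AdUnitary M), s.Countable ∧ ∀ g, ∃ h ∈ s, h⁻¹ * g ∈ V n := by
    intro n
    let Q : AdUnitary M → (κ → H) × (Fin n → H) := fun v =>
      (fun j => (v.val : M.Elem).1 (η j), fun m => (v.val : M.Elem).1 (e m))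
    -- the translate `g V n` only depends on the images of finitely many vectors under `g`
    obtain ⟨t, ht, htc, htd⟩ := (TopologicalSpace.IsSeparable.of_separableSpace
      (Set.range Q)).exists_countable_dense_subset
    choose! r hr using fun x (hx : x ∈ t) => ht hx
    refine ⟨r '' t, htc.image r, fun g => ?_⟩
    obtain ⟨x, hx, hxd⟩ := Metric.mem_closure_iff.mp (htd ⟨g, rfl⟩) (δ n) (hδ n)
    refine ⟨r x, ⟨x, hx, rfl⟩, ?_⟩
    rw [← hr x hx, Prod.dist_eq, max_lt_iff] at hxd
    have hb : ∀ ζ, ‖(((r x)⁻¹ * g).val : M.Elem).1 ζ - ζ‖ =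
        dist ((g.val : M.Elem).1 ζ) (((r x).val : M.Elem).1 ζ) := fun ζ => by
      rw [dist_eq_norm, AdUnitary.val_mul, AdUnitary.val_inv, norm_inv_mul_apply_sub]
    exact ⟨fun j => (hb _).trans_le ((dist_le_pi_dist _ _ j).trans hxd.1.le),
      fun m => (hb _).trans_le ((dist_le_pi_dist _ _ m).trans hxd.2.le)⟩
  obtain ⟨O, hO, h⟩ := exists_seq_tendsto_of_countable_cover V hV
  filter_upwards [hO] with u hu
  obtain ⟨w, hw0, hw, hwu⟩ := h u hu
  have hstep : ∀ n ζ, (∀ v ∈ V n, ‖(v.val : M.Elem).1 ζ - ζ‖ ≤ δ n) →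
      dist (((w n).val : M.Elem).1 ζ) (((w (n + 1)).val : M.Elem).1 ζ) ≤ ε / 2 / 2 ^ n := by
    intro n ζ hζ
    obtain ⟨a, ha, b, hb, hab⟩ := hw n
    have e1 : ((w (n + 1)).val : M.Elem).1 ζ =
        ((w n).val : M.Elem).1 (((a.val⁻¹ * b.val : unitary M.Elem) : M.Elem).1 ζ) := by
      rw [hab]; rfl
    rw [e1, dist_comm, dist_eq_norm, ← map_sub, norm_unitary_apply, norm_inv_mul_apply_sub]
    calc _ = ‖((b.val : M.Elem).1 ζ - ζ) - ((a.val : M.Elem).1 ζ - ζ)‖ := by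
          rw [sub_sub_sub_cancel_right]
      _ ≤ δ n + δ n := (norm_sub_le _ _).trans (add_le_add (hζ b hb) (hζ a ha))
      _ = ε / 2 / 2 ^ n := by simp only [δ]; ring
  obtain ⟨S, hS⟩ := exists_strong_limit_of_summable (w := fun n => (w n).val)
    (TopologicalSpace.denseRange_denseSeq H) (summable_geometric_two' ε)
    fun m n hmn => hstep n (e m) fun v hv => hv.2 ⟨m, hmn⟩
  -- the products converge strongly, and their limit implements `Ad u⁻¹` as well
  have hlim := (AdUnitary.tendsto_nhds.mp hwu).2
  obtain ⟨v, hvS, hv⟩ := exists_unitary_of_strong_limit (u := fun n => (w n).val)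
    (θ := Unitary.conjStarAlgAut ℂ M.Elem u.val⁻¹)
    (fun ξ η z => ((ContinuousLinearMap.apply ℂ ℂ z).continuous.tendsto _).comp (hlim ξ η)) hS
  obtain ⟨c, hc1, hc⟩ := hM.1.exists_eq_smul_of_conj_eq
    (inv_injective ((map_inv _ u.val).symm.trans (hv.trans (map_inv _ v))))
  refine ⟨c, fun j => ?_⟩
  have huv : (u.val : M.Elem).1 (η j) = c • S (η j) := by rw [hc, hvS]; rfl
  have h0 : dist (((w 0).val : M.Elem).1 (η j)) (S (η j)) ≤ ε :=
    dist_le_of_le_geometric_two_of_tendsto₀ (fun n => hstep n (η j) fun v hv => hv.1 j) (hS (η j))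
  have h1 : ((w 0).val : M.Elem).1 (η j) = η j := by rw [hw0]; rfl
  rw [h1, dist_comm, dist_eq_norm] at h0
  rw [huv, ← smul_sub, norm_smul]
  exact (mul_le_of_le_one_left (norm_nonneg _) hc1).trans h0

end VonNeumannAlgebra


/-! ### Asymptotically central families in a full factor -/

namespace VonNeumannAlgebra

section Central

variable {H : Type*} [NormedAddCommGroup H] [InnerProductSpace ℂ H] [CompleteSpace H]
  {M : VonNeumannAlgebra H} {ι : Type*} {l : Filter ι}

theorem IsAsympCentral.add {x y : ι → M.Elem} (hx : IsAsympCentral l x)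
    (hy : IsAsympCentral l y) : IsAsympCentral l fun i => x i + y i := by
  obtain ⟨C, hC⟩ := hx.bounded
  obtain ⟨D, hD⟩ := hy.bounded
  refine ⟨⟨C + D, fun i => (norm_add_le _ _).trans (add_le_add (hC i) (hD i))⟩, fun f hf => ?_⟩
  have h := (hx.tendsto f hf).add (hy.tendsto f hf)
  rw [add_zero] at h
  refine squeeze_zero (fun _ => norm_nonneg _) (fun i => ?_) h
  have e : comm f (x i + y i) = comm f (x i) + comm f (y i) := by
    ext z
    simp only [comm_apply, _root_.add_apply, mul_add, add_mul, map_add]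
    ring
  rw [e]
  exact norm_add_le _ _

theorem comm_smul (f : M.Elem →L[ℂ] ℂ) (c : ℂ) (x : M.Elem) :
    comm f (c • x) = c • comm f x := by
  ext z
  simp only [comm_apply, _root_.smul_apply, mul_smul_comm, smul_mul_assoc, map_smul, smul_sub]

theorem IsAsympCentral.const_smul {x : ι → M.Elem} (hx : IsAsympCentral l x) (c : ℂ) :
    IsAsympCentral l fun i => c • x i := by
  obtain ⟨C, hC⟩ := hx.bounded
  refine ⟨⟨‖c‖ * C, fun i => (norm_smul_le _ _).trans (by gcongr; exact hC i)⟩, fun f hf => ?_⟩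
  have h := (hx.tendsto f hf).const_mul ‖c‖
  rw [mul_zero] at h
  exact h.congr fun i => by rw [comm_smul, norm_smul]

/-- The operator `x - ⟨η₀, x η₀⟩`, which vanishes for scalars `x` if `η₀` is a unit vector. -/
noncomputable def offScalar (η₀ : H) : (H →L[ℂ] H) →ₗ[ℂ] (H →L[ℂ] H) where
  toFun x := x - ⟪η₀, x η₀⟫_ℂ • (1 : H →L[ℂ] H)
  map_add' x y := by
    rw [_root_.add_apply, inner_add_right, add_smul]; abel
  map_smul' c x := by
    rw [_root_.smul_apply, inner_smul_right, mul_smul, ← smul_sub]; rfl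

omit [CompleteSpace H] in
theorem offScalar_apply (η₀ : H) (x : H →L[ℂ] H) (η : H) :
    offScalar η₀ x η = x η - ⟪η₀, x η₀⟫_ℂ • η := rfl

theorem AdUnitary.tendsto_one [TopologicalSpace.SeparableSpace H] {u : ι → AdUnitary M}
    (h : ∀ ξ η, Tendsto (fun i => ‖comm (M.vectorFunctional ξ η) ((u i).val : M.Elem)‖) l (𝓝 0)) :
    Tendsto u l (𝓝 1) := by
  have h1 : (1 : AdUnitary M).val = 1 := rfl
  refine AdUnitary.tendsto_nhds.mpr ⟨fun ξ η => ?_, fun ξ η => ?_⟩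
  · rw [h1, rot_one, tendsto_iff_norm_sub_tendsto_zero]
    exact (h ξ η).congr fun i => (norm_rot_sub _ _).symm
  · rw [h1, inv_one, rot_one, tendsto_iff_norm_sub_tendsto_zero]
    exact (h ξ η).congr fun i => by rw [norm_rot_inv_sub, norm_rot_sub]

theorem IsFull.tendsto_offScalar_of_unitary [TopologicalSpace.SeparableSpace H] (hM : M.IsFull)
    {u : ι → unitary M.Elem} (h : IsAsympCentral l fun i => (u i : M.Elem)) {η₀ : H}
    (hη₀ : ‖η₀‖ = 1) (η : H) :
    Tendsto (fun i => offScalar η₀ (u i : M.Elem).1 η) l (𝓝 0) := by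
  have h1 : Tendsto (β := AdUnitary M) u l (𝓝 1) := AdUnitary.tendsto_one fun ξ η =>
    h.tendsto _ (vectorFunctional_mem M ξ η)
  rw [Metric.tendsto_nhds]
  intro ε hε
  have hδ : 0 < ε / 2 / (1 + ‖η‖) := by positivity
  filter_upwards [h1 (hM.nearly_scalar_mem_nhds_one hδ ![η₀, η])] with i ⟨c, hc⟩
  have hc0 : ‖(u i : M.Elem).1 η₀ - c • η₀‖ ≤ ε / 2 / (1 + ‖η‖) := hc 0
  have hc1 : ‖(u i : M.Elem).1 η - c • η‖ ≤ ε / 2 / (1 + ‖η‖) := hc 1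
  have h2 : ‖⟪η₀, (u i : M.Elem).1 η₀⟫_ℂ - c‖ ≤ ε / 2 / (1 + ‖η‖) := by
    have e : ⟪η₀, (u i : M.Elem).1 η₀⟫_ℂ - c = ⟪η₀, (u i : M.Elem).1 η₀ - c • η₀⟫_ℂ := by
      rw [inner_sub_right, inner_smul_right, inner_self_eq_norm_sq_to_K, hη₀]; simp
    rw [e]
    refine (norm_inner_le_norm _ _).trans ?_
    rwa [hη₀, one_mul]
  rw [dist_zero_right, offScalar_apply]
  calc _ = ‖((u i : M.Elem).1 η - c • η) - (⟪η₀, (u i : M.Elem).1 η₀⟫_ℂ - c) • η‖ := by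
        rw [sub_smul, sub_sub_sub_cancel_right]
    _ ≤ ε / 2 / (1 + ‖η‖) + ε / 2 / (1 + ‖η‖) * ‖η‖ := by
        refine (norm_sub_le _ _).trans (add_le_add hc1 ?_)
        rw [norm_smul]
        gcongr
    _ = ε / 2 := by field_simp
    _ < ε := half_lt_self hε

/-- The Cayley transform `u = (a + i) (a - i)⁻¹` of a self-adjoint element `a`, written as
`1 - 2i (i - a)⁻¹`. -/
theorem exists_cayley {A : Type*} [CStarAlgebra A] {a : A} (ha : IsSelfAdjoint a) :
    ∃ (u : unitary A) (c : A), c * (Complex.I • 1 - a) = 1 ∧ (Complex.I • 1 - a) * c = 1 ∧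
      (u : A) = 1 - (2 * Complex.I) • c := by
  have hI : IsUnit (Complex.I • 1 - a) := by
    by_contra hn
    have h1 : Complex.I ∈ spectrum ℂ a := by
      rw [spectrum.mem_iff, Algebra.algebraMap_eq_smul_one]
      exact hn
    have h2 := congrArg Complex.im (ha.mem_spectrum_eq_re h1)
    simp at h2
  obtain ⟨U, hU⟩ := hI
  obtain ⟨b, hb⟩ : ∃ b : A, b = Complex.I • 1 - a := ⟨_, rfl⟩
  obtain ⟨c, hc⟩ : ∃ c : A, c = ((U⁻¹ : Aˣ) : A) := ⟨_, rfl⟩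
  rw [← hb] at hU ⊢
  have h1 : c * b = 1 := by rw [← hU, hc]; exact U.inv_mul
  have h2 : b * c = 1 := by rw [← hU, hc]; exact U.mul_inv
  have hbs : star b = b - (2 * Complex.I) • 1 := by
    rw [hb, star_sub, star_smul, star_one, ha.star_eq]
    simp only [Complex.star_def, Complex.conj_I, neg_smul, two_mul, add_smul]
    abel
  have hs2 : star b * star c = 1 := by rw [← star_mul, h1, star_one]
  have hu : 1 - (2 * Complex.I) • c = c * star b := by
    rw [hbs, mul_sub, h1, mul_smul_comm, mul_one]
  have hu' : 1 - (2 * Complex.I) • c = star b * c := by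
    rw [hbs, sub_mul, h2, smul_mul_assoc, one_mul]
  refine ⟨⟨1 - (2 * Complex.I) • c, Unitary.mem_iff.mpr ⟨?_, ?_⟩⟩, c, h1, h2, rfl⟩
  · nth_rw 1 [hu]
    rw [hu', star_mul, star_star]
    calc b * star c * (star b * c) = b * star (b * c) * c := by rw [star_mul]; simp only [mul_assoc]
      _ = 1 := by rw [h2, star_one, mul_one, h2]
  · nth_rw 1 [hu]
    rw [hu', star_mul, star_star]
    calc c * star b * (star c * b) = c * (star b * star c) * b := by simp only [mul_assoc]
      _ = 1 := by rw [hs2, mul_one, h1]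

/-- The Cayley transforms of an asymptotically central self-adjoint family are asymptotically
central unitaries, hence asymptotically scalar, and so are the resolvents `(i - a)⁻¹`. -/
theorem IsFull.tendsto_offScalar_of_isSelfAdjoint [TopologicalSpace.SeparableSpace H]
    (hM : M.IsFull) {a : ι → M.Elem} (h : IsAsympCentral l a) (ha : ∀ i, IsSelfAdjoint (a i))
    {η₀ : H} (hη₀ : ‖η₀‖ = 1) (η : H) :
    Tendsto (fun i => offScalar η₀ (a i).1 η) l (𝓝 0) := by
  obtain ⟨C, hC⟩ := h.bounded
  choose u c hcb hbc hu using fun i => exists_cayley (ha i)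
  set b : ι → M.Elem := fun i => Complex.I • 1 - a i with hb
  have hcu : ∀ i, c i = (-(Complex.I / 2)) • (1 - (u i : M.Elem)) := fun i => by
    rw [hu, sub_sub_cancel, smul_smul]
    have : -(Complex.I / 2) * (2 * Complex.I) = 1 := by
      linear_combination -Complex.I_mul_I
    rw [this, one_smul]
  have hcn : ∀ i, ‖c i‖ ≤ 1 := fun i => by
    have h1 : ‖(1 : M.Elem)‖ ≤ 1 := norm_coe_unitary_le 1
    rw [hcu, norm_smul]
    have h2 : ‖-(Complex.I / 2)‖ = 1 / 2 := by simp
    rw [h2]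
    have := (norm_sub_le (1 : M.Elem) (u i)).trans (add_le_add h1 (norm_coe_unitary_le (u i)))
    linarith
  have hcc : ∀ f i, ‖comm f (c i)‖ ≤ ‖comm f (a i)‖ := fun f i => by
    refine ContinuousLinearMap.opNorm_le_bound _ (norm_nonneg _) fun z => ?_
    have e : comm f (c i) z = comm f (a i) (c i * z * c i) := by
      have e1 : a i = Complex.I • 1 - b i := by rw [hb]; simp
      rw [comm_apply, comm_apply, e1, mul_sub, sub_mul, mul_smul_comm, smul_mul_assoc, mul_one,
        one_mul, mul_assoc (c i * z), hcb, mul_one, mul_assoc (c i), ← mul_assoc (b i), hbc,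
        one_mul, map_sub, map_sub]
      ring
    rw [e]
    refine (ContinuousLinearMap.le_opNorm _ _).trans ?_
    gcongr
    calc ‖c i * z * c i‖ ≤ ‖c i‖ * ‖z‖ * ‖c i‖ :=
          (norm_mul_le _ _).trans (by gcongr; exact norm_mul_le _ _)
      _ ≤ 1 * ‖z‖ * 1 := by gcongr <;> exact hcn i
      _ = ‖z‖ := by ring
  have hcent : IsAsympCentral l c := ⟨⟨1, hcn⟩, fun f hf =>
    squeeze_zero (fun _ => norm_nonneg _) (hcc f) (h.tendsto f hf)⟩
  have h1c : IsAsympCentral l fun _ => (1 : M.Elem) := ⟨⟨_, fun _ => le_rfl⟩, fun f _ => by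
    have : comm f 1 = 0 := by ext z; simp [comm_apply]
    simpa [this] using tendsto_const_nhds⟩
  have hucent : IsAsympCentral l fun i => (u i : M.Elem) := by
    have := h1c.add (hcent.const_smul (-(2 * Complex.I)))
    simpa only [neg_smul, ← sub_eq_add_neg, ← hu] using this
  -- `cᵢ` is asymptotically scalar, hence so is its inverse `bᵢ`
  set μ : ι → ℂ := fun i => ⟪η₀, (c i).1 η₀⟫_ℂ with hμ
  have hc : ∀ η, Tendsto (fun i => (c i).1 η - μ i • η) l (𝓝 0) := fun η => by
    have h2 := (hM.tendsto_offScalar_of_unitary hucent hη₀ η).const_smul (Complex.I / 2)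
    rw [smul_zero] at h2
    refine h2.congr fun i => ?_
    have e1 : offScalar η₀ (1 : H →L[ℂ] H) = 0 := by
      ext v
      rw [offScalar_apply, one_apply_eq_self, one_apply_eq_self, inner_self_eq_norm_sq_to_K, hη₀]
      simp
    have e2 : (c i).1 = (-(Complex.I / 2)) • (1 - (u i : M.Elem).1) := congrArg Subtype.val (hcu i)
    change _ = offScalar η₀ (c i).1 η
    rw [e2, map_smul, map_sub, e1, zero_sub, smul_neg, neg_smul, neg_neg]; rfl
  have hbn : ∀ i, ‖(b i).1‖ ≤ 1 + C := fun i => by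
    have h1 : ‖(1 : M.Elem)‖ ≤ 1 := norm_coe_unitary_le 1
    refine (norm_sub_le (Complex.I • (1 : M.Elem)) (a i)).trans (add_le_add ?_ (hC i))
    rw [norm_smul, Complex.norm_I, one_mul]; exact h1
  have hb1 : ∀ η, Tendsto (fun i => η - μ i • (b i).1 η) l (𝓝 0) := fun η => by
    have h2 := (tendsto_zero_iff_norm_tendsto_zero.mp (hc η)).const_mul (1 + C)
    rw [mul_zero] at h2
    rw [tendsto_zero_iff_norm_tendsto_zero]
    refine squeeze_zero (fun _ => norm_nonneg _) (fun i => ?_) h2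
    have e : η - μ i • (b i).1 η = (b i).1 ((c i).1 η - μ i • η) := by
      rw [map_sub, map_smul]
      have : (b i).1 ((c i).1 η) = η := congrArg (fun x : M.Elem => x.1 η) (hbc i)
      rw [this]
    rw [e]
    exact ((b i).1.le_opNorm _).trans (by gcongr; exact hbn i)
  set ν : ι → ℂ := fun i => ⟪η₀, (b i).1 η₀⟫_ℂ with hν
  have hνn : ∀ i, ‖ν i‖ ≤ 1 + C := fun i => by
    refine (norm_inner_le_norm _ _).trans ?_
    rw [hη₀, one_mul]
    exact ((b i).1.le_opNorm _).trans (by rw [hη₀, mul_one]; exact hbn i)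
  have hμν : Tendsto (fun i => 1 - μ i * ν i) l (𝓝 0) := by
    have h2 := tendsto_const_nhds (x := η₀).inner (𝕜 := ℂ) (hb1 η₀)
    rw [inner_zero_right] at h2
    refine h2.congr fun i => ?_
    rw [inner_sub_right, inner_smul_right, inner_self_eq_norm_sq_to_K, hη₀]; simp [hν]
  have key : Tendsto (fun i => (b i).1 η - ν i • η) l (𝓝 0) := by
    have h2 := ((tendsto_zero_iff_norm_tendsto_zero.mp hμν).mul_const ((1 + C) * ‖η‖)).add
      ((tendsto_zero_iff_norm_tendsto_zero.mp (hb1 η)).const_mul (1 + C))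
    rw [zero_mul, mul_zero, add_zero] at h2
    rw [tendsto_zero_iff_norm_tendsto_zero]
    refine squeeze_zero (fun _ => norm_nonneg _) (fun i => ?_) h2
    have e : (b i).1 η - ν i • η = (1 - μ i * ν i) • (b i).1 η - ν i • (η - μ i • (b i).1 η) := by
      module
    rw [e]
    refine (norm_sub_le _ _).trans (add_le_add ?_ ?_)
    · rw [norm_smul]
      gcongr
      exact ((b i).1.le_opNorm _).trans (by gcongr; exact hbn i)
    · rw [norm_smul]
      gcongr
      exact hνn i
  have h3 := key.neg
  rw [neg_zero] at h3
  refine h3.congr fun i => ?_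
  have e1 : (a i).1 = Complex.I • 1 - (b i).1 := by
    have : a i = Complex.I • 1 - b i := by rw [hb]; simp
    exact congrArg Subtype.val this
  rw [offScalar_apply, e1]
  simp only [_root_.sub_apply, _root_.smul_apply, one_apply_eq_self, inner_sub_right,
    inner_smul_right, inner_self_eq_norm_sq_to_K, hη₀]
  simp only [hν, Complex.coe_algebraMap, Complex.ofReal_one, one_pow, mul_one]
  module

/-- In a full factor every asymptotically central family is asymptotically scalar. -/
theorem IsFull.tendsto_offScalar [TopologicalSpace.SeparableSpace H] (hM : M.IsFull)
    {y : ι → M.Elem} (h : IsAsympCentral l y) {η₀ : H} (hη₀ : ‖η₀‖ = 1) (η : H) :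
    Tendsto (fun i => offScalar η₀ (y i).1 η) l (𝓝 0) := by
  have h1 : IsAsympCentral l fun i => y i + star (y i) := h.add h.star_family
  have h2 : IsAsympCentral l fun i => Complex.I • (y i + (-1 : ℂ) • star (y i)) :=
    (h.add (h.star_family.const_smul (-1))).const_smul Complex.I
  have h3 := ((hM.tendsto_offScalar_of_isSelfAdjoint h1 (fun i => by
    rw [isSelfAdjoint_iff, star_add, star_star, add_comm]) hη₀ η).const_smul (1 / 2 : ℂ)).add
    ((hM.tendsto_offScalar_of_isSelfAdjoint h2 (fun i => by
      rw [isSelfAdjoint_iff, star_smul, star_add, star_smul, star_star, star_neg, star_one,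
        Complex.star_def, Complex.conj_I]
      module) hη₀ η).const_smul (-(Complex.I / 2)))
  rw [smul_zero, smul_zero, add_zero] at h3
  refine h3.congr fun i => ?_
  have e : (y i).1 = (1 / 2 : ℂ) • (y i + star (y i)).1 +
      (-(Complex.I / 2)) • (Complex.I • (y i + (-1 : ℂ) • star (y i))).1 := by
    refine congrArg Subtype.val (?_ : y i = (1 / 2 : ℂ) • (y i + star (y i)) +
      (-(Complex.I / 2)) • (Complex.I • (y i + (-1 : ℂ) • star (y i))))
    have hI : -(Complex.I / 2) * Complex.I = 1 / 2 := by
      linear_combination -(1 / 2 : ℂ) * Complex.I_mul_I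
    rw [smul_smul, hI]
    module
  rw [e, map_add, map_smul, map_smul]; rfl

end Central

end VonNeumannAlgebra

/-! ### Fullness from asymptotically central families -/

/-- If `aⱼ - cᵢⱼ aᵢ → 0` along `ω × ω` for scalars `cᵢⱼ` that converge along `ω` for each fixed `i`,
then `a` is Cauchy along `ω`. -/
theorem Ultrafilter.tendsto_sub_of_tendsto_sub_smul {ι V : Type*} [NormedAddCommGroup V]
    [NormedSpace ℂ V] (ω : Ultrafilter ι) {a : ι → V} {c : ι → ι → ℂ}
    (hc : ∀ i, ∃ z, Tendsto (c i) ω (𝓝 z))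
    (h : Tendsto (fun p : ι × ι => a p.2 - c p.1 p.2 • a p.1)
      ((ω : Filter ι) ×ˢ (ω : Filter ι)) (𝓝 0)) :
    Tendsto (fun p : ι × ι => a p.1 - a p.2) ((ω : Filter ι) ×ˢ (ω : Filter ι)) (𝓝 0) := by
  rw [Metric.tendsto_nhds]
  intro ε hε
  obtain ⟨t, ht, htp⟩ := (eventually_prod_self_iff (r := fun i j =>
    dist (a j - c i j • a i) 0 < ε / 3)).mp (Metric.tendsto_nhds.mp h (ε / 3) (by positivity))
  obtain ⟨i, hi⟩ := ω.nonempty_of_mem ht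
  obtain ⟨z, hz⟩ := hc i
  have h1 : Tendsto (fun p : ι × ι => (c i p.1 - c i p.2) • a i)
      ((ω : Filter ι) ×ˢ (ω : Filter ι)) (𝓝 0) := by
    have := ((hz.comp tendsto_fst).sub (hz.comp (tendsto_snd (f := (ω : Filter ι))))).smul_const
      (a i)
    rwa [sub_self, zero_smul] at this
  filter_upwards [Metric.tendsto_nhds.mp h1 (ε / 3) (by positivity), prod_mem_prod ht ht]
    with p hp hpt
  have h2 : ∀ j ∈ t, ‖a j - c i j • a i‖ < ε / 3 := fun j hj => by
    simpa only [dist_zero_right] using htp i hi j hj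
  rw [dist_zero_right] at hp ⊢
  calc _ = ‖(a p.1 - c i p.1 • a i) - (a p.2 - c i p.2 • a i) + (c i p.1 - c i p.2) • a i‖ := by
        congr 1; module
    _ < ε / 3 + ε / 3 + ε / 3 :=
        (norm_add_le _ _).trans_lt (add_lt_add ((norm_sub_le _ _).trans_lt
          (add_lt_add (h2 _ hpt.1) (h2 _ hpt.2))) hp)
    _ = ε := by ring

namespace VonNeumannAlgebra

section Closed

variable {H : Type*} [NormedAddCommGroup H] [InnerProductSpace ℂ H] [CompleteSpace H]
  {M : VonNeumannAlgebra H}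

theorem norm_comm_mul_inv (u v : unitary M.Elem) (f : M.Elem →L[ℂ] ℂ) :
    ‖comm f ((u * v⁻¹ : unitary M.Elem) : M.Elem)‖ = ‖rot u f - rot v f‖ := by
  rw [← norm_rot_sub, rot_mul, ← (rot v).norm_map (_ - f), map_sub, rot_rot_inv]

/-- If every asymptotically central family is asymptotically scalar, then the inner automorphisms
form a closed subgroup: if `Ad u → θ`, then `u u'*` is asymptotically scalar, hence `u*` converges
strongly, once its phase is fixed by passing to an ultrafilter. -/
theorem isClosed_innerAut {η₀ : H}
    (h : ∀ (ω : Ultrafilter (unitary M.Elem × unitary M.Elem))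
      (x : unitary M.Elem × unitary M.Elem → M.Elem), IsAsympCentral (ω : Filter _) x → ∀ η,
      Tendsto (fun i => offScalar η₀ (x i).1 η) ω (𝓝 0)) :
    IsClosed[M.uTopology] M.innerAut := by
  let _ := M.uTopology
  refine isClosed_of_closure_subset fun θ hθ => ?_
  let F := comap (Unitary.conjStarAlgAut ℂ M.Elem) (𝓝 θ)
  have : F.NeBot := comap_neBot_iff_frequently.mpr (mem_closure_iff_frequently.mp hθ)
  let ω := Ultrafilter.of F
  have hω : ∀ f ∈ M.predual, Tendsto (fun u => rot u f) ω (𝓝 (pull θ f)) := fun f hf => by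
    have h1 : Tendsto (Unitary.conjStarAlgAut ℂ M.Elem) ω (𝓝 θ) :=
      tendsto_comap.mono_left (Ultrafilter.of_le F)
    rw [nhds_induced, tendsto_comap_iff, tendsto_pi_nhds] at h1
    exact h1 ⟨f, hf⟩
  have hcent : IsAsympCentral (↑ω ×ˢ ↑ω : Filter (unitary M.Elem × unitary M.Elem))
      fun p => ((p.1 * p.2⁻¹ : unitary M.Elem) : M.Elem) := by
    refine ⟨⟨1, fun p => norm_coe_unitary_le _⟩, fun f hf => ?_⟩
    have h1 : Tendsto (fun p : unitary M.Elem × unitary M.Elem => rot p.1 f) (↑ω ×ˢ ↑ω)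
        (𝓝 (pull θ f)) := (hω f hf).comp tendsto_fst
    have h2 : Tendsto (fun p : unitary M.Elem × unitary M.Elem => rot p.2 f) (↑ω ×ˢ ↑ω)
        (𝓝 (pull θ f)) := (hω f hf).comp tendsto_snd
    have h3 := (h1.sub h2).norm
    rw [sub_self, norm_zero] at h3
    simpa only [norm_comm_mul_inv] using h3
  have hprod : ∀ η, Tendsto (fun p : unitary M.Elem × unitary M.Elem =>
      offScalar η₀ ((p.1 * p.2⁻¹ : unitary M.Elem) : M.Elem).1 η) (↑ω ×ˢ ↑ω) (𝓝 0) := fun η =>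
    tendsto_iff_ultrafilter _ _ _ |>.mpr fun g hg =>
      h g _ ⟨hcent.bounded, fun f hf => (hcent.tendsto f hf).mono_left hg⟩ η
  let c : unitary M.Elem → unitary M.Elem → ℂ := fun u u' =>
    ⟪η₀, ((u * u'⁻¹ : unitary M.Elem) : M.Elem).1 η₀⟫_ℂ
  have hc : ∀ u, ∃ a, Tendsto (c u) ω (𝓝 a) := fun u =>
    ω.exists_tendsto_of_norm_le (C := ‖η₀‖ * ‖η₀‖) fun u' =>
      (norm_inner_le_norm _ _).trans (by rw [norm_unitary_apply])
  have hcau : ∀ η, Tendsto (fun p : unitary M.Elem × unitary M.Elem =>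
      ((p.1⁻¹ : unitary M.Elem) : M.Elem).1 η - ((p.2⁻¹ : unitary M.Elem) : M.Elem).1 η)
      (↑ω ×ˢ ↑ω) (𝓝 0) := by
    intro η
    refine ω.tendsto_sub_of_tendsto_sub_smul (c := c)
      (a := fun u => ((u⁻¹ : unitary M.Elem) : M.Elem).1 η) hc ?_
    refine tendsto_zero_iff_norm_tendsto_zero.mpr
      ((tendsto_zero_iff_norm_tendsto_zero.mp (hprod η)).congr fun p => ?_)
    rw [← norm_unitary_apply p.1⁻¹, offScalar_apply, map_sub, map_smul]
    congr 2
    conv_rhs => rw [← inv_mul_cancel_left p.1 p.2⁻¹]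
    rfl
  obtain ⟨S, hS⟩ := exists_strong_limit (l := (ω : Filter (unitary M.Elem)))
    (T := fun u => ((u⁻¹ : unitary M.Elem) : M.Elem).1) (C := 1)
    (fun u => norm_coe_unitary_le u⁻¹) hcau
  obtain ⟨w, -, hw⟩ := exists_unitary_of_strong_limit (u := fun u : unitary M.Elem => u⁻¹) (θ := θ)
    (l := (ω : Filter (unitary M.Elem))) (fun ξ η z => by
      simp only [inv_inv]
      exact ((ContinuousLinearMap.apply ℂ ℂ z).continuous.tendsto _).comp
        (hω _ (vectorFunctional_mem M ξ η))) hS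
  exact ⟨w⁻¹, hw.symm⟩

end Closed

section TensorFull

variable {H K : Type*} [NormedAddCommGroup H] [InnerProductSpace ℂ H] [CompleteSpace H]
  [NormedAddCommGroup K] [InnerProductSpace ℂ K] [CompleteSpace K]
  [TopologicalSpace.SeparableSpace K]

/-- Asymptotically central families of `M ⊗ N` are strongly asymptotic to `1 ⊗ y` with `y`
asymptotically central in `N`, hence asymptotically scalar when `N` is full. -/
theorem IsFull.tensor {M : VonNeumannAlgebra H} {N : VonNeumannAlgebra K} (hM : M.IsFactor)
    (hcpt : ∃ S ∈ closure (M.commSpan : Set (H →L[ℂ] H)), IsCompactOperator S ∧ S ≠ 0)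
    (hN : N.IsFull) : (M.tensor N).IsFull := by
  have := hM.1
  have := hN.1.1
  obtain ⟨ξ₀, hξ₀⟩ := exists_norm_eq H zero_le_one
  obtain ⟨η₀, hη₀⟩ := exists_norm_eq K zero_le_one
  refine ⟨hM.tensor hN.1, isClosed_innerAut (η₀ := tm ξ₀ η₀) fun ω x hx ζ => ?_⟩
  obtain ⟨C, hC⟩ := hx.bounded
  have hy := hx.sliceElem ξ₀ ξ₀
  let T : unitary (M.tensor N).Elem × unitary (M.tensor N).Elem →
      HilbertTensor H K →ₗ[ℂ] HilbertTensor H K := fun i =>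
    (ampR H K (offScalar η₀ (slice ξ₀ ξ₀ (x i).1))).toLinearMap
  have hT : ζ ∈ nullSubmodule (ω : Filter _) T := by
    refine mem_of_tm_mem _ (isClosed_nullSubmodule _ T (C := 2 * C) fun i v => ?_) (fun ξ η => ?_) ζ
    · refine ((ampR H K _).le_opNorm v).trans ?_
      gcongr
      refine (norm_ampR_le _).trans ?_
      have h1 : ‖slice ξ₀ ξ₀ (x i).1‖ ≤ C := by
        refine (norm_slice_le _ _ _).trans ?_
        rw [hξ₀, one_mul, one_mul]; exact hC i
      refine ContinuousLinearMap.opNorm_le_bound _ (by linarith [(norm_nonneg _).trans h1])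
        fun η => ?_
      rw [offScalar_apply]
      calc _ ≤ ‖slice ξ₀ ξ₀ (x i).1 η‖ + ‖⟪η₀, slice ξ₀ ξ₀ (x i).1 η₀⟫_ℂ‖ * ‖η‖ :=
            (norm_sub_le _ _).trans (by rw [norm_smul])
        _ ≤ C * ‖η‖ + C * ‖η‖ := by
            gcongr
            · exact ((slice ξ₀ ξ₀ (x i).1).le_opNorm η).trans (by gcongr)
            · refine (norm_inner_le_norm _ _).trans ?_
              rw [hη₀, one_mul]
              exact ((slice ξ₀ ξ₀ (x i).1).le_opNorm η₀).trans (by rwa [hη₀, mul_one])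
        _ = 2 * C * ‖η‖ := by ring
    · have h1 := ((leftT ξ : K →L[ℂ] HilbertTensor H K).continuous.tendsto 0).comp
        (hN.tendsto_offScalar hy hη₀ η)
      rw [map_zero] at h1
      exact h1.congr fun i => (ampR_tm _ ξ η).symm
  have h2 := (hx.tendsto_sub_ampR_slice hM hcpt ω hξ₀ ζ).add hT
  rw [add_zero] at h2
  refine h2.congr fun i => ?_
  rw [offScalar_apply, ← inner_slice]
  change ((x i).1 - ampR H K (slice ξ₀ ξ₀ (x i).1)) ζ +
    ampR H K (slice ξ₀ ξ₀ (x i).1 - ⟪η₀, slice ξ₀ ξ₀ (x i).1 η₀⟫_ℂ • 1) ζ = _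
  rw [map_sub, map_smul, map_one, _root_.sub_apply, _root_.sub_apply, _root_.smul_apply,
    one_apply_eq_self, sub_add_sub_cancel]

end TensorFull

end VonNeumannAlgebra

theorem mainTheorem8
    {H K : Type*}
    [NormedAddCommGroup H] [InnerProductSpace ℂ H] [CompleteSpace H]
    [TopologicalSpace.SeparableSpace H]
    [NormedAddCommGroup K] [InnerProductSpace ℂ K] [CompleteSpace K]
    [TopologicalSpace.SeparableSpace K]
    (M : VonNeumannAlgebra H) (N : VonNeumannAlgebra K)
    (hM : M.IsFactor) (hN : N.IsFactor)
    (φ : M.Elem →ₚ[ℂ] ℂ) (hφ : VonNeumannAlgebra.IsFaithfulNormalState φ)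
    (hcpt : ∃ T ∈ VonNeumannAlgebra.cstarLeftRight φ, IsCompactOperator T ∧ T ≠ 0) :
    (∀ ω : Ultrafilter ℕ, (ω : Filter ℕ) ≤ Filter.cofinite →
      ∃ Φ : N.AsymptoticCentralizer ω →ₐ[ℂ] (M.tensor N).AsymptoticCentralizer ω,
        (∀ x : N.centralizingSeq ω,
          ∃ h : (fun n => M.oneTensor ((x : ℕ → N.Elem) n)) ∈ (M.tensor N).centralizingSeq ω,
            Φ (N.toAsymptoticCentralizer ω x) =
              (M.tensor N).toAsymptoticCentralizer ω ⟨_, h⟩) ∧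
        Function.Surjective Φ) ∧
    (N.IsFull → (M.tensor N).IsFull) := by
  have hcpt' := VonNeumannAlgebra.exists_compact_commSpan φ hφ.normal hcpt
  refine ⟨fun ω _ => ⟨VonNeumannAlgebra.oneTensorAsymptotic M N ω, fun x =>
    ⟨(VonNeumannAlgebra.oneTensorSeq M N ω x).2, rfl⟩,
    VonNeumannAlgebra.oneTensorAsymptotic_surjective hM hcpt' ω⟩, fun hfull => ?_⟩
  exact hfull.tensor hM hcpt'
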